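/- Let $A_1,\dots,A_k$ be invertible real $2\times 2$ matrices with strictly positive entries and Euclidean operator norm less than $1$, let $d_1,\dots,d_k\in\mathbb R^2$, and put $T_i(x)=A_ix+d_i$. Let $\phi_i:\mathbb{PR}^1\to\mathbb{PR}^1$ be the projective map induced by $A_i^{-1}$, and write $\phi_{a_n\cdots a_1}=\phi_{a_n}\circ\cdots\circ\phi_{a_1}$. Let $\mu$ be the Bernoulli measure on $\Sigma=\{1,\dots,k\}^{\mathbb N}$ with weights $p_1,\dots,p_k>0$, $\sum_i p_i=1$. Let $\mathcal Q_2\subset\mathbb{PR}^1$ be the set of lines through the origin contained in $\{(x,y):xy\le 0\}$, and let $\mu_F$ be the Furstenberg measure, that is, the Borel probability measure on $\mathbb{PR}^1$ supported in $\mathcal Q_2$ with $\mu_F(U)=\sum_i p_i\,\mu_F(\phi_i^{-1}(U))$ for all Borel sets $U$. If all the $A_i$ have a common eigenvector for their eigenvalues of largest modulus, let $B$ be $\mathbb{PR}^1$ without the direction of this eigenvector; otherwise let $B=\mathbb{PR}^1$. For $\theta\in\mathbb{PR}^1$ let $\pi_\theta$ be the orthogonal projection along the direction $\theta$ onto the line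 perpendicular to it, let $D$ be the closed unit disk, and put $$|a_1\cdots a_n|_\theta=-\log_b\Big(\tfrac12\,\big|\pi_\theta\big(T_{a_1}\circ\cdots\circ T_{a_n}(D)\big)\big|\Big),$$ where $|\cdot|$ on the right is the length of a segment. Here $b=2$, except in the resonant case, where $b=3$: the resonant case is that in which all the $A_i$ have a common eigenvector for their eigenvalues of largest modulus, these eigenvalues are all rational powers of $2$, and the $A_i$ have no common eigenvector with direction in $\mathcal Q_2$. For integers $N,j\ge1$ let $n_j=n_j(\underline a,N,\theta)$ be the natural number with $$|a_1\cdots a_{n_j-1}|_\theta<Nj\le|a_1\cdots a_{n_j}|_\theta .$$ Then there exists a Borel probability measure $\nu_F$ on $\mathbb{PR}^1$, equivalent to $\mu_F$ (each is absolutely continuous with respect to the other), such that for all $\theta\in B$, all integers $N\ge1$ and $\mu$-almost all $\underline a\in\Sigma$, the sequence $(\phi_{a_{n_i}\cdots a_1}(\theta))_{i=1}^\infty$ equidistributes with respect to $\nu_F$, i.e. $$\lim_{I\to\infty}\frac1I\Big|\big\{i\in\{1,\dots,I\}:\phi_{a_{n_i}\cdots a_1}(\theta)\in S\big\}\Big|=\nu_F(S)$$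 for all intervals $S\subset\mathbb{PR}^1$ with $\nu_F(\partial S)=0$, and indeed for all intervals $S\subset\mathbb{PR}^1$ whatsoever if the $A_i$ have no common eigenvector with direction in $\mathcal Q_2$. -/

import Mathlib

open MeasureTheory Filter Topology
open scoped LinearAlgebra.Projectivization

noncomputable section

/-- The Euclidean plane. -/
abbrev Plane : Type := EuclideanSpace ℝ (Fin 2)

/-- The real projective line: lines through the origin of the plane. -/
abbrev RP1 : Type := ℙ ℝ Plane

/-- The quotient topology of the punctured plane. -/
instance RP1.instTopologicalSpace : TopologicalSpace RP1 :=
  TopologicalSpace.coinduced (fun v : {v : Plane // v ≠ 0} => Projectivization.mk' ℝ v) inferInstance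

/-- The Borel σ-algebra of the projective line. -/
instance RP1.instMeasurableSpace : MeasurableSpace RP1 := borel RP1

instance RP1.instBorelSpace : BorelSpace RP1 := ⟨rfl⟩

namespace SelfAffine

lemma unitVec_ne_zero (t : ℝ) : (!₂[Real.cos t, Real.sin t] : Plane) ≠ 0 := by
  intro h
  have h0 : Real.cos t = 0 := by simpa using congrArg (fun v : Plane => v 0) h
  have h1 : Real.sin t = 0 := by simpa using congrArg (fun v : Plane => v 1) h
  have := Real.sin_sq_add_cos_sq t
  rw [h0, h1] at this
  norm_num at this

/-- The line at angle `t` to the horizontal axis. -/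
def lineAt (t : ℝ) : RP1 := Projectivization.mk ℝ !₂[Real.cos t, Real.sin t] (unitVec_ne_zero t)

/-- Intervals (arcs) of the projective line: the lines whose angles run through an interval of `ℝ`
of any kind (open, closed, half-open, bounded or not, possibly empty or a point). -/
def IsInterval (S : Set RP1) : Prop := ∃ J : Set ℝ, J.OrdConnected ∧ S = lineAt '' J

/-- The linear map of the plane given by a matrix. -/
def lin (M : Matrix (Fin 2) (Fin 2) ℝ) : Plane →ₗ[ℝ] Plane := Matrix.toEuclideanLin M

lemma lin_injective (g : GL (Fin 2) ℝ) : Function.Injective (lin g.val) := by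
  intro x y h
  have h' : Matrix.mulVec g.val x.ofLp = Matrix.mulVec g.val y.ofLp := by
    simpa [lin, Matrix.toLpLin_apply] using h
  have hinj : Function.Injective (Matrix.mulVec g.val) :=
    Matrix.mulVec_injective_iff_isUnit.2 g.isUnit
  exact WithLp.ofLp_injective 2 (hinj h')

variable {k : ℕ}

/-- The projective map `φ_i` induced by the inverse matrix `A_i⁻¹`. -/
def phi (A : Fin k → GL (Fin 2) ℝ) (i : Fin k) : RP1 → RP1 :=
  Projectivization.map (lin (A i)⁻¹.val) (lin_injective (A i)⁻¹)

/-- `orbit A a θ n` is `φ_{a_n ⋯ a_1}(θ)`; the first letter `a_1` is `a 0`. -/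
def orbit (A : Fin k → GL (Fin 2) ℝ) (a : ℕ → Fin k) (θ : RP1) : ℕ → RP1
  | 0 => θ
  | n + 1 => phi A (a n) (orbit A a θ n)

/-- The composition `T_{a_1} ∘ ⋯ ∘ T_{a_n}` of the maps `T_i x = A_i x + d_i`. -/
def wordMap (A : Fin k → GL (Fin 2) ℝ) (d : Fin k → Plane) (a : ℕ → Fin k) : ℕ → Plane → Plane
  | 0 => id
  | n + 1 => wordMap A d a n ∘ fun x => lin (A (a n)).val x + d (a n)

/-- The length `|π_θ(T_{a_1 ⋯ a_n}(D))|` of the orthogonal projection along the line `θ` (onto the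
perpendicular line) of the ellipse `T_{a_1 ⋯ a_n}(D)`, where `D` is the unit disk. The projection
is a segment, so that its length is its diameter. -/
def projLength (A : Fin k → GL (Fin 2) ℝ) (d : Fin k → Plane) (θ : RP1) (a : ℕ → Fin k)
    (n : ℕ) : ℝ :=
  Metric.diam (θ.submoduleᗮ.starProjection '' (wordMap A d a n '' Metric.closedBall 0 1))

/-- The length function `|a_1 ⋯ a_n|_θ`, with logarithms to base `b`. -/
def wordLength (b : ℝ) (A : Fin k → GL (Fin 2) ℝ) (d : Fin k → Plane) (θ : RP1) (a : ℕ → Fin k)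
    (n : ℕ) : ℝ :=
  -Real.logb b (projLength A d θ a n / 2)

/-- The index `n_j(a, N, θ)`: the first `n` with `N j ≤ |a_1 ⋯ a_n|_θ`. As the lengths start at `0`
and increase strictly to infinity, it is for `N, j ≥ 1` the only `n ≥ 1` with
`|a_1 ⋯ a_{n-1}|_θ < N j ≤ |a_1 ⋯ a_n|_θ`. -/
def stopIndex (b : ℝ) (A : Fin k → GL (Fin 2) ℝ) (d : Fin k → Plane) (θ : RP1) (N : ℕ)
    (a : ℕ → Fin k) (j : ℕ) : ℕ :=
  sInf {n : ℕ | (N * j : ℝ) ≤ wordLength b A d θ a n}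

/-- The vectors of the line `θ` are eigenvectors of `M` for an eigenvalue `l` of largest modulus. -/
def IsMaxEigendirection (M : Matrix (Fin 2) (Fin 2) ℝ) (θ : RP1) (l : ℝ) : Prop :=
  (∀ v ∈ θ.submodule, lin M v = l • v) ∧
    ∀ m : ℝ, Module.End.HasEigenvalue (lin M) m → |m| ≤ |l|

/-- The set `B`: all directions other than a common maximal eigendirection of all the `A_i`. -/
def goodDirections (A : Fin k → GL (Fin 2) ℝ) : Set RP1 :=
  {θ | ¬ ∀ i, ∃ l, IsMaxEigendirection (A i).val θ l}

/-- The lines in the closed second quadrant, `{(x, y) : x y ≤ 0}`. -/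
def secondQuadrant : Set RP1 := {θ | ∀ v ∈ θ.submodule, v 0 * v 1 ≤ 0}

/-- All `A_i` have a common eigendirection in the closed second quadrant (that is, the direction of
their eigenvectors for the eigenvalue of smaller modulus is the same). -/
def HasCommonMinorDirection (A : Fin k → GL (Fin 2) ℝ) : Prop :=
  ∃ x ∈ secondQuadrant, ∀ i, phi A i x = x

/-- All `A_i` have a common maximal eigendirection, the corresponding eigenvalues are all rational
powers of `2`, and the `A_i` have no other common eigendirection. -/
def IsResonant (A : Fin k → GL (Fin 2) ℝ) : Prop :=
  (∃ θ : RP1, ∀ i, ∃ q : ℚ, IsMaxEigendirection (A i).val θ ((2 : ℝ) ^ (q : ℝ))) ∧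
    ¬ HasCommonMinorDirection A

open Classical in
/-- The base of the logarithms in the length function: `2`, and `3` in the resonant case. -/
def logBase (A : Fin k → GL (Fin 2) ℝ) : ℝ := if IsResonant A then 3 else 2

/-- The Bernoulli measure on `Σ` with weights `p`. -/
def bernoulli (p : PMF (Fin k)) : Measure (ℕ → Fin k) := Measure.infinitePi fun _ => p.toMeasure

/-- The Furstenberg measure: the stationary probability measure for the maps `φ_i`, chosen with
probabilities `p_i`, that is supported in the closed second quadrant, which all `φ_i` map into
its interior. -/
structure IsFurstenberg (A : Fin k → GL (Fin 2) ℝ) (p : PMF (Fin k)) (μF : Measure RP1) : Prop where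
  prob : IsProbabilityMeasure μF
  supp : μF secondQuadrantᶜ = 0
  stationary : ∀ U : Set RP1, MeasurableSet U → μF U = ∑ i, p i * μF (phi A i ⁻¹' U)

/-- The proportion of the terms `x_1, x_2, …, x_I` in `S` tends to `ν S` as `I → ∞`. -/
def HasFrequency (x : ℕ → RP1) (ν : Measure RP1) (S : Set RP1) : Prop :=
  Tendsto (fun I : ℕ => ({i : ℕ | 1 ≤ i ∧ i ≤ I ∧ x i ∈ S}.ncard : ℝ) / I) atTop (𝓝 (ν.real S))

/-- Equidistribution with respect to `ν`, tested on the intervals with `ν`-null boundary. -/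
def Equidistributes (x : ℕ → RP1) (ν : Measure RP1) : Prop :=
  ∀ S, IsInterval S → ν (frontier S) = 0 → HasFrequency x ν S

end SelfAffine

end

/-! Write a line θ as the line perpendicular to a vector w. Then `phi A i` sends it to the line
perpendicular to A_iᵀ w, and |a_1 ⋯ a_n|_θ = log_b |w| - log_b |A_{a_n}ᵀ ⋯ A_{a_1}ᵀ w|. So length is
an additive cocycle over the projective action. In the coordinate z of the lines perpendicular to
(1, e^z), orbit and length together form a random walk (z, s) ↦ (ψ_i z, s + f_i z), where the ψ_i
are uniform contractions (Birkhoff) and the f_i are Lipschitz and bounded away from 0. A good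
direction enters this chart almost surely (`ae_exists_line`): on the open first quadrant the maps
φ_i are expanding.

The index n_j is the first passage of s over N j. A step from s to s' passes ⌊s'/N⌋ - ⌊s/N⌋ = (s' -
s)/N - {s'/N} + {s/N} multiples of N. Hence the average of g over the stopping times is a quotient
of two averages over all steps, weighted by this number (`mean_firstIndex`). If z and s mod N are
asymptotically independent, with s mod N uniform, both fractional parts contribute half of ∫ g dm,
where m is the stationary measure, and they cancel (`ae_mean_floor`). What remains is ∫ ∑ p_i f_i(z)
g(ψ_i z) dm(z), divided by its value at g = 1. This defines ν_F; it is equivalent to m because the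
f_i are positive.

Independence is tested on the functions g(z) exp(2πi n s/N). A law of large numbers for martingale
differences reduces it to the uniform convergence of Cesàro averages of the Markov operator
(`ae_tendsto_average`). On functions of frequency t this operator is the twisted transfer operator,
and by equicontinuity its averages vanish unless it has a nonzero continuous fixed function
(`twist_cesaro`).

Such a function h would have constant modulus on an invariant set E and satisfy exp(i t f_i) h ∘ ψ_i
= h there. Without a common minor direction E has two points. Comparing h with powers of the pairing
⟨(1, e^ξ), (1, e^z)⟩ then shows that all A_i share their Perron direction
(`fixed_eq_of_cohomological`). Evaluation at the fixed points makes all Perron eigenvalues rational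
powers of b, which the choice of b excludes (`noTwistedFixed`). With a common minor direction m is a
point mass, to which every orbit in the chart converges, and no such argument is needed. -/

noncomputable section

namespace SelfAffine

/-! ### Bernoulli measures, random walks and the law of large numbers. -/

section Probability

variable {k : ℕ}

/-- Prepend a letter to a sequence. -/
def consSeq {α : Type*} (i : α) (a : ℕ → α) : ℕ → α
  | 0 => i
  | n + 1 => a n

lemma measurable_consSeq (i : Fin k) : Measurable (consSeq i : (ℕ → Fin k) → ℕ → Fin k) := by
  refine measurable_pi_lambda _ fun n => ?_
  cases n with
  | zero => exact measurable_const
  | succ n => exact measurable_pi_apply n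

instance bernoulli_isProbabilityMeasure (p : PMF (Fin k)) :
    IsProbabilityMeasure (bernoulli p) := by
  unfold bernoulli; infer_instance

/-- Self-similarity of the Bernoulli measure under prepending letters. -/
lemma bernoulli_eq_sum (p : PMF (Fin k)) :
    bernoulli p = ∑ i, p i • (bernoulli p).map (consSeq i) := by
  classical
  symm
  refine Measure.eq_infinitePi (fun _ : ℕ => p.toMeasure) fun s t ht => ?_
  -- The box is filled up with full factors to an initial segment of coordinates, so that coordinate
  -- 0, the prepended letter, splits off.
  obtain ⟨M, hM⟩ : ∃ M, s ⊆ Finset.range (M + 1) :=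
    ⟨s.sup id, fun n hn => Finset.mem_range_succ_iff.2 (Finset.le_sup (f := id) hn)⟩
  set t' : ℕ → Set (Fin k) := fun n => if n ∈ s then t n else Set.univ with ht'
  have hbox : Set.pi (s : Set ℕ) t = Set.pi (Finset.range (M + 1) : Set ℕ) t' := by
    ext a
    simp only [Set.mem_pi, Finset.mem_coe, ht']
    constructor
    · intro h n _
      split_ifs with hn
      · exact h n hn
      · trivial
    · intro h n hn
      simpa [hn] using h n (hM hn)
  have hprod : ∏ n ∈ s, p.toMeasure (t n) = ∏ n ∈ Finset.range (M + 1), p.toMeasure (t' n) := by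
    rw [← Finset.prod_subset hM]
    · exact Finset.prod_congr rfl fun n hn => by simp [ht', hn]
    · intro n _ hn
      simp [ht', hn]
  rw [hbox, hprod, Finset.prod_range_succ']
  have hm : ∀ r : Finset ℕ, ∀ u : ℕ → Set (Fin k), MeasurableSet (Set.pi (r : Set ℕ) u) :=
    fun r u => MeasurableSet.pi r.countable_toSet fun _ _ => MeasurableSet.of_discrete
  have hpre : ∀ i, (bernoulli p).map (consSeq i) (Set.pi (Finset.range (M + 1) : Set ℕ) t') =
      Set.indicator (t' 0) (fun _ => ∏ n ∈ Finset.range M, p.toMeasure (t' (n + 1))) i := by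
    intro i
    rw [Measure.map_apply (measurable_consSeq i) (hm _ _)]
    have : consSeq i ⁻¹' (Set.pi (Finset.range (M + 1) : Set ℕ) t') =
        if i ∈ t' 0 then Set.pi (Finset.range M : Set ℕ) (fun n => t' (n + 1)) else ∅ := by
      ext a
      simp only [Set.mem_preimage, Set.mem_pi, Finset.coe_range, Set.mem_Iio]
      split_ifs with hi
      · constructor
        · intro h n hn
          exact h (n + 1) (by simpa using hn)
        · intro h n hn
          cases n with
          | zero => exact hi
          | succ n => exact h n (by simpa using hn)
      · simp only [Set.mem_empty_iff_false, iff_false]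
        intro h
        exact hi (h 0 (by simp))
    rw [this]
    split_ifs with hi
    · rw [Set.indicator_of_mem hi, bernoulli,
        Measure.infinitePi_pi _ (fun _ _ => MeasurableSet.of_discrete)]
    · rw [Set.indicator_of_notMem hi, measure_empty]
  have happ : (∑ i, p i • (bernoulli p).map (consSeq i))
      (Set.pi (Finset.range (M + 1) : Set ℕ) t') =
      ∑ i, p i * (bernoulli p).map (consSeq i) (Set.pi (Finset.range (M + 1) : Set ℕ) t') := by
    simp [Measure.finsetSum_apply]
  rw [happ, PMF.toMeasure_apply_fintype, Finset.mul_sum]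
  refine Finset.sum_congr rfl fun i _ => ?_
  rw [hpre i]
  by_cases hi : i ∈ t' 0
  · simp [hi, mul_comm]
  · simp [hi]

lemma sum_toReal_pmf (p : PMF (Fin k)) : ∑ i, (p i).toReal = 1 := by
  have h := p.tsum_coe
  rw [tsum_fintype] at h
  rw [← ENNReal.toReal_sum (fun i _ => p.apply_ne_top i), h, ENNReal.toReal_one]

lemma bernoulli_apply (p : PMF (Fin k)) {s : Set (ℕ → Fin k)} (hs : MeasurableSet s) :
    bernoulli p s = ∑ i, p i * bernoulli p (consSeq i ⁻¹' s) := by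
  conv_lhs => rw [bernoulli_eq_sum]
  rw [Measure.finsetSum_apply]
  refine Finset.sum_congr rfl fun i _ => ?_
  rw [Measure.smul_apply, Measure.map_apply (measurable_consSeq i) hs, smul_eq_mul]

lemma integrable_of_bdd (p : PMF (Fin k)) {F : (ℕ → Fin k) → ℝ} (hF : Measurable F)
    {C : ℝ} (hC : ∀ a, |F a| ≤ C) : Integrable F (bernoulli p) :=
  Integrable.of_bound hF.aestronglyMeasurable C (Eventually.of_forall hC)

lemma integral_bernoulli (p : PMF (Fin k)) {F : (ℕ → Fin k) → ℝ} (hF : Measurable F)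
    {C : ℝ} (hC : ∀ a, |F a| ≤ C) :
    ∫ a, F a ∂bernoulli p = ∑ i, (p i).toReal * ∫ a, F (consSeq i a) ∂bernoulli p := by
  conv_lhs => rw [bernoulli_eq_sum]
  rw [integral_finsetSum_measure]
  · refine Finset.sum_congr rfl fun i _ => ?_
    rw [integral_smul_measure, integral_map (measurable_consSeq i).aemeasurable
      hF.aestronglyMeasurable, smul_eq_mul]
  · intro i _
    refine Integrable.smul_measure ?_ (p.apply_ne_top i)
    have : IsProbabilityMeasure ((bernoulli p).map (consSeq i)) :=
      Measure.isProbabilityMeasure_map (measurable_consSeq i).aemeasurable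
    exact Integrable.of_bound hF.aestronglyMeasurable C (Eventually.of_forall hC)

/-- The left shift preserves the Bernoulli measure. -/
lemma bernoulli_shift (p : PMF (Fin k)) (n : ℕ) {s : Set (ℕ → Fin k)} (hs : MeasurableSet s) :
    bernoulli p ((fun (a : ℕ → Fin k) j => a (n + j)) ⁻¹' s) = bernoulli p s := by
  induction n with
  | zero => simp
  | succ n ih =>
    have hm : ∀ n : ℕ, Measurable (fun (a : ℕ → Fin k) j => a (n + j)) := fun n =>
      measurable_pi_lambda _ fun j => measurable_pi_apply _
    rw [bernoulli_apply p (hm _ hs), ← ih]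
    have : ∀ i : Fin k, consSeq i ⁻¹' ((fun (a : ℕ → Fin k) j => a (n + 1 + j)) ⁻¹' s) =
        (fun (a : ℕ → Fin k) j => a (n + j)) ⁻¹' s := by
      intro i
      ext a
      have : (fun j => consSeq i a (n + 1 + j)) = fun j => a (n + j) := by
        funext j
        rw [show n + 1 + j = (n + j) + 1 by ring]; rfl
      simp [this]
    simp only [this]
    rw [← Finset.sum_mul, ← tsum_fintype (L := .unconditional _), p.tsum_coe, one_mul]

lemma ae_shift (p : PMF (Fin k)) (n : ℕ) {P : (ℕ → Fin k) → Prop}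
    (h : ∀ᵐ a ∂bernoulli p, P a) : ∀ᵐ a ∂bernoulli p, P (fun j => a (n + j)) := by
  have hm : Measurable (fun (a : ℕ → Fin k) j => a (n + j)) :=
    measurable_pi_lambda _ fun j => measurable_pi_apply _
  refine Measure.QuasiMeasurePreserving.ae ⟨hm, ?_⟩ h
  refine Measure.AbsolutelyContinuous.mk fun s hs h0 => ?_
  rw [Measure.map_apply hm hs, bernoulli_shift p n hs, h0]

/-- The trajectory of a point under the maps `T i` chosen by the letters of `a`. -/
def walk {X : Type*} (T : Fin k → X → X) (x : X) (a : ℕ → Fin k) : ℕ → X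
  | 0 => x
  | n + 1 => T (a n) (walk T x a n)

lemma walk_cons {X : Type*} (T : Fin k → X → X) (x : X) (i : Fin k) (a : ℕ → Fin k) (n : ℕ) :
    walk T x (consSeq i a) (n + 1) = walk T (T i x) a n := by
  induction n with
  | zero => rfl
  | succ n ih => rw [walk, ih]; rfl

/-- The walk up to time n depends on finitely many letters of a finite alphabet, so nothing need be
assumed of `T` or `G`: measurability already holds for the discrete σ-algebra on `X`. -/
lemma measurable_walk {X β : Type*} [MeasurableSpace β] (T : Fin k → X → X) (x : X) (n : ℕ)
    (G : X → Fin k → β) : Measurable fun a : ℕ → Fin k => G (walk T x a n) (a n) := by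
  let _ : MeasurableSpace X := ⊤
  have h : ∀ n, Measurable fun a : ℕ → Fin k => walk T x a n := by
    intro n
    induction n with
    | zero => exact measurable_const
    | succ n ih =>
      have h2 : Measurable (fun q : X × Fin k => T q.2 q.1) :=
        measurable_from_prod_countable_left fun i => measurable_from_top
      exact h2.comp (ih.prodMk (measurable_pi_apply n))
  have h2 : Measurable (fun q : X × Fin k => G q.1 q.2) :=
    measurable_from_prod_countable_left fun i => measurable_from_top
  exact h2.comp ((h n).prodMk (measurable_pi_apply n))

lemma measurable_walk' {X β : Type*} [MeasurableSpace β] (T : Fin k → X → X) (x : X) (n : ℕ)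
    (G : X → β) : Measurable fun a : ℕ → Fin k => G (walk T x a n) :=
  measurable_walk T x n fun x _ => G x

/-- Sums of bounded martingale differences along a trajectory: mean zero and variance `O(n)`. -/
lemma walk_sum_moments {X : Type*} (p : PMF (Fin k)) (T : Fin k → X → X) (Y : X → Fin k → ℝ)
    {C : ℝ} (hY : ∀ x i, |Y x i| ≤ C) (h0 : ∀ x, ∑ i, (p i).toReal * Y x i = 0) (n : ℕ) :
    ∀ x, ∫ a, (∑ j ∈ Finset.range n, Y (walk T x a j) (a j)) ∂bernoulli p = 0 ∧
      ∫ a, (∑ j ∈ Finset.range n, Y (walk T x a j) (a j)) ^ 2 ∂bernoulli p ≤ n * C ^ 2 := by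
  have hmeas : ∀ n x, Measurable fun a : ℕ → Fin k =>
      ∑ j ∈ Finset.range n, Y (walk T x a j) (a j) := fun n x =>
    Finset.measurable_sum _ fun j _ => measurable_walk T x j Y
  have hbd : ∀ n x (a : ℕ → Fin k),
      |∑ j ∈ Finset.range n, Y (walk T x a j) (a j)| ≤ n * C := by
    intro n x a
    refine (Finset.abs_sum_le_sum_abs _ _).trans ?_
    refine (Finset.sum_le_sum fun j _ => hY _ _).trans ?_
    simp
  have hbd2 : ∀ n x (a : ℕ → Fin k),
      |(∑ j ∈ Finset.range n, Y (walk T x a j) (a j)) ^ 2| ≤ (n * C) ^ 2 := by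
    intro n x a
    rw [abs_pow]
    exact pow_le_pow_left₀ (abs_nonneg _) (hbd n x a) 2
  induction n with
  | zero => intro x; simp
  | succ n ih =>
    intro x
    have hcons : ∀ i a, ∑ j ∈ Finset.range (n + 1), Y (walk T x (consSeq i a) j) (consSeq i a j) =
        Y x i + ∑ j ∈ Finset.range n, Y (walk T (T i x) a j) (a j) := by
      intro i a
      rw [Finset.sum_range_succ', add_comm]
      congr 1
      refine Finset.sum_congr rfl fun j _ => ?_
      rw [walk_cons]; rfl
    constructor
    · rw [integral_bernoulli p (hmeas _ _) (hbd _ _), ← h0 x]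
      refine Finset.sum_congr rfl fun i _ => ?_
      simp only [hcons]
      rw [integral_add (integrable_const _) (integrable_of_bdd p (hmeas _ _) (hbd _ _)),
        (ih _).1]
      simp
    · rw [integral_bernoulli p ((hmeas _ _).pow_const 2) (hbd2 _ _)]
      have key : ∀ i, ∫ a, (∑ j ∈ Finset.range (n + 1),
          Y (walk T x (consSeq i a) j) (consSeq i a j)) ^ 2 ∂bernoulli p ≤ (n + 1) * C ^ 2 := by
        intro i
        have hexp : ∀ a : ℕ → Fin k, (∑ j ∈ Finset.range (n + 1),
            Y (walk T x (consSeq i a) j) (consSeq i a j)) ^ 2 =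
            (Y x i ^ 2 + 2 * Y x i * ∑ j ∈ Finset.range n, Y (walk T (T i x) a j) (a j)) +
            (∑ j ∈ Finset.range n, Y (walk T (T i x) a j) (a j)) ^ 2 := by
          intro a; rw [hcons]; ring
        simp only [hexp]
        have i1 := integrable_of_bdd p (hmeas n (T i x)) (hbd n (T i x))
        have i2 := integrable_of_bdd p ((hmeas n (T i x)).pow_const 2) (hbd2 n (T i x))
        have i3 : Integrable (fun a : ℕ → Fin k => Y x i ^ 2 +
            2 * Y x i * ∑ j ∈ Finset.range n, Y (walk T (T i x) a j) (a j)) (bernoulli p) :=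
          (integrable_const _).add (i1.const_mul _)
        -- Given the first letter, the cross term is a constant times the mean of the remaining sum,
        -- which vanishes by induction. This is why both moments are treated together, for all
        -- starting points.
        rw [integral_add i3 i2,
          integral_add (integrable_const _) (i1.const_mul _), integral_const_mul, (ih _).1]
        have := (ih (T i x)).2
        have h3 : Y x i ^ 2 ≤ C ^ 2 := sq_le_sq' (by linarith [abs_le.1 (hY x i)])
          (abs_le.1 (hY x i)).2
        simp only [integral_const, probReal_univ, smul_eq_mul]
        linarith
      calc _ ≤ ∑ i, (p i).toReal * ((n + 1) * C ^ 2) :=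
            Finset.sum_le_sum fun i _ => mul_le_mul_of_nonneg_left (key i) ENNReal.toReal_nonneg
        _ = _ := by rw [← Finset.sum_mul, sum_toReal_pmf]; push_cast; ring

/-- If the increments of `s` are bounded and `s (n²) / n² → 0`, then `s n / n → 0`. -/
lemma tendsto_div_of_squares {s : ℕ → ℝ} {C : ℝ} (hs : ∀ n, |s (n + 1) - s n| ≤ C)
    (h : Tendsto (fun n : ℕ => s (n ^ 2) / (n : ℝ) ^ 2) atTop (𝓝 0)) :
    Tendsto (fun n : ℕ => s n / n) atTop (𝓝 0) := by
  have hC : 0 ≤ C := (abs_nonneg _).trans (hs 0)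
  have hinc : ∀ n m : ℕ, |s (n + m) - s n| ≤ C * m := by
    intro n m
    induction m with
    | zero => simp
    | succ m ih =>
      have := abs_add_le (s (n + m + 1) - s (n + m)) (s (n + m) - s n)
      rw [sub_add_sub_cancel] at this
      rw [← add_assoc]
      push_cast
      linarith [hs (n + m)]
  have hsq : Tendsto (fun n : ℕ => n.sqrt) atTop atTop := by
    refine tendsto_atTop.2 fun b => ?_
    filter_upwards [eventually_ge_atTop (b ^ 2)] with n hn
    exact Nat.le_sqrt'.2 hn
  have h1 : Tendsto (fun n : ℕ => |s (n.sqrt ^ 2) / (n.sqrt : ℝ) ^ 2| + 2 * C * (1 / (n.sqrt : ℝ)))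
      atTop (𝓝 0) := by
    have a := (h.comp hsq).abs
    have b := ((tendsto_one_div_atTop_nhds_zero_nat (𝕜 := ℝ)).comp hsq).const_mul (2 * C)
    simpa using a.add b
  refine squeeze_zero_norm' ?_ h1
  filter_upwards [eventually_ge_atTop 1] with n hn
  -- The largest square r² below n is at most 2r steps away, so `s` changes by at most 2Cr, which is
  -- negligible against r².
  set r := n.sqrt with hr
  have hr1 : 1 ≤ r := Nat.le_sqrt'.2 (by simpa using hn)
  have hr2 : r ^ 2 ≤ n := Nat.sqrt_le' n
  have hr3 : n ≤ r ^ 2 + 2 * r := by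
    have := Nat.sqrt_le_add n
    rw [← hr] at this
    nlinarith
  obtain ⟨m, hm⟩ := Nat.exists_eq_add_of_le hr2
  have hm2 : m ≤ 2 * r := by omega
  have hrpos : (0 : ℝ) < r := by exact_mod_cast hr1
  have hnr : (r : ℝ) ^ 2 ≤ n := by exact_mod_cast hr2
  have hnpos : (0 : ℝ) < n := by exact_mod_cast hn
  have e1 : |s n| ≤ |s (r ^ 2)| + C * (2 * r) := by
    have h2 := hinc (r ^ 2) m
    rw [← hm] at h2
    have h3 : C * (m : ℝ) ≤ C * (2 * r) := mul_le_mul_of_nonneg_left (by exact_mod_cast hm2) hC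
    have := abs_sub_abs_le_abs_sub (s n) (s (r ^ 2))
    linarith
  rw [Real.norm_eq_abs, abs_div, abs_div, Nat.abs_cast, abs_of_pos (pow_pos hrpos 2)]
  calc |s n| / n ≤ |s n| / (r : ℝ) ^ 2 := by gcongr
    _ ≤ (|s (r ^ 2)| + C * (2 * r)) / (r : ℝ) ^ 2 := by gcongr
    _ = _ := by field_simp

/-- Strong law of large numbers for bounded martingale differences along a trajectory. -/
lemma ae_walk_sum_div {X : Type*} (p : PMF (Fin k)) (T : Fin k → X → X) (Y : X → Fin k → ℝ)
    {C : ℝ} (hY : ∀ x i, |Y x i| ≤ C) (h0 : ∀ x, ∑ i, (p i).toReal * Y x i = 0) (x : X) :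
    ∀ᵐ a ∂bernoulli p, Tendsto
      (fun n : ℕ => (∑ j ∈ Finset.range n, Y (walk T x a j) (a j)) / n) atTop (𝓝 0) := by
  set s : ℕ → (ℕ → Fin k) → ℝ := fun n a => ∑ j ∈ Finset.range n, Y (walk T x a j) (a j) with hs
  have hmeas : ∀ n, Measurable (s n) := fun n =>
    Finset.measurable_sum _ fun j _ => measurable_walk T x j Y
  have hbd : ∀ n a, |s n a| ≤ n * C := by
    intro n a
    refine (Finset.abs_sum_le_sum_abs _ _).trans ?_
    refine (Finset.sum_le_sum fun j _ => hY _ _).trans ?_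
    simp
  -- Along the squares the second moments of s(n²)/n² are at most C²/n², hence summable. So the
  -- series of these squares is finite almost surely and its terms tend to 0.
  set F : ℕ → (ℕ → Fin k) → ENNReal :=
    fun n a => ENNReal.ofReal ((s ((n + 1) ^ 2) a / ((n : ℝ) + 1) ^ 2) ^ 2) with hF
  have hFm : ∀ n, Measurable (F n) := fun n =>
    (((hmeas _).div_const _).pow_const 2).ennreal_ofReal
  have hint : ∀ n, ∫⁻ a, F n a ∂bernoulli p ≤ ENNReal.ofReal (C ^ 2 * (1 / ((n : ℝ) + 1) ^ 2)) := by
    intro n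
    have hb : ∀ a, |(s ((n + 1) ^ 2) a / ((n : ℝ) + 1) ^ 2) ^ 2| ≤
        ((((n + 1) ^ 2 : ℕ) : ℝ) * C / ((n : ℝ) + 1) ^ 2) ^ 2 := by
      intro a
      rw [abs_pow, abs_div, abs_of_pos (show (0 : ℝ) < ((n : ℝ) + 1) ^ 2 by positivity)]
      have := hbd ((n + 1) ^ 2) a
      gcongr
    rw [← ofReal_integral_eq_lintegral_ofReal
      (integrable_of_bdd p (((hmeas _).div_const _).pow_const 2) hb)
      (Eventually.of_forall fun a => sq_nonneg _)]
    refine ENNReal.ofReal_le_ofReal ?_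
    simp only [div_pow]
    rw [integral_div]
    have := (walk_sum_moments p T Y hY h0 ((n + 1) ^ 2) x).2
    rw [div_le_iff₀ (by positivity)]
    refine this.trans (le_of_eq ?_)
    push_cast
    field_simp
  have hsum : ∫⁻ a, ∑' n, F n a ∂bernoulli p ≠ ⊤ := by
    rw [lintegral_tsum fun n => (hFm n).aemeasurable]
    refine ne_top_of_le_ne_top ?_ (ENNReal.tsum_le_tsum hint)
    rw [← ENNReal.ofReal_tsum_of_nonneg (fun n => by positivity)]
    · exact ENNReal.ofReal_ne_top
    · refine Summable.mul_left _ ?_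
      have := (summable_nat_add_iff 1).2 (Real.summable_one_div_nat_pow.2 one_lt_two)
      simpa using this
  have hae := ae_lt_top (Measurable.tsum hFm) hsum
  filter_upwards [hae] with a ha
  have h1 : Tendsto (fun n => F n a) atTop (𝓝 0) := ENNReal.tendsto_atTop_zero_of_tsum_ne_top ha.ne
  have h2 : Tendsto (fun n => (s ((n + 1) ^ 2) a / ((n : ℝ) + 1) ^ 2) ^ 2) atTop (𝓝 0) := by
    have := (ENNReal.tendsto_toReal ENNReal.zero_ne_top).comp h1
    simp only [ENNReal.toReal_zero] at this
    refine this.congr fun n => ?_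
    simp [hF, ENNReal.toReal_ofReal (sq_nonneg _)]
  have h3 : Tendsto (fun n => s ((n + 1) ^ 2) a / ((n : ℝ) + 1) ^ 2) atTop (𝓝 0) := by
    have h4 := h2.sqrt
    simp only [Real.sqrt_sq_eq_abs, Real.sqrt_zero] at h4
    exact (tendsto_zero_iff_abs_tendsto_zero _).2 h4
  refine tendsto_div_of_squares (s := fun n => s n a) (C := C) ?_ ?_
  · intro n
    simp only [hs, Finset.sum_range_succ, add_sub_cancel_left]
    exact hY _ _
  · refine (tendsto_add_atTop_iff_nat 1).1 ?_
    simpa using h3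

/-- The Markov operator of the random walk. -/
def avgOp {X : Type*} (p : PMF (Fin k)) (T : Fin k → X → X) (G : X → ℂ) (x : X) : ℂ :=
  ∑ i, ((p i).toReal : ℂ) * G (T i x)

lemma norm_avgOp_le {X : Type*} (p : PMF (Fin k)) (T : Fin k → X → X) {G : X → ℂ} {C : ℝ}
    (hG : ∀ x, ‖G x‖ ≤ C) (x : X) : ‖avgOp p T G x‖ ≤ C := by
  refine (norm_sum_le _ _).trans ?_
  calc _ ≤ ∑ i, (p i).toReal * C := Finset.sum_le_sum fun i _ => by
        rw [norm_mul, Complex.norm_real, Real.norm_of_nonneg ENNReal.toReal_nonneg]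
        exact mul_le_mul_of_nonneg_left (hG _) ENNReal.toReal_nonneg
    _ = C := by rw [← Finset.sum_mul, sum_toReal_pmf, one_mul]

lemma norm_avgOp_iterate_le {X : Type*} (p : PMF (Fin k)) (T : Fin k → X → X) {G : X → ℂ} {C : ℝ}
    (hG : ∀ x, ‖G x‖ ≤ C) (l : ℕ) (x : X) : ‖(avgOp p T)^[l] G x‖ ≤ C := by
  induction l generalizing x with
  | zero => exact hG x
  | succ l ih => rw [Function.iterate_succ_apply']; exact norm_avgOp_le p T ih x

/-- Along almost every trajectory, a bounded function and its image under the Markov operator have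
the same asymptotic averages. -/
lemma ae_avgOp_sub {X : Type*} (p : PMF (Fin k)) (T : Fin k → X → X) {G : X → ℂ} {C : ℝ}
    (hG : ∀ x, ‖G x‖ ≤ C) (x : X) :
    ∀ᵐ a ∂bernoulli p, Tendsto (fun n : ℕ => (∑ j ∈ Finset.range n,
      (G (walk T x a (j + 1)) - avgOp p T G (walk T x a j))) / n) atTop (𝓝 0) := by
  have hb : ∀ x i, ‖G (T i x) - avgOp p T G x‖ ≤ C + C := fun x i =>
    (norm_sub_le _ _).trans (add_le_add (hG _) (norm_avgOp_le p T hG x))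
  have hz : ∀ x, ∑ i, ((p i).toReal : ℂ) * (G (T i x) - avgOp p T G x) = 0 := by
    intro x
    have h1 : ∑ i, ((p i).toReal : ℂ) = 1 := by exact_mod_cast sum_toReal_pmf p
    simp only [mul_sub, Finset.sum_sub_distrib, ← Finset.sum_mul, h1]
    simp [avgOp]
  have hre := ae_walk_sum_div p T (fun x i => (G (T i x) - avgOp p T G x).re) (C := C + C)
    (fun x i => (Complex.abs_re_le_norm _).trans (hb x i))
    (fun x => by
      have := congrArg Complex.re (hz x)
      simpa only [Complex.re_sum, Complex.re_ofReal_mul, Complex.zero_re] using this) x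
  have him := ae_walk_sum_div p T (fun x i => (G (T i x) - avgOp p T G x).im) (C := C + C)
    (fun x i => (Complex.abs_im_le_norm _).trans (hb x i))
    (fun x => by
      have := congrArg Complex.im (hz x)
      simpa only [Complex.im_sum, Complex.im_ofReal_mul, Complex.zero_im] using this) x
  filter_upwards [hre, him] with a h1 h2
  have h3 := (Complex.continuous_ofReal.tendsto _).comp h1
  have h4 := ((Complex.continuous_ofReal.tendsto _).comp h2).mul_const Complex.I
  have h5 := h3.add h4
  simp only [Complex.ofReal_zero, zero_mul, add_zero] at h5
  refine h5.congr fun n => ?_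
  simp only [Function.comp, Complex.ofReal_div, Complex.ofReal_natCast, Complex.ofReal_sum]
  rw [div_mul_eq_mul_div, ← add_div, Finset.sum_mul, ← Finset.sum_add_distrib]
  congr 1
  refine Finset.sum_congr rfl fun j _ => ?_
  exact Complex.re_add_im _

/-- If the Cesàro averages of the Markov operator applied to `G` converge uniformly to a constant,
then the averages of `G` along almost every trajectory converge to this constant. -/
theorem ae_tendsto_average {X : Type*} (p : PMF (Fin k)) (T : Fin k → X → X) {G : X → ℂ} {C : ℝ}
    (hG : ∀ x, ‖G x‖ ≤ C) {c : ℂ}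
    (hc : ∀ ε > 0, ∃ L : ℕ, 0 < L ∧
      ∀ x, ‖(∑ l ∈ Finset.range L, (avgOp p T)^[l] G x) / L - c‖ ≤ ε) (x : X) :
    ∀ᵐ a ∂bernoulli p, Tendsto (fun n : ℕ => (∑ j ∈ Finset.range n, G (walk T x a j)) / n)
      atTop (𝓝 c) := by
  have h := ae_all_iff.2 fun l => ae_avgOp_sub p T (norm_avgOp_iterate_le p T hG l) x
  filter_upwards [h] with a ha
  set Z := walk T x a with hZ
  set A : (X → ℂ) → ℕ → ℂ := fun H n => (∑ j ∈ Finset.range n, H (Z j)) / n with hA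
  have step : ∀ l, Tendsto (fun n => A ((avgOp p T)^[l] G) n - A ((avgOp p T)^[l + 1] G) n)
      atTop (𝓝 0) := by
    intro l
    set H := (avgOp p T)^[l] G with hH
    have hHb : ∀ x, ‖H x‖ ≤ C := norm_avgOp_iterate_le p T hG l
    -- The martingale law compares PH at time j with H at time j + 1; returning to H at time j costs
    -- a telescoping sum.
    have tel : Tendsto (fun n : ℕ => (H (Z n) - H (Z 0)) / n) atTop (𝓝 0) := by
      refine squeeze_zero_norm (a := fun n : ℕ => (C + C) / n) (fun n => ?_)
        (tendsto_const_div_atTop_nhds_zero_nat _)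
      rw [norm_div, Complex.norm_natCast]
      gcongr
      exact (norm_sub_le _ _).trans (add_le_add (hHb _) (hHb _))
    have h2 := (ha l).sub tel
    rw [sub_zero] at h2
    refine h2.congr fun n => ?_
    rw [Function.iterate_succ_apply', ← hH, hA]
    simp only
    rw [← Finset.sum_range_sub (fun j => H (Z j)) n, ← sub_div, ← sub_div,
      ← Finset.sum_sub_distrib, ← Finset.sum_sub_distrib]
    congr 1
    refine Finset.sum_congr rfl fun j _ => ?_
    ring
  have all : ∀ l, Tendsto (fun n => A G n - A ((avgOp p T)^[l] G) n) atTop (𝓝 0) := by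
    intro l
    induction l with
    | zero => simp
    | succ l ih => simpa using ih.add (step l)
  refine Metric.tendsto_atTop.2 fun ε hε => ?_
  obtain ⟨L, hL, hLc⟩ := hc (ε / 2) (half_pos hε)
  have hsum : Tendsto (fun n => (∑ l ∈ Finset.range L, (A G n - A ((avgOp p T)^[l] G) n)) / L)
      atTop (𝓝 0) := by
    simpa using (tendsto_finsetSum (Finset.range L) fun l _ => all l).div_const (L : ℂ)
  obtain ⟨n₀, hn₀⟩ := (Metric.tendsto_atTop.1 hsum) (ε / 2) (half_pos hε)
  refine ⟨n₀ + 1, fun n hn => ?_⟩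
  have h1 := hn₀ n (by omega)
  rw [dist_zero_right] at h1
  rw [dist_eq_norm]
  have hLne : (L : ℂ) ≠ 0 := by exact_mod_cast hL.ne'
  have hnne : (n : ℂ) ≠ 0 := by exact_mod_cast (by omega : n ≠ 0)
  -- Replace G by the mean of its first L images under the operator, which is uniformly close to c
  -- at every point of the trajectory.
  have hdec : A G n - c = (∑ l ∈ Finset.range L, (A G n - A ((avgOp p T)^[l] G) n)) / L +
      (∑ j ∈ Finset.range n,
        ((∑ l ∈ Finset.range L, (avgOp p T)^[l] G (Z j)) / L - c)) / n := by
    simp only [hA, Finset.sum_sub_distrib, Finset.sum_const, Finset.card_range, nsmul_eq_mul,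
      ← Finset.sum_div]
    rw [Finset.sum_comm]
    field_simp
    ring
  have h2 : ‖(∑ j ∈ Finset.range n,
      ((∑ l ∈ Finset.range L, (avgOp p T)^[l] G (Z j)) / L - c)) / n‖ ≤ ε / 2 := by
    rw [norm_div, Complex.norm_natCast, div_le_iff₀ (by exact_mod_cast (by omega : 0 < n))]
    refine (norm_sum_le _ _).trans ((Finset.sum_le_sum fun j _ => hLc (Z j)).trans ?_)
    simp [mul_comm]
  change ‖A G n - c‖ < ε
  rw [hdec]
  exact (norm_add_le _ _).trans_lt (by linarith)

end Probability

/-! ### Twisted transfer operators and their Cesàro averages. -/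

section Transfer

variable {k : ℕ}

/-- A system of contractions `ψ i` of the line with bounded images, with positive Lipschitz
weights `f i`. -/
structure IsContractingSystem (ψ f : Fin k → ℝ → ℝ) (ρ R M c C : ℝ) : Prop where
  rho_nonneg : 0 ≤ ρ
  rho_lt_one : ρ < 1
  contr : ∀ i x y, |ψ i x - ψ i y| ≤ ρ * |x - y|
  range : ∀ i x, |ψ i x| ≤ R
  lip : ∀ i x y, |f i x - f i y| ≤ M * |x - y|
  pos : 0 < c
  lower : ∀ i x, c ≤ f i x
  upper : ∀ i x, f i x ≤ C

/-- The transfer operator twisted by the character `exp (i t ·)`. -/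
def twist (p : PMF (Fin k)) (ψ f : Fin k → ℝ → ℝ) (t : ℝ) (g : ℝ → ℂ) (z : ℝ) : ℂ :=
  ∑ i, ((p i).toReal : ℂ) * (Complex.exp ((t * f i z : ℝ) * Complex.I) * g (ψ i z))

/-- The skew product of the `ψ i` by the weights `f i`. -/
def skew (ψ f : Fin k → ℝ → ℝ) (i : Fin k) (x : ℝ × ℝ) : ℝ × ℝ := (ψ i x.1, x.2 + f i x.1)

/-- Translation of s multiplies the character by a constant, so functions of a fixed frequency t
form an invariant class of the Markov operator. -/
lemma avgOp_skew (p : PMF (Fin k)) (ψ f : Fin k → ℝ → ℝ) (t : ℝ) (g : ℝ → ℂ) :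
    avgOp p (skew ψ f) (fun x => g x.1 * Complex.exp ((t * x.2 : ℝ) * Complex.I)) =
      fun x => twist p ψ f t g x.1 * Complex.exp ((t * x.2 : ℝ) * Complex.I) := by
  funext x
  simp only [avgOp, twist, skew, Finset.sum_mul]
  refine Finset.sum_congr rfl fun i _ => ?_
  rw [mul_add t, Complex.ofReal_add, add_mul, Complex.exp_add]
  ring

lemma avgOp_skew_iterate (p : PMF (Fin k)) (ψ f : Fin k → ℝ → ℝ) (t : ℝ) (g : ℝ → ℂ) (l : ℕ) :
    (avgOp p (skew ψ f))^[l] (fun x => g x.1 * Complex.exp ((t * x.2 : ℝ) * Complex.I)) =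
      fun x => (twist p ψ f t)^[l] g x.1 * Complex.exp ((t * x.2 : ℝ) * Complex.I) := by
  induction l with
  | zero => rfl
  | succ l ih => rw [Function.iterate_succ_apply', ih, avgOp_skew, Function.iterate_succ_apply']

lemma norm_sum_pmf_le (p : PMF (Fin k)) {u : Fin k → ℂ} {B : ℝ} (hu : ∀ i, ‖u i‖ ≤ B) :
    ‖∑ i, ((p i).toReal : ℂ) * u i‖ ≤ B := by
  refine (norm_sum_le _ _).trans ?_
  calc _ ≤ ∑ i, (p i).toReal * B := Finset.sum_le_sum fun i _ => by
        rw [norm_mul, Complex.norm_real, Real.norm_of_nonneg ENNReal.toReal_nonneg]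
        exact mul_le_mul_of_nonneg_left (hu i) ENNReal.toReal_nonneg
    _ = B := by rw [← Finset.sum_mul, sum_toReal_pmf, one_mul]

lemma norm_twist_le_of_mem (p : PMF (Fin k)) {ψ f : Fin k → ℝ → ℝ} {t : ℝ} {g : ℝ → ℂ} {B z : ℝ}
    (hg : ∀ i, ‖g (ψ i z)‖ ≤ B) : ‖twist p ψ f t g z‖ ≤ B := by
  refine norm_sum_pmf_le p fun i => ?_
  rw [norm_mul, Complex.norm_exp_ofReal_mul_I, one_mul]
  exact hg i

lemma norm_twist_iterate_le (p : PMF (Fin k)) {ψ f : Fin k → ℝ → ℝ} {t : ℝ} {g : ℝ → ℂ} {B : ℝ}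
    (hg : ∀ z, ‖g z‖ ≤ B) (l : ℕ) (z : ℝ) : ‖(twist p ψ f t)^[l] g z‖ ≤ B := by
  induction l generalizing z with
  | zero => exact hg z
  | succ l ih =>
    rw [Function.iterate_succ_apply']
    exact norm_twist_le_of_mem p fun i => ih _

lemma norm_exp_sub_exp_le (a b : ℝ) :
    ‖Complex.exp (a * Complex.I) - Complex.exp (b * Complex.I)‖ ≤ |a - b| := by
  have h : Complex.exp (a * Complex.I) - Complex.exp (b * Complex.I) =
      Complex.exp (b * Complex.I) * (Complex.exp (Complex.I * ((a - b : ℝ) : ℂ)) - 1) := by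
    rw [mul_sub, ← Complex.exp_add, mul_one]
    congr 2
    push_cast
    ring
  rw [h, norm_mul, Complex.norm_exp_ofReal_mul_I, one_mul]
  exact Real.norm_exp_I_mul_ofReal_sub_one_le

section

variable {ψ f : Fin k → ℝ → ℝ} {ρ R M c C : ℝ}

/-- An inequality of Doeblin–Fortet type: contraction reduces the Lipschitz constant by ρ, and the
twist adds a multiple of the sup norm only. -/
lemma twist_lip (hS : IsContractingSystem ψ f ρ R M c C) (p : PMF (Fin k)) {t : ℝ} {g : ℝ → ℂ}
    {B D : ℝ} (hB : ∀ z, ‖g z‖ ≤ B) (hD : ∀ x y, ‖g x - g y‖ ≤ D * |x - y|) (x y : ℝ) :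
    ‖twist p ψ f t g x - twist p ψ f t g y‖ ≤ (ρ * D + |t| * M * B) * |x - y| := by
  have hB0 : 0 ≤ B := (norm_nonneg _).trans (hB 0)
  have hD0 : 0 ≤ D := by have := (norm_nonneg _).trans (hD 1 0); simpa using this
  simp only [twist, ← Finset.sum_sub_distrib, ← mul_sub]
  refine norm_sum_pmf_le p fun i => ?_
  have hdec : Complex.exp ((t * f i x : ℝ) * Complex.I) * g (ψ i x) -
      Complex.exp ((t * f i y : ℝ) * Complex.I) * g (ψ i y) =
      Complex.exp ((t * f i x : ℝ) * Complex.I) * (g (ψ i x) - g (ψ i y)) +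
      (Complex.exp ((t * f i x : ℝ) * Complex.I) - Complex.exp ((t * f i y : ℝ) * Complex.I)) *
        g (ψ i y) := by ring
  rw [hdec]
  refine (norm_add_le _ _).trans ?_
  rw [norm_mul, norm_mul, Complex.norm_exp_ofReal_mul_I, one_mul, add_mul]
  refine add_le_add ?_ ?_
  · refine (hD _ _).trans ?_
    have := mul_le_mul_of_nonneg_left (hS.contr i x y) hD0
    linarith
  · have h1 := norm_exp_sub_exp_le (t * f i x) (t * f i y)
    rw [← mul_sub, abs_mul] at h1
    have h2 := mul_le_mul_of_nonneg_left (hS.lip i x y) (abs_nonneg t)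
    calc _ ≤ (|t| * (M * |x - y|)) * B :=
          mul_le_mul (h1.trans h2) (hB _) (norm_nonneg _) ((norm_nonneg _).trans (h1.trans h2))
      _ = _ := by ring

/-- The terms added by `twist_lip` sum to a geometric series, so the iterates are equi-Lipschitz. -/
lemma twist_iterate_lip (hS : IsContractingSystem ψ f ρ R M c C) (p : PMF (Fin k)) {t : ℝ}
    {g : ℝ → ℂ} {B D : ℝ} (hB : ∀ z, ‖g z‖ ≤ B) (hD : ∀ x y, ‖g x - g y‖ ≤ D * |x - y|) (l : ℕ)
    (x y : ℝ) : ‖(twist p ψ f t)^[l] g x - (twist p ψ f t)^[l] g y‖ ≤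
      (ρ ^ l * D + |t| * M * B / (1 - ρ)) * |x - y| := by
  have h1 : 0 < 1 - ρ := by linarith [hS.rho_lt_one]
  -- The sign of M is forced by any one weight, and there is a letter because the probabilities sum
  -- to 1.
  have hM : 0 ≤ M ∨ k = 0 := by
    rcases Nat.eq_zero_or_pos k with h | h
    · exact Or.inr h
    · have := (abs_nonneg _).trans (hS.lip ⟨0, h⟩ 1 0)
      left; simpa using this
  have hM0 : 0 ≤ M := by
    rcases hM with h | h
    · exact h
    · subst h
      exact absurd (sum_toReal_pmf p) (by simp)
  have hB0 : 0 ≤ B := (norm_nonneg _).trans (hB 0)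
  induction l generalizing x y with
  | zero =>
    refine (hD x y).trans (mul_le_mul_of_nonneg_right ?_ (abs_nonneg _))
    have : 0 ≤ |t| * M * B / (1 - ρ) := by positivity
    simpa using this
  | succ l ih =>
    rw [Function.iterate_succ_apply']
    refine (twist_lip hS p (norm_twist_iterate_le p hB l) ih x y).trans (le_of_eq ?_)
    congr 1
    field_simp
    ring

/-- A uniformly bounded, equi-Lipschitz sequence has a subsequence converging uniformly on a
compact interval. -/
lemma exists_subseq_tendstoUniformlyOn {h : ℕ → ℝ → ℂ} {B D : ℝ} (hB : ∀ n z, ‖h n z‖ ≤ B)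
    (hD : ∀ n x y, ‖h n x - h n y‖ ≤ D * |x - y|) (R : ℝ) :
    ∃ φ : ℕ → ℕ, StrictMono φ ∧ ∃ H : ℝ → ℂ, ContinuousOn H (Set.Icc (-R) R) ∧
      TendstoUniformlyOn (fun n => h (φ n)) H atTop (Set.Icc (-R) R) := by
  classical
  have hlip : ∀ n, LipschitzWith D.toNNReal (fun x : Set.Icc (-R) R => h n x) := fun n =>
    LipschitzWith.of_dist_le_mul fun x y => by
      rw [dist_eq_norm]
      refine (hD n x y).trans ?_
      rw [Subtype.dist_eq, Real.dist_eq]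
      exact mul_le_mul_of_nonneg_right (Real.le_coe_toNNReal D) (abs_nonneg _)
  let F : ℕ → BoundedContinuousFunction (Set.Icc (-R) R) ℂ := fun n =>
    BoundedContinuousFunction.mkOfCompact ⟨fun x => h n x, (hlip n).continuous⟩
  have hcomp : IsCompact (closure (Set.range F)) := by
    refine BoundedContinuousFunction.arzela_ascoli (Metric.closedBall 0 B)
      (isCompact_closedBall _ _) _ ?_ ?_
    · rintro _ x ⟨n, rfl⟩
      simpa [F] using hB n x
    · refine (LipschitzWith.uniformEquicontinuous _ D.toNNReal ?_).equicontinuous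
      rintro ⟨_, n, rfl⟩
      exact hlip n
  obtain ⟨H, -, φ, hφ, hH⟩ := hcomp.tendsto_subseq fun n => subset_closure (Set.mem_range_self n)
  refine ⟨φ, hφ, fun z => if hz : z ∈ Set.Icc (-R) R then H ⟨z, hz⟩ else 0, ?_, ?_⟩
  · rw [continuousOn_iff_continuous_domRestrict]
    convert H.continuous using 1
    funext x
    have hx : (x : ℝ) ∈ Set.Icc (-R) R := x.2
    simp only [Set.domRestrict_apply]
    rw [dif_pos hx]
  · rw [Metric.tendstoUniformlyOn_iff]
    intro ε hε
    filter_upwards [Metric.tendsto_nhds.1 hH ε hε] with n hn z hz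
    rw [dif_pos hz, dist_comm]
    exact (BoundedContinuousFunction.dist_coe_le_dist (⟨z, hz⟩ : Set.Icc (-R) R)).trans_lt hn

/-- If the twisted operator has no nonzero continuous fixed function, its Cesàro averages tend to
zero uniformly. -/
theorem twist_cesaro (hS : IsContractingSystem ψ f ρ R M c C) (p : PMF (Fin k)) {t : ℝ}
    (hfix : ∀ h : ℝ → ℂ, ContinuousOn h (Set.Icc (-R) R) →
      (∀ z ∈ Set.Icc (-R) R, twist p ψ f t h z = h z) → ∀ z ∈ Set.Icc (-R) R, h z = 0)
    {g : ℝ → ℂ} {B D : ℝ} (hB : ∀ z, ‖g z‖ ≤ B) (hD : ∀ x y, ‖g x - g y‖ ≤ D * |x - y|)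
    {ε : ℝ} (hε : 0 < ε) :
    ∃ L : ℕ, 0 < L ∧ ∀ z, ‖(∑ l ∈ Finset.range L, (twist p ψ f t)^[l] g z) / L‖ ≤ ε := by
  -- Otherwise every Cesàro average exceeds ε somewhere. These averages are bounded and
  -- equi-Lipschitz and are moved by O(1/n) only, so a subsequence converges on [-R, R] to a fixed
  -- function, which is zero.
  by_contra! hcon
  have hmem : ∀ i z, ψ i z ∈ Set.Icc (-R) R := fun i z => abs_le.1 (hS.range i z)
  have hD0 : 0 ≤ D := by have := (norm_nonneg _).trans (hD 1 0); simpa using this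
  set h : ℕ → ℝ → ℂ := fun n z =>
    (∑ l ∈ Finset.range (n + 1), (twist p ψ f t)^[l] g z) / ((n + 1 : ℕ) : ℂ) with hh
  have avg : ∀ (n : ℕ) (u : ℕ → ℂ) (E : ℝ), (∀ l, ‖u l‖ ≤ E) →
      ‖(∑ l ∈ Finset.range (n + 1), u l) / ((n + 1 : ℕ) : ℂ)‖ ≤ E := by
    intro n u E hu
    rw [norm_div, Complex.norm_natCast, div_le_iff₀ (by positivity)]
    refine (norm_sum_le _ _).trans ((Finset.sum_le_sum fun l _ => hu l).trans ?_)
    simp [mul_comm]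
  have hhB : ∀ n z, ‖h n z‖ ≤ B := fun n z =>
    avg n _ B fun l => norm_twist_iterate_le p hB l z
  have hhD : ∀ n x y, ‖h n x - h n y‖ ≤ (D + |t| * M * B / (1 - ρ)) * |x - y| := by
    intro n x y
    simp only [hh]
    rw [← sub_div, ← Finset.sum_sub_distrib]
    refine avg n _ _ fun l => (twist_iterate_lip hS p hB hD l x y).trans ?_
    have : ρ ^ l * D ≤ D :=
      mul_le_of_le_one_left hD0 (pow_le_one₀ hS.rho_nonneg hS.rho_lt_one.le)
    gcongr
  have htw : ∀ n z, twist p ψ f t (h n) z - h n z =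
      ((twist p ψ f t)^[n + 1] g z - g z) / ((n + 1 : ℕ) : ℂ) := by
    intro n z
    have e1 : twist p ψ f t (h n) z =
        (∑ l ∈ Finset.range (n + 1), (twist p ψ f t)^[l + 1] g z) / ((n + 1 : ℕ) : ℂ) := by
      simp only [hh, Function.iterate_succ_apply']
      simp only [twist]
      rw [Finset.sum_comm, Finset.sum_div]
      refine Finset.sum_congr rfl fun i _ => ?_
      rw [← Finset.mul_sum, ← Finset.mul_sum]
      ring
    rw [e1, ← sub_div, ← Finset.sum_sub_distrib,
      Finset.sum_range_sub (fun l => (twist p ψ f t)^[l] g z)]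
    rfl
  have htwn : ∀ n z, ‖twist p ψ f t (h n) z - h n z‖ ≤ 2 * B / ((n : ℝ) + 1) := by
    intro n z
    rw [htw, norm_div, Complex.norm_natCast]
    push_cast
    gcongr
    refine (norm_sub_le _ _).trans ?_
    linarith [norm_twist_iterate_le (ψ := ψ) (f := f) (t := t) p hB (n + 1) z, hB z]
  obtain ⟨φ, hφ, H, hHc, hHu⟩ := exists_subseq_tendstoUniformlyOn hhB hhD R
  have hdec : Tendsto (fun n : ℕ => 2 * B / ((φ n : ℝ) + 1)) atTop (𝓝 0) := by
    have h1 := (tendsto_const_div_atTop_nhds_zero_nat (2 * B)).comp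
      ((tendsto_add_atTop_nat 1).comp hφ.tendsto_atTop)
    refine h1.congr fun n => ?_
    simp
  have hpt : ∀ z ∈ Set.Icc (-R) R, Tendsto (fun n => h (φ n) z) atTop (𝓝 (H z)) :=
    fun z hz => hHu.tendsto_at hz
  have hHfix : ∀ z ∈ Set.Icc (-R) R, twist p ψ f t H z = H z := by
    intro z hz
    have h1 : Tendsto (fun n => twist p ψ f t (h (φ n)) z) atTop (𝓝 (twist p ψ f t H z)) := by
      unfold twist
      exact tendsto_finsetSum _ fun i _ =>
        ((hpt _ (hmem i z)).const_mul _).const_mul _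
    have h2 := h1.sub (hpt z hz)
    have h3 := squeeze_zero_norm (fun n => htwn (φ n) z) hdec
    exact sub_eq_zero.1 (tendsto_nhds_unique h2 h3)
  have hH0 := hfix H hHc hHfix
  have e1 := (Metric.tendstoUniformlyOn_iff.1 hHu) (ε / 2) (half_pos hε)
  have e2 := hdec.eventually_lt_const (half_pos hε)
  obtain ⟨n, hn1, hn2⟩ := (e1.and e2).exists
  obtain ⟨z, hz⟩ := hcon (φ n + 1) (Nat.succ_pos _)
  have hz' : ε < ‖h (φ n) z‖ := hz
  -- The point z may lie outside [-R, R], where nothing is known about convergence; one application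
  -- of the operator only sees values inside.
  have h3 : ‖twist p ψ f t (h (φ n)) z‖ ≤ ε / 2 := norm_twist_le_of_mem p fun i => by
    have := hn1 _ (hmem i z)
    rw [hH0 _ (hmem i z), dist_zero_left] at this
    exact this.le
  have h4 := norm_sub_norm_le (h (φ n) z) (twist p ψ f t (h (φ n)) z)
  rw [norm_sub_rev] at h4
  linarith [htwn (φ n) z]

lemma psi_continuous (hS : IsContractingSystem ψ f ρ R M c C) (i : Fin k) : Continuous (ψ i) :=
  (LipschitzWith.of_dist_le_mul (K := ρ.toNNReal) fun x y => by
    rw [Real.coe_toNNReal _ hS.rho_nonneg]; exact hS.contr i x y).continuous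

lemma weight_continuous (hS : IsContractingSystem ψ f ρ R M c C) (i : Fin k) :
    Continuous (f i) :=
  (LipschitzWith.of_dist_le_mul (K := M.toNNReal) fun x y =>
    (hS.lip i x y).trans (mul_le_mul_of_nonneg_right (Real.le_coe_toNNReal M)
      (abs_nonneg _))).continuous

lemma continuous_of_lip {g : ℝ → ℂ} {D : ℝ} (hD : ∀ x y, ‖g x - g y‖ ≤ D * |x - y|) :
    Continuous g :=
  (LipschitzWith.of_dist_le_mul (K := D.toNNReal) fun x y => by
    rw [dist_eq_norm]
    exact (hD x y).trans (mul_le_mul_of_nonneg_right (Real.le_coe_toNNReal D)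
      (abs_nonneg _))).continuous

lemma integral_of_stationary (p : PMF (Fin k)) {m : Measure ℝ} [IsProbabilityMeasure m]
    (hψ : ∀ i, Measurable (ψ i)) (hm : m = ∑ i, p i • m.map (ψ i)) {g : ℝ → ℂ} (hg : Measurable g)
    {B : ℝ} (hB : ∀ z, ‖g z‖ ≤ B) :
    ∫ z, ∑ i, ((p i).toReal : ℂ) * g (ψ i z) ∂m = ∫ z, g z ∂m := by
  have hint : ∀ i, Integrable (fun z => g (ψ i z)) m := fun i =>
    Integrable.of_bound (hg.comp (hψ i)).aestronglyMeasurable B (Eventually.of_forall fun z => hB _)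
  rw [integral_finsetSum _ fun i _ => (hint i).const_mul _]
  conv_rhs => rw [hm]
  rw [integral_finsetSum_measure]
  · refine Finset.sum_congr rfl fun i _ => ?_
    rw [integral_smul_measure, integral_map (hψ i).aemeasurable hg.aestronglyMeasurable,
      integral_const_mul]
    rfl
  · intro i _
    refine Integrable.smul_measure ?_ (p.apply_ne_top i)
    have : IsProbabilityMeasure (m.map (ψ i)) :=
      Measure.isProbabilityMeasure_map (hψ i).aemeasurable
    exact Integrable.of_bound hg.aestronglyMeasurable B (Eventually.of_forall hB)

lemma twist_zero (p : PMF (Fin k)) (g : ℝ → ℂ) (z : ℝ) :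
    twist p ψ f 0 g z = ∑ i, ((p i).toReal : ℂ) * g (ψ i z) := by
  simp [twist]

/-- The Cesàro averages of the untwisted operator converge uniformly to the integral against the
stationary measure. -/
theorem twist_zero_cesaro (hS : IsContractingSystem ψ f ρ R M c C) (p : PMF (Fin k))
    {m : Measure ℝ} [IsProbabilityMeasure m] (hm : m = ∑ i, p i • m.map (ψ i))
    {g : ℝ → ℂ} {B D : ℝ} (hB : ∀ z, ‖g z‖ ≤ B) (hD : ∀ x y, ‖g x - g y‖ ≤ D * |x - y|)
    {ε : ℝ} (hε : 0 < ε) :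
    ∃ L : ℕ, 0 < L ∧ ∀ z,
      ‖(∑ l ∈ Finset.range L, (twist p ψ f 0)^[l] g z) / L - ∫ y, g y ∂m‖ ≤ ε := by
  have hB0 : 0 ≤ B := (norm_nonneg _).trans (hB 0)
  have hD0 : 0 ≤ D := by have := (norm_nonneg _).trans (hD 1 0); simpa using this
  have hlip : ∀ l x y, ‖(twist p ψ f 0)^[l] g x - (twist p ψ f 0)^[l] g y‖ ≤
      ρ ^ l * D * |x - y| := by
    intro l x y
    simpa using twist_iterate_lip hS p (t := 0) hB hD l x y
  have hmeas : ∀ l, Measurable ((twist p ψ f 0)^[l] g) := fun l =>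
    (continuous_of_lip (hlip l)).measurable
  have hint : ∀ l, ∫ y, (twist p ψ f 0)^[l] g y ∂m = ∫ y, g y ∂m := by
    intro l
    induction l with
    | zero => rfl
    | succ l ih =>
      rw [← ih, Function.iterate_succ_apply']
      simp only [twist_zero]
      exact integral_of_stationary p (fun i => (psi_continuous hS i).measurable) hm (hmeas l)
        (norm_twist_iterate_le p hB l)
  -- At t = 0 the Lipschitz constants decay like ρ^l. One further step confines the arguments to an
  -- interval of length 2R, so the oscillation on all of ℝ decays as well.
  have hosc : ∀ l x y, ‖(twist p ψ f 0)^[l + 1] g x - (twist p ψ f 0)^[l + 1] g y‖ ≤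
      ρ ^ l * (D * (2 * R)) := by
    intro l x y
    rw [Function.iterate_succ_apply', twist_zero, twist_zero, ← Finset.sum_sub_distrib]
    simp only [← mul_sub]
    refine norm_sum_pmf_le p fun i => (hlip l _ _).trans ?_
    have h1 : |ψ i x - ψ i y| ≤ 2 * R := by
      have := abs_le.1 (hS.range i x)
      have := abs_le.1 (hS.range i y)
      rw [abs_le]; constructor <;> linarith
    rw [mul_assoc]
    have := hS.rho_nonneg
    gcongr
  have hdiff : ∀ l z, ‖(twist p ψ f 0)^[l + 1] g z - ∫ y, g y ∂m‖ ≤ ρ ^ l * (D * (2 * R)) := by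
    intro l z
    have hi : Integrable ((twist p ψ f 0)^[l + 1] g) m :=
      Integrable.of_bound (hmeas _).aestronglyMeasurable B
        (Eventually.of_forall (norm_twist_iterate_le p hB _))
    have : (twist p ψ f 0)^[l + 1] g z - ∫ y, g y ∂m =
        ∫ y, ((twist p ψ f 0)^[l + 1] g z - (twist p ψ f 0)^[l + 1] g y) ∂m := by
      rw [integral_sub (integrable_const _) hi, hint]
      simp
    rw [this]
    have h2 := norm_integral_le_of_norm_le_const (μ := m)
      (Eventually.of_forall fun y => hosc l z y)
    simpa using h2
  -- The oscillation bound needs one application of the operator; the zeroth iterate is only bounded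
  -- trivially.
  set b : ℕ → ℝ := fun l => match l with
    | 0 => 2 * B
    | l + 1 => ρ ^ l * (D * (2 * R)) with hb
  have hbt : Tendsto b atTop (𝓝 0) := by
    refine (tendsto_add_atTop_iff_nat 1).1 ?_
    simpa [hb] using
      (tendsto_pow_atTop_nhds_zero_of_lt_one hS.rho_nonneg hS.rho_lt_one).mul_const (D * (2 * R))
  have hbound : ∀ l z, ‖(twist p ψ f 0)^[l] g z - ∫ y, g y ∂m‖ ≤ b l := by
    intro l z
    cases l with
    | zero =>
      have h1 : ‖∫ y, g y ∂m‖ ≤ B := by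
        have := norm_integral_le_of_norm_le_const (μ := m) (Eventually.of_forall hB)
        simpa using this
      have h2 := norm_sub_le (g z) (∫ y, g y ∂m)
      have h3 := hB z
      simp only [hb, Function.iterate_zero, id]
      linarith
    | succ l => exact hdiff l z
  have hces := hbt.cesaro
  obtain ⟨L, hL, hL0⟩ := ((hces.eventually_lt_const hε).and (eventually_gt_atTop 0)).exists
  refine ⟨L, hL0, fun z => ?_⟩
  have hLne : (L : ℂ) ≠ 0 := by exact_mod_cast hL0.ne'
  have : (∑ l ∈ Finset.range L, (twist p ψ f 0)^[l] g z) / L - ∫ y, g y ∂m =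
      (∑ l ∈ Finset.range L, ((twist p ψ f 0)^[l] g z - ∫ y, g y ∂m)) / L := by
    rw [Finset.sum_sub_distrib]
    simp only [Finset.sum_const, Finset.card_range, nsmul_eq_mul]
    field_simp
  rw [this, norm_div, Complex.norm_natCast]
  refine le_trans ?_ hL.le
  rw [div_eq_inv_mul]
  refine mul_le_mul_of_nonneg_left ?_ (by positivity)
  exact (norm_sum_le _ _).trans (Finset.sum_le_sum fun l _ => hbound l z)

/-- There is no nonzero continuous function fixed by the twisted operators with nontrivial
frequencies in `(2π / N) ℤ`. -/
def NoTwistedFixed (p : PMF (Fin k)) (ψ f : Fin k → ℝ → ℝ) (R : ℝ) (N : ℕ) : Prop :=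
  ∀ n : ℤ, n ≠ 0 → ∀ h : ℝ → ℂ, ContinuousOn h (Set.Icc (-R) R) →
    (∀ z ∈ Set.Icc (-R) R, twist p ψ f (2 * Real.pi * n / N) h z = h z) →
      ∀ z ∈ Set.Icc (-R) R, h z = 0

/-- Weyl sums along almost every trajectory of the skew product. -/
theorem ae_weyl (hS : IsContractingSystem ψ f ρ R M c C) (p : PMF (Fin k))
    {m : Measure ℝ} [IsProbabilityMeasure m] (hm : m = ∑ i, p i • m.map (ψ i)) {N : ℕ}
    (hN : NoTwistedFixed p ψ f R N)
    {g : ℝ → ℂ} {B D : ℝ} (hB : ∀ z, ‖g z‖ ≤ B) (hD : ∀ x y, ‖g x - g y‖ ≤ D * |x - y|)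
    (x : ℝ × ℝ) :
    ∀ᵐ a ∂bernoulli p, ∀ n : ℤ, Tendsto (fun I : ℕ => (∑ j ∈ Finset.range I,
      g (walk (skew ψ f) x a j).1 *
        Complex.exp ((2 * Real.pi * n / N * (walk (skew ψ f) x a j).2 : ℝ) * Complex.I)) / I)
      atTop (𝓝 (if n = 0 then ∫ y, g y ∂m else 0)) := by
  refine ae_all_iff.2 fun n => ?_
  have hGB : ∀ x : ℝ × ℝ, ‖g x.1 * Complex.exp
      ((2 * Real.pi * n / N * x.2 : ℝ) * Complex.I)‖ ≤ B := fun x => by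
    rw [norm_mul, Complex.norm_exp_ofReal_mul_I, mul_one]; exact hB _
  refine ae_tendsto_average p (skew ψ f)
    (G := fun x => g x.1 * Complex.exp ((2 * Real.pi * n / N * x.2 : ℝ) * Complex.I)) hGB
    (fun ε hε => ?_) x
  simp only [avgOp_skew_iterate]
  split_ifs with hn
  · subst hn
    obtain ⟨L, hL, h⟩ := twist_zero_cesaro hS p hm hB hD hε
    exact ⟨L, hL, fun x => by simpa using h x.1⟩
  · obtain ⟨L, hL, h⟩ := twist_cesaro hS p (hN n hn) hB hD hε
    refine ⟨L, hL, fun x => ?_⟩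
    have := h x.1
    rw [← Finset.sum_mul, sub_zero, norm_div, norm_mul, Complex.norm_exp_ofReal_mul_I, mul_one,
      ← norm_div]
    exact this

end
end Transfer

/-! ### Weyl's criterion with weights. -/

section Weyl

/-- The arithmetic mean of the first `I` terms. -/
def mean {E : Type*} [DivisionRing E] (u : ℕ → E) (I : ℕ) : E := (∑ j ∈ Finset.range I, u j) / I

lemma norm_mean_le {u : ℕ → ℂ} {B : ℝ} (hB0 : 0 ≤ B) (hu : ∀ j, ‖u j‖ ≤ B) (I : ℕ) :
    ‖mean u I‖ ≤ B := by
  rcases Nat.eq_zero_or_pos I with rfl | hI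
  · simpa [mean] using hB0
  rw [mean, norm_div, Complex.norm_natCast, div_le_iff₀ (by exact_mod_cast hI)]
  refine (norm_sum_le _ _).trans ((Finset.sum_le_sum fun j _ => hu j).trans ?_)
  simp [mul_comm]

lemma norm_mean_le_mean {u : ℕ → ℂ} {v : ℕ → ℝ} (h : ∀ j, ‖u j‖ ≤ v j) (I : ℕ) :
    ‖mean u I‖ ≤ mean v I := by
  rw [mean, mean, norm_div, Complex.norm_natCast]
  gcongr
  exact (norm_sum_le _ _).trans (Finset.sum_le_sum fun j _ => h j)

lemma mean_sub {E : Type*} [Field E] (u v : ℕ → E) (I : ℕ) :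
    mean (fun j => u j - v j) I = mean u I - mean v I := by
  simp only [mean, Finset.sum_sub_distrib, sub_div]

lemma mean_add {E : Type*} [Field E] (u v : ℕ → E) (I : ℕ) :
    mean (fun j => u j + v j) I = mean u I + mean v I := by
  simp only [mean, Finset.sum_add_distrib, add_div]

lemma mean_mul_left {E : Type*} [Field E] (c : E) (v : ℕ → E) (I : ℕ) :
    mean (fun j => c * v j) I = c * mean v I := by
  simp only [mean, ← Finset.mul_sum, mul_div_assoc]

lemma tendsto_of_approx {F : ℕ → ℂ} {l : ℂ}
    (h : ∀ ε > 0, ∃ G : ℕ → ℂ, ∃ l', Tendsto G atTop (𝓝 l') ∧ ‖l' - l‖ ≤ ε ∧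
      ∀ᶠ n in atTop, ‖F n - G n‖ ≤ ε) : Tendsto F atTop (𝓝 l) := by
  refine Metric.tendsto_nhds.2 fun ε hε => ?_
  obtain ⟨G, l', hG, hl, hF⟩ := h (ε / 4) (by positivity)
  filter_upwards [hF, Metric.tendsto_nhds.1 hG (ε / 4) (by positivity)] with n h1 h2
  rw [dist_eq_norm] at h2 ⊢
  have : F n - l = (F n - G n) + (G n - l') + (l' - l) := by ring
  rw [this]
  refine (norm_add₃_le).trans_lt ?_
  linarith

lemma integral_fourier (n : ℤ) :
    ∫ x : UnitAddCircle, fourier n x = if n = 0 then 1 else 0 := by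
  have h := congrFun (fourierCoeff_fourier (T := 1) n) 0
  rw [fourierCoeff, AddCircle.integral_haarAddCircle] at h
  simp only [neg_zero, fourier_zero, one_smul, inv_one] at h
  rw [h, Pi.single_apply]
  simp [eq_comm]

/-- Weighted Weyl criterion: from characters to continuous functions. -/
lemma weyl_continuous {g : ℕ → ℂ} {x : ℕ → ℝ} {B : ℝ} (hg : ∀ j, ‖g j‖ ≤ B) {c : ℂ}
    (h : ∀ n : ℤ, Tendsto (mean fun j => g j * fourier n (x j : UnitAddCircle)) atTop
      (𝓝 (if n = 0 then c else 0))) (u : C(UnitAddCircle, ℂ)) :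
    Tendsto (mean fun j => g j * u (x j : UnitAddCircle)) atTop (𝓝 (c * ∫ y, u y)) := by
  have hB : 0 ≤ B := (norm_nonneg _).trans (hg 0)
  have hint : ∀ u : C(UnitAddCircle, ℂ), Integrable (fun y => u y) volume := fun u =>
    u.continuous.integrable_of_hasCompactSupport (HasCompactSupport.of_compactSpace _)
  have hspan : ∀ v ∈ Submodule.span ℂ (Set.range (@fourier 1)),
      Tendsto (mean fun j => g j * v (x j : UnitAddCircle)) atTop (𝓝 (c * ∫ y, v y)) := by
    intro v hv
    induction hv using Submodule.span_induction with
    | mem v hv =>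
      obtain ⟨n, rfl⟩ := hv
      rw [integral_fourier]
      simpa using h n
    | zero =>
      simp only [ContinuousMap.zero_apply, mul_zero, integral_zero]
      exact tendsto_const_nhds.congr fun I => by simp [mean]
    | add v w _ _ hv hw =>
      have := hv.add hw
      simp only [ContinuousMap.add_apply, mul_add]
      rw [integral_add (hint v) (hint w), mul_add]
      refine this.congr fun I => ?_
      rw [mean_add]
    | smul r v _ hv =>
      have := hv.const_mul r
      simp only [ContinuousMap.smul_apply, smul_eq_mul]
      rw [integral_const_mul, mul_left_comm]
      refine this.congr fun I => ?_
      rw [← mean_mul_left]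
      congr 1
      funext j
      ring
  refine tendsto_of_approx fun ε hε => ?_
  have hu : u ∈ (Submodule.span ℂ (Set.range (@fourier 1))).topologicalClosure := by
    rw [span_fourier_closure_eq_top]; trivial
  obtain ⟨v, hv, hd⟩ := Metric.mem_closure_iff.1 hu (ε / (B + ‖c‖ + 1)) (by positivity)
  rw [dist_eq_norm] at hd
  have hvu : ∀ y, ‖u y - v y‖ ≤ ε / (B + ‖c‖ + 1) := fun y =>
    ((u - v).norm_coe_le_norm y).trans hd.le
  have hq : 0 < B + ‖c‖ + 1 := by positivity
  refine ⟨_, _, hspan v hv, ?_, Eventually.of_forall fun I => ?_⟩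
  · rw [← mul_sub, ← integral_sub (hint v) (hint u), norm_mul]
    have h1 := norm_integral_le_of_norm_le_const (μ := (volume : Measure UnitAddCircle))
      (Eventually.of_forall fun y => (norm_sub_rev (v y) (u y)).le.trans (hvu y))
    simp only [measureReal_def, UnitAddCircle.measure_univ, ENNReal.toReal_one, mul_one] at h1
    calc _ ≤ ‖c‖ * (ε / (B + ‖c‖ + 1)) := mul_le_mul_of_nonneg_left h1 (norm_nonneg _)
      _ ≤ ε := by
        rw [mul_div_assoc', div_le_iff₀ hq]
        nlinarith [norm_nonneg c]
  · rw [← mean_sub]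
    refine (norm_mean_le (B := B * (ε / (B + ‖c‖ + 1))) (by positivity) (fun j => ?_) I).trans ?_
    · rw [← mul_sub, norm_mul]
      exact mul_le_mul (hg j) (hvu _) (norm_nonneg _) hB
    · rw [mul_div_assoc', div_le_iff₀ hq]
      nlinarith [norm_nonneg c]

/-- The function on the circle with values `v (fract x)`. -/
def circleFun (v : ℝ → ℝ) (hv : Continuous v) (h01 : v 0 = v 1) : C(UnitAddCircle, ℂ) where
  toFun := AddCircle.liftIco 1 0 fun x => (v x : ℂ)
  continuous_toFun := AddCircle.liftIco_zero_continuous (by simp [h01])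
    (Complex.continuous_ofReal.comp hv).continuousOn

lemma circleFun_apply (v : ℝ → ℝ) (hv : Continuous v) (h01 : v 0 = v 1) (x : ℝ) :
    circleFun v hv h01 (x : UnitAddCircle) = v (Int.fract x) := by
  have h1 : (x : UnitAddCircle) = (Int.fract x : ℝ) := by
    rw [Int.fract, AddCircle.coe_sub]
    have : ((⌊x⌋ : ℝ) : UnitAddCircle) = 0 := by
      rw [AddCircle.coe_eq_zero_iff]
      exact ⟨⌊x⌋, by simp⟩
    rw [this, sub_zero]
  rw [h1]
  exact AddCircle.liftIco_zero_coe_apply (f := fun x => (v x : ℂ)) ⟨Int.fract_nonneg x, Int.fract_lt_one x⟩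

lemma integral_circleFun (v : ℝ → ℝ) (hv : Continuous v) (h01 : v 0 = v 1) :
    ∫ y, circleFun v hv h01 y = ((∫ x in (0 : ℝ)..1, v x : ℝ) : ℂ) := by
  rw [← UnitAddCircle.intervalIntegral_preimage 0, zero_add, ← intervalIntegral.integral_ofReal]
  refine intervalIntegral.integral_congr_ae ?_
  have : ∀ᵐ x : ℝ, x ≠ 1 := by simp [ae_iff]
  filter_upwards [this] with x hx1 hx
  rw [Set.uIoc_of_le zero_le_one] at hx
  rw [circleFun_apply, Int.fract_eq_self.2 ⟨hx.1.le, lt_of_le_of_ne hx.2 hx1⟩]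

/-- Weighted averages of fractional parts. -/
lemma weyl_fract {g : ℕ → ℂ} {x : ℕ → ℝ} {B : ℝ} (hg : ∀ j, ‖g j‖ ≤ B) {c : ℂ}
    (h : ∀ n : ℤ, Tendsto (mean fun j => g j * fourier n (x j : UnitAddCircle)) atTop
      (𝓝 (if n = 0 then c else 0)))
    (h1 : ∀ n : ℤ, Tendsto (mean fun j => fourier n (x j : UnitAddCircle)) atTop
      (𝓝 (if n = 0 then 1 else 0))) :
    Tendsto (mean fun j => g j * ((Int.fract (x j) : ℝ) : ℂ)) atTop (𝓝 (c / 2)) := by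
  have hB : 0 ≤ B := (norm_nonneg _).trans (hg 0)
  refine tendsto_of_approx fun ε hε => ?_
  -- With this n both errors below, ‖c‖/(n + 1) and 2B/(n + 1), are at most ε.
  obtain ⟨n, hn⟩ := exists_nat_gt ((2 * B + ‖c‖ + 1) / ε)
  rw [div_lt_iff₀ hε] at hn
  have hn0 : n ≠ 0 := by
    rintro rfl
    have := norm_nonneg c
    simp only [Nat.cast_zero, zero_mul] at hn
    linarith
  -- The fractional part jumps at the integers, but x - xⁿ takes equal values at 0 and 1. The error
  -- xⁿ is dominated by xⁿ + (1 - x)ⁿ, also continuous on the circle, with integral 2/(n + 1).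
  set U := circleFun (fun x => x - x ^ n) (by fun_prop) (by simp [hn0]) with hU
  set W := circleFun (fun x => x ^ n + (1 - x) ^ n) (by fun_prop) (by simp [hn0]) with hW
  have iU : ∫ y, U y = 1 / 2 - 1 / ((n : ℂ) + 1) := by
    rw [hU, integral_circleFun, intervalIntegral.integral_sub (by simp) (by simp)]
    simp
  have iW : ∫ y, W y = 2 / ((n : ℂ) + 1) := by
    have e : ∫ x in (0 : ℝ)..1, (1 - x) ^ n = 1 / ((n : ℝ) + 1) := by
      rw [intervalIntegral.integral_comp_sub_left (fun x => x ^ n) 1]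
      simp
    rw [hW, integral_circleFun, intervalIntegral.integral_add (by simp)
      (Continuous.intervalIntegrable (by fun_prop) _ _), e]
    simp
    ring
  have hWt := weyl_continuous (g := fun _ => 1) (B := 1) (by simp) (by simpa using h1) W
  rw [one_mul, iW] at hWt
  have hn1 : (0 : ℝ) < (n : ℝ) + 1 := by positivity
  refine ⟨_, _, weyl_continuous hg h U, ?_, ?_⟩
  · rw [iU]
    have : c * (1 / 2 - 1 / ((n : ℂ) + 1)) - c / 2 = -(c / ((n : ℂ) + 1)) := by ring
    rw [this, norm_neg, norm_div]
    have h2 : ‖(n : ℂ) + 1‖ = (n : ℝ) + 1 := by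
      have := Complex.norm_natCast (n + 1)
      push_cast at this
      exact this
    rw [h2, div_le_iff₀ hn1]
    nlinarith
  · have hWn : Tendsto (mean fun j => Int.fract (x j) ^ n + (1 - Int.fract (x j)) ^ n) atTop
        (𝓝 (2 / ((n : ℝ) + 1))) := by
      have h3 := (Complex.continuous_re.tendsto _).comp hWt
      have h4 : (2 / ((n : ℂ) + 1)).re = 2 / ((n : ℝ) + 1) := by
        have : (2 / ((n : ℂ) + 1)) = ((2 / ((n : ℝ) + 1) : ℝ) : ℂ) := by push_cast; rfl
        rw [this, Complex.ofReal_re]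
      rw [h4] at h3
      refine h3.congr fun I => ?_
      have h5 : (mean (fun j => (1 : ℂ) * W (x j : UnitAddCircle)) I) =
          ((mean (fun j => Int.fract (x j) ^ n + (1 - Int.fract (x j)) ^ n) I : ℝ) : ℂ) := by
        simp only [mean, hW, circleFun_apply, one_mul]
        push_cast
        rfl
      simp only [Function.comp, h5, Complex.ofReal_re]
    have h6 : B * (2 / ((n : ℝ) + 1)) < ε := by
      rw [mul_div_assoc', div_lt_iff₀ hn1]
      nlinarith [norm_nonneg c]
    filter_upwards [(hWn.const_mul B).eventually_lt_const h6] with I hI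
    rw [← mean_sub]
    refine le_trans (norm_mean_le_mean (v := fun j => B *
      (Int.fract (x j) ^ n + (1 - Int.fract (x j)) ^ n)) (fun j => ?_) I) ?_
    · rw [hU, circleFun_apply, ← mul_sub, norm_mul, ← Complex.ofReal_sub, Complex.norm_real,
        sub_sub_cancel]
      have f0 := Int.fract_nonneg (x j)
      have f1 := (Int.fract_lt_one (x j)).le
      have f2 : 0 ≤ (1 - Int.fract (x j)) ^ n := pow_nonneg (by linarith) n
      have f3 : 0 ≤ Int.fract (x j) ^ n := pow_nonneg f0 n
      rw [Real.norm_of_nonneg f3]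
      exact mul_le_mul (hg j) (by linarith) f3 hB
    · rw [mean_mul_left]
      exact hI.le

end Weyl

/-! ### First passage times over the multiples of N. -/

section Stopping

lemma mean_shift {u : ℕ → ℝ} {l : ℝ} (n : ℕ) :
    Tendsto (mean fun j => u (n + j)) atTop (𝓝 l) ↔ Tendsto (mean u) atTop (𝓝 l) := by
  have key : Tendsto (mean fun j => u (n + j)) atTop (𝓝 l) ↔
      Tendsto (fun I => mean u (n + I)) atTop (𝓝 l) := by
    have h1 : Tendsto (fun I : ℕ => ((I : ℝ) + n) / I) atTop (𝓝 1) := by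
      have h2 : Tendsto (fun I : ℕ => 1 + (n : ℝ) / I) atTop (𝓝 (1 + 0)) :=
        tendsto_const_nhds.add (tendsto_const_div_atTop_nhds_zero_nat _)
      rw [add_zero] at h2
      refine h2.congr' ?_
      filter_upwards [eventually_gt_atTop 0] with I hI
      have : (I : ℝ) ≠ 0 := by exact_mod_cast hI.ne'
      field_simp
    have h0 : Tendsto (fun I : ℕ => (∑ j ∈ Finset.range n, u j) / (I : ℝ)) atTop (𝓝 0) :=
      tendsto_const_div_atTop_nhds_zero_nat _
    have e : ∀ I : ℕ, 0 < I → mean (fun j => u (n + j)) I =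
        mean u (n + I) * (((I : ℝ) + n) / I) - (∑ j ∈ Finset.range n, u j) / (I : ℝ) := by
      intro I hI
      have h3 : (I : ℝ) ≠ 0 := by exact_mod_cast hI.ne'
      have h4 : ((n : ℝ) + I) ≠ 0 := by positivity
      simp only [mean, Finset.sum_range_add]
      push_cast
      field_simp
      ring
    constructor
    · intro h
      have h5 := (h.add h0).div h1 one_ne_zero
      rw [add_zero, div_one] at h5
      refine h5.congr' ?_
      filter_upwards [eventually_gt_atTop 0] with I hI
      have h3 : ((I : ℝ) + n) / I ≠ 0 := by positivity
      simp only [Pi.div_apply, e I hI, sub_add_cancel]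
      rw [mul_div_assoc, div_self h3, mul_one]
    · intro h
      have h5 := (h.mul h1).sub h0
      rw [mul_one, sub_zero] at h5
      refine h5.congr' ?_
      filter_upwards [eventually_gt_atTop 0] with I hI
      simp only [e I hI]
  rw [key]
  simp only [add_comm n]
  exact tendsto_add_atTop_iff_nat (f := mean u) n

/-- Cesàro averages along a random time change with bounded defect. -/
lemma mean_of_time_change {u : ℕ → ℝ} {B : ℝ} (hu : ∀ j, |u j| ≤ B) {F τ : ℕ → ℕ} {C : ℝ}
    (hle : ∀ J, J ≤ F (τ J)) (hC : ∀ J, (F (τ J) : ℝ) ≤ J + C) (hτ : Tendsto τ atTop atTop)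
    {A l : ℝ} (hl : l ≠ 0)
    (hA : Tendsto (fun n : ℕ => (∑ j ∈ Finset.range (F n), u j) / n) atTop (𝓝 A))
    (hF : Tendsto (fun n : ℕ => (F n : ℝ) / n) atTop (𝓝 l)) :
    Tendsto (mean u) atTop (𝓝 (A / l)) := by
  have hB0 : 0 ≤ B := (abs_nonneg _).trans (hu 0)
  have hC0 : 0 ≤ C := by
    have h1 := hC 0
    have h2 : (0 : ℝ) ≤ F (τ 0) := Nat.cast_nonneg _
    simp only [Nat.cast_zero, zero_add] at h1
    linarith
  -- Time τ J accounts for F(τ J) terms, at most C more than J. After division by τ J the excess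
  -- vanishes in the sum and in the count, and the quotient of the two limits remains.
  have hdef : Tendsto (fun J => ((F (τ J) : ℝ) - J) / τ J) atTop (𝓝 0) := by
    refine squeeze_zero_norm (a := fun J => C / (τ J : ℝ)) (fun J => ?_)
      ((tendsto_const_div_atTop_nhds_zero_nat C).comp hτ)
    have : (J : ℝ) ≤ F (τ J) := by exact_mod_cast hle J
    rw [norm_div, Real.norm_natCast, Real.norm_of_nonneg (by linarith)]
    gcongr
    linarith [hC J]
  have hJ : Tendsto (fun J : ℕ => (J : ℝ) / τ J) atTop (𝓝 l) := by
    have := (hF.comp hτ).sub hdef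
    rw [sub_zero] at this
    refine this.congr fun J => ?_
    simp only [Function.comp]
    rw [← sub_div]
    congr 1
    ring
  have hrem : Tendsto (fun J => (∑ j ∈ Finset.Ico J (F (τ J)), u j) / (τ J : ℝ)) atTop (𝓝 0) := by
    refine squeeze_zero_norm (a := fun J => (C * B) / (τ J : ℝ)) (fun J => ?_)
      ((tendsto_const_div_atTop_nhds_zero_nat (C * B)).comp hτ)
    rw [norm_div, Real.norm_natCast]
    gcongr
    refine (Finset.abs_sum_le_sum_abs _ _).trans ((Finset.sum_le_sum fun j _ => hu j).trans ?_)
    rw [Finset.sum_const, Nat.card_Ico, nsmul_eq_mul, Nat.cast_sub (hle J)]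
    exact mul_le_mul_of_nonneg_right (by linarith [hC J]) hB0
  have hnum : Tendsto (fun J => (∑ j ∈ Finset.range J, u j) / (τ J : ℝ)) atTop (𝓝 A) := by
    have := (hA.comp hτ).sub hrem
    rw [sub_zero] at this
    refine this.congr fun J => ?_
    simp only [Function.comp]
    rw [← sub_div, ← Finset.sum_range_add_sum_Ico u (hle J)]
    congr 1
    ring
  refine (hnum.div hJ hl).congr' ?_
  filter_upwards [hτ.eventually_gt_atTop 0, eventually_gt_atTop 0] with J h1 h2
  have h3 : (τ J : ℝ) ≠ 0 := by exact_mod_cast h1.ne'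
  have h4 : (J : ℝ) ≠ 0 := by exact_mod_cast h2.ne'
  simp only [mean, Pi.div_apply]
  field_simp

/-- The first index at which `S` is at least `y`. -/
def firstIndex (S : ℕ → ℝ) (y : ℝ) : ℕ := sInf {n | y ≤ S n}

section

variable {S : ℕ → ℝ} {c C : ℝ}

lemma linear_le (hc : ∀ n, c ≤ S (n + 1) - S n) (n m : ℕ) : S n + c * m ≤ S (n + m) := by
  induction m with
  | zero => simp
  | succ m ih =>
    have := hc (n + m)
    push_cast
    rw [← add_assoc]
    linarith

lemma le_linear (hC : ∀ n, S (n + 1) - S n ≤ C) (n m : ℕ) : S (n + m) ≤ S n + C * m := by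
  induction m with
  | zero => simp
  | succ m ih =>
    have := hC (n + m)
    push_cast
    rw [← add_assoc]
    linarith

lemma firstIndex_le (h0 : S 0 = 0) (hc0 : 0 < c) (hc : ∀ n, c ≤ S (n + 1) - S n) (y : ℝ) :
    y ≤ S (firstIndex S y) := by
  -- Linear growth makes the set nonempty, so `sInf` does not take its default value 0.
  refine Nat.sInf_mem (s := {n | y ≤ S n}) ?_
  obtain ⟨n, hn⟩ := exists_nat_ge (y / c)
  refine ⟨n, ?_⟩
  have := linear_le hc 0 n
  rw [h0, zero_add, zero_add] at this
  rw [div_le_iff₀ hc0] at hn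
  simp only [Set.mem_ofPred_eq]
  linarith

lemma firstIndex_eq (hc0 : 0 < c) (hc : ∀ n, c ≤ S (n + 1) - S n) {y : ℝ} {n : ℕ} (h1 : S n < y)
    (h2 : y ≤ S (n + 1)) : firstIndex S y = n + 1 := by
  have hmono : Monotone S := monotone_nat_of_le_succ fun n => by linarith [hc n]
  refine le_antisymm (Nat.sInf_le h2) ?_
  refine le_csInf ⟨n + 1, h2⟩ fun m hm => ?_
  by_contra! hlt
  have h3 := hmono (Nat.lt_succ_iff.1 hlt)
  have h4 : y ≤ S m := hm
  linarith

lemma tendsto_firstIndex (h0 : S 0 = 0) (hc0 : 0 < c) (hc : ∀ n, c ≤ S (n + 1) - S n)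
    (hC : ∀ n, S (n + 1) - S n ≤ C) {N : ℕ} (hN : 1 ≤ N) :
    Tendsto (fun j : ℕ => firstIndex S (N * j)) atTop atTop := by
  refine tendsto_atTop.2 fun b => ?_
  obtain ⟨J, hJ⟩ := exists_nat_gt (C * b)
  have hmono : Monotone S := monotone_nat_of_le_succ fun n => by linarith [hc n]
  filter_upwards [eventually_ge_atTop J] with j hj
  by_contra! hlt
  have h1 := firstIndex_le h0 hc0 hc (N * j)
  have h2 := hmono hlt.le
  have h3 := le_linear hC 0 b
  rw [h0, zero_add, zero_add] at h3
  have h4 : (J : ℝ) ≤ N * j := by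
    have : J ≤ N * j := hj.trans (Nat.le_mul_of_pos_left j hN)
    exact_mod_cast this
  linarith

/-- Step m passes ⌊S (m+1)/N⌋ - ⌊S m/N⌋ multiples of N, and all of them have first index m + 1. A
sum over multiples thus becomes a weighted sum over steps; the shift j + 1 leaves out the multiple
0. -/
lemma sum_firstIndex (h0 : S 0 = 0) (hc0 : 0 < c) (hc : ∀ n, c ≤ S (n + 1) - S n) {N : ℕ}
    (hN : 1 ≤ N) (γ : ℕ → ℝ) (n : ℕ) :
    ∑ j ∈ Finset.range ⌊S n / N⌋₊, γ (firstIndex S (N * (j + 1 : ℕ))) =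
      ∑ m ∈ Finset.range n, γ (m + 1) * ((⌊S (m + 1) / N⌋ : ℝ) - ⌊S m / N⌋) := by
  have hNpos : (0 : ℝ) < N := by exact_mod_cast hN
  have hmono : Monotone S := monotone_nat_of_le_succ fun n => by linarith [hc n]
  have hnn : ∀ n, 0 ≤ S n / N := fun n => div_nonneg (h0 ▸ hmono (Nat.zero_le n)) hNpos.le
  induction n with
  | zero => simp [h0]
  | succ n ih =>
    have hle : ⌊S n / N⌋₊ ≤ ⌊S (n + 1) / N⌋₊ :=
      Nat.floor_mono (div_le_div_of_nonneg_right (hmono n.le_succ) hNpos.le)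
    rw [Finset.sum_range_succ, ← ih, ← Finset.sum_range_add_sum_Ico _ hle]
    congr 1
    have : ∀ j ∈ Finset.Ico ⌊S n / N⌋₊ ⌊S (n + 1) / N⌋₊,
        γ (firstIndex S (N * (j + 1 : ℕ))) = γ (n + 1) := by
      intro j hj
      rw [Finset.mem_Ico] at hj
      congr 1
      refine firstIndex_eq hc0 hc ?_ ?_
      · have := (Nat.floor_lt (hnn n)).1 (Nat.lt_succ_of_le hj.1)
        rw [div_lt_iff₀ hNpos] at this
        linarith
      · have := (Nat.le_floor_iff (hnn (n + 1))).1 hj.2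
        rw [le_div_iff₀ hNpos] at this
        push_cast at this ⊢
        linarith
    rw [Finset.sum_congr rfl this, Finset.sum_const, Nat.card_Ico, nsmul_eq_mul,
      Nat.cast_sub hle, natCast_floor_eq_intCast_floor (hnn _),
      natCast_floor_eq_intCast_floor (hnn _)]
    ring

/-- Averages of a sequence observed at the first passage times of `S` through the multiples of
`N`. -/
lemma mean_firstIndex (h0 : S 0 = 0) (hc0 : 0 < c) (hc : ∀ n, c ≤ S (n + 1) - S n)
    (hC : ∀ n, S (n + 1) - S n ≤ C) {N : ℕ} (hN : 1 ≤ N) {γ : ℕ → ℝ} {B : ℝ}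
    (hB : ∀ n, |γ n| ≤ B) {A l : ℝ} (hl : l ≠ 0)
    (hA : Tendsto (mean fun m => γ (m + 1) * ((⌊S (m + 1) / N⌋ : ℝ) - ⌊S m / N⌋)) atTop (𝓝 A))
    (h1 : Tendsto (mean fun m => ((⌊S (m + 1) / N⌋ : ℝ) - ⌊S m / N⌋)) atTop (𝓝 l)) :
    Tendsto (mean fun j : ℕ => γ (firstIndex S (N * (j + 1 : ℕ)))) atTop (𝓝 (A / l)) := by
  have hNpos : (1 : ℝ) ≤ N := by exact_mod_cast hN
  have hmono : Monotone S := monotone_nat_of_le_succ fun n => by linarith [hc n]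
  have hnn : ∀ n, 0 ≤ S n / N := fun n =>
    div_nonneg (h0 ▸ hmono (Nat.zero_le n)) (by linarith)
  have hC0 : 0 ≤ C := by linarith [hc 0, hC 0]
  refine mean_of_time_change (F := fun n => ⌊S n / N⌋₊)
    (τ := fun J => firstIndex S (N * J)) (C := C) (fun j => hB _) ?_ ?_
    (tendsto_firstIndex h0 hc0 hc hC hN) hl ?_ ?_
  · intro J
    rw [Nat.le_floor_iff (hnn _), le_div_iff₀ (by linarith)]
    have := firstIndex_le h0 hc0 hc (N * J)
    linarith
  · intro J
    refine (Nat.floor_le (hnn _)).trans ?_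
    rw [div_le_iff₀ (by linarith)]
    -- The overshoot over N J is at most one increment, so at most C further multiples are counted.
    have h3 : S (firstIndex S (N * J)) ≤ N * J + C := by
      rcases Nat.eq_zero_or_pos (firstIndex S (N * J)) with h | h
      · rw [h, h0]; positivity
      · obtain ⟨n, hn⟩ := Nat.exists_eq_succ_of_ne_zero h.ne'
        have h4 : ¬ (N * J : ℝ) ≤ S n := fun h5 => by
          have : firstIndex S (N * J) ≤ n := Nat.sInf_le h5
          omega
        rw [hn]
        have := hC n
        simp only [Nat.succ_eq_add_one]
        linarith
    nlinarith
  · refine hA.congr fun n => ?_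
    rw [mean, sum_firstIndex h0 hc0 hc hN]
  · refine h1.congr fun n => ?_
    have := sum_firstIndex h0 hc0 hc hN (fun _ => 1) n
    simp only [Finset.sum_const, Finset.card_range, nsmul_eq_mul, mul_one, one_mul] at this
    rw [mean, this]

end

end Stopping

/-! ### The renewal average of the skew product. -/

section Renewal

variable {k : ℕ} {ψ f : Fin k → ℝ → ℝ} {ρ R M c C : ℝ}

lemma mean_ofReal (u : ℕ → ℝ) (I : ℕ) : mean (fun j => (u j : ℂ)) I = (mean u I : ℝ) := by
  simp [mean]

lemma tendsto_mean_ofReal {u : ℕ → ℝ} {l : ℝ}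
    (h : Tendsto (mean fun j => (u j : ℂ)) atTop (𝓝 (l : ℂ))) : Tendsto (mean u) atTop (𝓝 l) := by
  have := (Complex.continuous_re.tendsto _).comp h
  refine this.congr fun I => ?_
  simp [mean_ofReal]

/-- Averages of `g z` and of `g z` times the fractional part of `s / N` along almost every
trajectory `(z, s)` of the skew product. -/
lemma ae_mean_fract (hS : IsContractingSystem ψ f ρ R M c C) (p : PMF (Fin k))
    {m : Measure ℝ} [IsProbabilityMeasure m] (hm : m = ∑ i, p i • m.map (ψ i)) {N : ℕ}
    (hN : NoTwistedFixed p ψ f R N) {g : ℝ → ℝ} {B D : ℝ} (hB : ∀ z, |g z| ≤ B)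
    (hD : ∀ x y, |g x - g y| ≤ D * |x - y|) (x : ℝ × ℝ) :
    ∀ᵐ a ∂bernoulli p,
      Tendsto (mean fun j => g (walk (skew ψ f) x a j).1) atTop (𝓝 (∫ y, g y ∂m)) ∧
      Tendsto (mean fun j => g (walk (skew ψ f) x a j).1 *
        Int.fract ((walk (skew ψ f) x a j).2 / N)) atTop (𝓝 ((∫ y, g y ∂m) / 2)) := by
  have h1 := ae_weyl hS p hm hN (g := fun z => (g z : ℂ)) (B := B) (D := D)
    (fun z => by rw [Complex.norm_real]; exact hB z)
    (fun x y => by rw [← Complex.ofReal_sub, Complex.norm_real]; exact hD x y) x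
  have h2 := ae_weyl hS p hm hN (g := fun z => 1) (B := 1) (D := 0) (by simp) (by simp) x
  filter_upwards [h1, h2] with a ha hb
  have e : ∀ (n : ℤ) (s : ℝ), Complex.exp ((2 * Real.pi * n / N * s : ℝ) * Complex.I) =
      fourier n ((s / N : ℝ) : UnitAddCircle) := by
    intro n s
    rw [fourier_coe_apply]
    congr 1
    push_cast
    ring
  simp only [e] at ha hb
  have hint : ∫ y, (g y : ℂ) ∂m = ((∫ y, g y ∂m : ℝ) : ℂ) := integral_ofReal
  rw [hint] at ha
  simp only [one_mul, integral_const, probReal_univ, one_smul] at hb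
  constructor
  · have := ha 0
    simp only [fourier_zero, mul_one, if_true] at this
    exact tendsto_mean_ofReal this
  · have := weyl_fract (g := fun j => (g (walk (skew ψ f) x a j).1 : ℂ))
      (x := fun j => (walk (skew ψ f) x a j).2 / N) (B := B)
      (fun j => by rw [Complex.norm_real]; exact hB _) ha hb
    refine tendsto_mean_ofReal ?_
    push_cast
    exact this

lemma lip_mul {g h : ℝ → ℝ} {B D B' D' : ℝ} (hB : ∀ z, |g z| ≤ B)
    (hD : ∀ x y, |g x - g y| ≤ D * |x - y|) (hB' : ∀ z, |h z| ≤ B')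
    (hD' : ∀ x y, |h x - h y| ≤ D' * |x - y|) (x y : ℝ) :
    |g x * h x - g y * h y| ≤ (B * D' + D * B') * |x - y| := by
  have : g x * h x - g y * h y = g x * (h x - h y) + (g x - g y) * h y := by ring
  rw [this]
  refine (abs_add_le _ _).trans ?_
  rw [abs_mul, abs_mul, add_mul]
  refine add_le_add ?_ ?_
  · rw [mul_assoc]
    exact mul_le_mul (hB x) (hD' x y) (abs_nonneg _) ((abs_nonneg _).trans (hB x))
  · rw [mul_right_comm]
    exact mul_le_mul (hD x y) (hB' y) (abs_nonneg _) ((abs_nonneg _).trans (hD x y))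

lemma abs_sum_pmf_le (p : PMF (Fin k)) {u : Fin k → ℝ} {B : ℝ} (hu : ∀ i, |u i| ≤ B) :
    |∑ i, (p i).toReal * u i| ≤ B := by
  refine (Finset.abs_sum_le_sum_abs _ _).trans ?_
  calc _ ≤ ∑ i, (p i).toReal * B := Finset.sum_le_sum fun i _ => by
        rw [abs_mul, abs_of_nonneg ENNReal.toReal_nonneg]
        exact mul_le_mul_of_nonneg_left (hu i) ENNReal.toReal_nonneg
    _ = B := by rw [← Finset.sum_mul, sum_toReal_pmf, one_mul]

/-- The mean increment, weighted by the value of `g` at the next point. -/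
def renewalMean (p : PMF (Fin k)) (ψ f : Fin k → ℝ → ℝ) (m : Measure ℝ) (g : ℝ → ℝ) : ℝ :=
  ∫ z, ∑ i, (p i).toReal * (f i z * g (ψ i z)) ∂m

/-- Averages along a trajectory, weighted by the number of passages through multiples of `N`. -/
theorem ae_mean_floor (hS : IsContractingSystem ψ f ρ R M c C) (p : PMF (Fin k))
    {m : Measure ℝ} [IsProbabilityMeasure m] (hm : m = ∑ i, p i • m.map (ψ i)) {N : ℕ}
    (hN : NoTwistedFixed p ψ f R N) {g : ℝ → ℝ} {B D : ℝ} (hB : ∀ z, |g z| ≤ B)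
    (hD : ∀ x y, |g x - g y| ≤ D * |x - y|) (x : ℝ × ℝ) :
    ∀ᵐ a ∂bernoulli p,
      Tendsto (mean fun j => g (walk (skew ψ f) x a (j + 1)).1 *
        ((⌊(walk (skew ψ f) x a (j + 1)).2 / N⌋ : ℝ) - ⌊(walk (skew ψ f) x a j).2 / N⌋))
        atTop (𝓝 (renewalMean p ψ f m g / N)) := by
  have hB0 : 0 ≤ B := (abs_nonneg _).trans (hB 0)
  have hD0 : 0 ≤ D := by have := (abs_nonneg _).trans (hD 1 0); simpa using this
  have hψD : ∀ i x y, |g (ψ i x) - g (ψ i y)| ≤ D * |x - y| := fun i x y =>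
    (hD _ _).trans (mul_le_mul_of_nonneg_left ((hS.contr i x y).trans
      (mul_le_of_le_one_left (abs_nonneg _) hS.rho_lt_one.le)) hD0)
  have hfB : ∀ i z, |f i z| ≤ C := fun i z => by
    rw [abs_of_nonneg (hS.pos.le.trans (hS.lower i z))]; exact hS.upper i z
  -- P and Q are the conditional expectations, given the present point z, of g at the next point and
  -- of the increment times g at the next point.
  set P : ℝ → ℝ := fun z => ∑ i, (p i).toReal * g (ψ i z) with hP
  set Q : ℝ → ℝ := fun z => ∑ i, (p i).toReal * (f i z * g (ψ i z)) with hQ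
  have hPB : ∀ z, |P z| ≤ B := fun z => abs_sum_pmf_le p fun i => hB _
  have hPD : ∀ x y, |P x - P y| ≤ D * |x - y| := fun x y => by
    simp only [hP, ← Finset.sum_sub_distrib, ← mul_sub]
    exact abs_sum_pmf_le p fun i => hψD i x y
  have hfg : ∀ i z, |f i z * g (ψ i z)| ≤ C * B := fun i z => by
    rw [abs_mul]
    exact mul_le_mul (hfB i z) (hB _) (abs_nonneg _) ((abs_nonneg _).trans (hfB i z))
  have hQB : ∀ z, |Q z| ≤ C * B := fun z => abs_sum_pmf_le p fun i => hfg i z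
  have hQD : ∀ x y, |Q x - Q y| ≤ (C * D + M * B) * |x - y| := fun x y => by
    simp only [hQ, ← Finset.sum_sub_distrib, ← mul_sub]
    exact abs_sum_pmf_le p fun i =>
      lip_mul (hfB i) (hS.lip i) (fun z => hB (ψ i z)) (hψD i) x y
  have hPint : ∫ z, P z ∂m = ∫ z, g z ∂m := by
    have hgm : Measurable fun z => (g z : ℂ) :=
      (continuous_of_lip (g := fun z => (g z : ℂ)) (D := D) fun x y => by
        rw [← Complex.ofReal_sub, Complex.norm_real]; exact hD x y).measurable
    have h := integral_of_stationary p (fun i => (psi_continuous hS i).measurable) hm hgm (B := B)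
      (fun z => by rw [Complex.norm_real]; exact hB z)
    have h2 : ∫ z, (P z : ℂ) ∂m = ∫ z, (g z : ℂ) ∂m := by
      rw [← h]
      simp only [hP]
      push_cast
      rfl
    have h3 : ∫ z, (P z : ℂ) ∂m = ((∫ z, P z ∂m : ℝ) : ℂ) := integral_ofReal
    have h4 : ∫ z, (g z : ℂ) ∂m = ((∫ z, g z ∂m : ℝ) : ℂ) := integral_ofReal
    rw [h3, h4] at h2
    exact_mod_cast h2
  have hsum1 := sum_toReal_pmf p
  have m1 := ae_walk_sum_div p (skew ψ f)
    (fun x i => f i x.1 * g (ψ i x.1) - Q x.1) (C := C * B + C * B)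
    (fun x i => (abs_sub _ _).trans (add_le_add (hfg i _) (hQB _)))
    (fun x => by
      simp only [mul_sub, Finset.sum_sub_distrib, ← Finset.sum_mul, hsum1]
      simp [hQ]) x
  -- The fractional part of s/N before the step is known at that time, so it may multiply a
  -- martingale difference.
  have m2 := ae_walk_sum_div p (skew ψ f)
    (fun x i => (g (ψ i x.1) - P x.1) * Int.fract (x.2 / N)) (C := (B + B) * 1)
    (fun x i => by
      rw [abs_mul]
      refine mul_le_mul ((abs_sub _ _).trans (add_le_add (hB _) (hPB _))) ?_ (abs_nonneg _)
        (by linarith)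
      rw [abs_of_nonneg (Int.fract_nonneg _)]
      exact (Int.fract_lt_one _).le)
    (fun x => by
      simp only [← mul_assoc, ← Finset.sum_mul, mul_sub, Finset.sum_sub_distrib, hsum1]
      simp [hP]) x
  filter_upwards [m1, m2, ae_mean_fract hS p hm hN hB hD x, ae_mean_fract hS p hm hN hPB hPD x,
    ae_mean_fract hS p hm hN hQB hQD x] with a h1 h2 hg' hP' hQ'
  set Z := walk (skew ψ f) x a with hZ
  have hZ1 : ∀ j, Z (j + 1) = (ψ (a j) (Z j).1, (Z j).2 + f (a j) (Z j).1) := fun j => rfl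
  have t1 : Tendsto (mean fun j => f (a j) (Z j).1 * g (Z (j + 1)).1) atTop
      (𝓝 (renewalMean p ψ f m g)) := by
    have := h1.add hQ'.1
    rw [zero_add] at this
    refine this.congr fun n => ?_
    change mean _ n + mean _ n = _
    rw [← mean_add]
    congr 1
    funext j
    rw [hZ1]
    ring
  have t2 : Tendsto (mean fun j => g (Z (j + 1)).1 * Int.fract ((Z (j + 1)).2 / N)) atTop
      (𝓝 ((∫ y, g y ∂m) / 2)) := by
    have := (mean_shift (u := fun j => g (Z j).1 * Int.fract ((Z j).2 / N)) 1).2 hg'.2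
    simpa only [add_comm 1] using this
  have t3 : Tendsto (mean fun j => g (Z (j + 1)).1 * Int.fract ((Z j).2 / N)) atTop
      (𝓝 ((∫ y, g y ∂m) / 2)) := by
    have := h2.add hP'.2
    rw [zero_add, hPint] at this
    refine this.congr fun n => ?_
    change mean _ n + mean _ n = _
    rw [← mean_add]
    congr 1
    funext j
    rw [hZ1]
    ring
  -- The fractional parts after and before the step have the same limit ∫ g / 2, the second because
  -- ∫ P = ∫ g, and they cancel.
  have t4 := ((t1.const_mul (1 / (N : ℝ))).sub t2).add t3
  have hlim : 1 / (N : ℝ) * renewalMean p ψ f m g - (∫ y, g y ∂m) / 2 + (∫ y, g y ∂m) / 2 =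
      renewalMean p ψ f m g / N := by ring
  rw [hlim] at t4
  refine t4.congr fun n => ?_
  rw [← mean_mul_left, ← mean_sub, ← mean_add]
  congr 1
  funext j
  have f1 := Int.self_sub_fract ((Z (j + 1)).2 / N)
  have f2 := Int.self_sub_fract ((Z j).2 / N)
  have f3 : (Z (j + 1)).2 = (Z j).2 + f (a j) (Z j).1 := by rw [hZ1]
  rw [← f1, ← f2, f3]
  ring

end Renewal

/-! ### From averages of Lipschitz functions to frequencies of sets. -/

section Frequency

/-- Convergence of averages of bounded Lipschitz functions implies convergence of frequencies of
sets with null boundary. -/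
lemma mean_indicator_of_lip {ζ : ℕ → ℝ} {ν : Measure ℝ} [IsProbabilityMeasure ν]
    (h : ∀ (g : ℝ → ℝ) (B D : ℝ), (∀ z, |g z| ≤ B) → (∀ x y, |g x - g y| ≤ D * |x - y|) →
      Tendsto (mean fun j => g (ζ j)) atTop (𝓝 (∫ y, g y ∂ν)))
    {E : Set ℝ} (hE : ν (frontier E) = 0) :
    Tendsto (mean fun j => E.indicator (fun _ => (1 : ℝ)) (ζ j)) atTop (𝓝 (ν.real E)) := by
  classical
  -- These are the empirical measures of the first I + 1 terms, a number that is never 0. Bounded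
  -- Lipschitz functions determine weak convergence, and the portmanteau theorem gives the sets with
  -- null boundary.
  set emp : ℕ → Measure ℝ := fun I =>
    ∑ j ∈ Finset.range (I + 1), ((I + 1 : ℕ) : ENNReal)⁻¹ • Measure.dirac (ζ j) with hemp
  have hprob : ∀ I, IsProbabilityMeasure (emp I) := fun I => by
    constructor
    rw [hemp]
    simp only [Measure.finsetSum_apply, Measure.smul_apply, measure_univ, smul_eq_mul, mul_one,
      Finset.sum_const, Finset.card_range, nsmul_eq_mul]
    exact ENNReal.mul_inv_cancel (by simp) (by simp)
  have hreal : ∀ I E, (emp I).real E =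
      mean (fun j => E.indicator (fun _ => (1 : ℝ)) (ζ j)) (I + 1) := by
    intro I E
    rw [measureReal_def, hemp]
    simp only [Measure.finsetSum_apply, Measure.smul_apply, smul_eq_mul, Measure.dirac_apply]
    rw [ENNReal.toReal_sum]
    · simp only [mean, Finset.sum_div, ENNReal.toReal_mul, ENNReal.toReal_inv, ENNReal.toReal_natCast]
      refine Finset.sum_congr rfl fun j _ => ?_
      rw [div_eq_inv_mul]
      congr 1
      by_cases hj : ζ j ∈ E <;> simp [hj]
    · intro j _
      refine ENNReal.mul_ne_top (by simp) ?_
      by_cases hj : ζ j ∈ E <;> simp [hj]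
  let μs : ℕ → ProbabilityMeasure ℝ := fun I => ⟨emp I, hprob I⟩
  let μ : ProbabilityMeasure ℝ := ⟨ν, inferInstance⟩
  have hconv : Tendsto μs atTop (𝓝 μ) := by
    rw [tendsto_iff_forall_lipschitz_integral_tendsto]
    rintro g ⟨B, hB⟩ ⟨D, hD⟩
    have h1 := h g (|g 0| + B) D (fun z => by
      have h2 := hB z 0
      rw [Real.dist_eq] at h2
      have h3 := abs_sub_abs_le_abs_sub (g z) (g 0)
      linarith) (fun x y => by
        have := hD.dist_le_mul x y
        rwa [Real.dist_eq, Real.dist_eq] at this)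
    refine ((tendsto_add_atTop_iff_nat 1).2 h1).congr fun I => ?_
    simp only [μs, ProbabilityMeasure.coe_mk, hemp]
    rw [integral_finsetSum_measure]
    · simp only [integral_smul_measure, integral_dirac, mean, Finset.sum_div]
      refine Finset.sum_congr rfl fun j _ => ?_
      rw [ENNReal.toReal_inv, ENNReal.toReal_natCast, smul_eq_mul, div_eq_inv_mul]
    · intro j _
      refine Integrable.smul_measure ?_ (by simp)
      exact integrable_dirac (by simp)
  have h2 := ProbabilityMeasure.tendsto_measure_of_null_frontier_of_tendsto' hconv (E := E) hE
  have h3 := (ENNReal.tendsto_toReal (measure_ne_top ν E)).comp h2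
  refine (tendsto_add_atTop_iff_nat 1).1 (h3.congr fun I => ?_)
  exact hreal I E

/-- Frequencies count the indices 1, …, I and `mean` counts 0, …, I - 1, hence the shift by one. -/
lemma hasFrequency_iff (x : ℕ → RP1) (ν : Measure RP1) (S : Set RP1) :
    HasFrequency x ν S ↔ Tendsto (mean fun j => S.indicator (fun _ => (1 : ℝ)) (x (j + 1))) atTop
      (𝓝 (ν.real S)) := by
  classical
  unfold HasFrequency
  refine iff_of_eq (congrArg (fun F => Tendsto F atTop (𝓝 (ν.real S))) ?_)
  funext I
  rw [mean]
  congr 1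
  have : {i : ℕ | 1 ≤ i ∧ i ≤ I ∧ x i ∈ S} =
      (((Finset.range I).filter fun j => x (j + 1) ∈ S).map ⟨Nat.succ, Nat.succ_injective⟩ :
        Finset ℕ) := by
    ext i
    simp only [Set.mem_ofPred_eq, Finset.coe_map, Function.Embedding.coeFn_mk, Set.mem_image,
      Finset.mem_coe, Finset.mem_filter, Finset.mem_range]
    constructor
    · rintro ⟨h1, h2, h3⟩
      refine ⟨i - 1, ⟨by omega, ?_⟩, by omega⟩
      rwa [Nat.sub_add_cancel h1]
    · rintro ⟨j, ⟨h1, h2⟩, rfl⟩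
      exact ⟨by omega, by omega, h2⟩
  rw [this, Set.ncard_coe_finset, Finset.card_map, Finset.card_filter]
  push_cast
  refine Finset.sum_congr rfl fun j _ => ?_
  simp [Set.indicator_apply]

/-- Frequencies of a sequence of lines parametrised eventually by `ℓ : ℝ → RP1`. -/
lemma hasFrequency_of_lip {x : ℕ → RP1} {ℓ : ℝ → RP1} (hℓ : MeasurableEmbedding ℓ) {ζ : ℕ → ℝ}
    (hx : ∀ᶠ j in atTop, x j = ℓ (ζ j)) {ν : Measure ℝ} [IsProbabilityMeasure ν]
    (h : ∀ (g : ℝ → ℝ) (B D : ℝ), (∀ z, |g z| ≤ B) → (∀ x y, |g x - g y| ≤ D * |x - y|) →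
      Tendsto (mean fun j => g (ζ (j + 1))) atTop (𝓝 (∫ y, g y ∂ν)))
    {S : Set RP1} (hS : ν (frontier (ℓ ⁻¹' S)) = 0) : HasFrequency x (ν.map ℓ) S := by
  rw [hasFrequency_iff]
  have hE := mean_indicator_of_lip (ζ := fun j => ζ (j + 1)) h hS
  have hval : (ν.map ℓ).real S = ν.real (ℓ ⁻¹' S) := by
    rw [measureReal_def, measureReal_def, hℓ.map_apply]
  rw [hval]
  obtain ⟨n, hn⟩ := eventually_atTop.1 hx
  rw [← mean_shift n] at hE ⊢
  refine hE.congr fun I => ?_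
  congr 1
  funext j
  rw [hn _ (by omega)]
  rfl

end Frequency

/-! ### Normal vectors and the length cocycle. -/

section Geometry

variable {k : ℕ}

/-- The Euclidean norm in coordinates. -/
def nrm (w : ℝ × ℝ) : ℝ := Real.sqrt (w.1 ^ 2 + w.2 ^ 2)

lemma nrm_sq (w : ℝ × ℝ) : nrm w ^ 2 = w.1 ^ 2 + w.2 ^ 2 := Real.sq_sqrt (by positivity)

lemma nrm_nonneg (w : ℝ × ℝ) : 0 ≤ nrm w := Real.sqrt_nonneg _

lemma nrm_pos {w : ℝ × ℝ} (hw : w ≠ 0) : 0 < nrm w := by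
  refine Real.sqrt_pos.2 ?_
  by_contra! h
  refine hw (Prod.ext ?_ ?_)
  · have : w.1 ^ 2 = 0 := by nlinarith [sq_nonneg w.1, sq_nonneg w.2]
    simpa using this
  · have : w.2 ^ 2 = 0 := by nlinarith [sq_nonneg w.1, sq_nonneg w.2]
    simpa using this

lemma nrm_smul (c : ℝ) (w : ℝ × ℝ) : nrm (c • w) = |c| * nrm w := by
  have : (c • w).1 ^ 2 + (c • w).2 ^ 2 = c ^ 2 * (w.1 ^ 2 + w.2 ^ 2) := by
    simp only [Prod.smul_fst, Prod.smul_snd, smul_eq_mul]; ring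
  rw [nrm, this, Real.sqrt_mul (sq_nonneg c), Real.sqrt_sq_eq_abs, nrm]

lemma dot_le (w x : ℝ × ℝ) : |w.1 * x.1 + w.2 * x.2| ≤ nrm w * nrm x := by
  rw [nrm, nrm, ← Real.sqrt_mul (by positivity)]
  refine Real.abs_le_sqrt ?_
  nlinarith [sq_nonneg (w.1 * x.2 - w.2 * x.1)]

lemma norm_plane (x : Plane) : ‖x‖ = nrm (x 0, x 1) := by
  rw [EuclideanSpace.norm_eq, nrm]
  simp [Fin.sum_univ_two]

/-- The action of the transpose of a matrix in coordinates. -/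
def tr (M : Matrix (Fin 2) (Fin 2) ℝ) (w : ℝ × ℝ) : ℝ × ℝ :=
  (M 0 0 * w.1 + M 1 0 * w.2, M 0 1 * w.1 + M 1 1 * w.2)

lemma tr_smul (M : Matrix (Fin 2) (Fin 2) ℝ) (c : ℝ) (w : ℝ × ℝ) : tr M (c • w) = c • tr M w := by
  ext <;> simp [tr] <;> ring

lemma lin_zero (M : Matrix (Fin 2) (Fin 2) ℝ) (x : Plane) :
    lin M x 0 = M 0 0 * x 0 + M 0 1 * x 1 := by
  simp [lin, Matrix.toLpLin_apply]

lemma lin_one (M : Matrix (Fin 2) (Fin 2) ℝ) (x : Plane) :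
    lin M x 1 = M 1 0 * x 0 + M 1 1 * x 1 := by
  simp [lin, Matrix.toLpLin_apply]

lemma plane_ext {x y : Plane} (h0 : x 0 = y 0) (h1 : x 1 = y 1) : x = y := by
  ext i
  fin_cases i
  · exact h0
  · exact h1

lemma det_ne_zero (g : GL (Fin 2) ℝ) : g.val 0 0 * g.val 1 1 - g.val 0 1 * g.val 1 0 ≠ 0 := by
  rw [← Matrix.det_fin_two]
  exact g.det.ne_zero

lemma tr_ne_zero (g : GL (Fin 2) ℝ) {w : ℝ × ℝ} (hw : w ≠ 0) : tr g.val w ≠ 0 := by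
  intro h
  have h1 : g.val 0 0 * w.1 + g.val 1 0 * w.2 = 0 := congrArg Prod.fst h
  have h2 : g.val 0 1 * w.1 + g.val 1 1 * w.2 = 0 := congrArg Prod.snd h
  refine hw (Prod.ext ?_ ?_)
  · refine (mul_eq_zero.1 ?_).resolve_left (det_ne_zero g)
    linear_combination g.val 1 1 * h1 - g.val 1 0 * h2
  · refine (mul_eq_zero.1 ?_).resolve_left (det_ne_zero g)
    linear_combination g.val 0 0 * h2 - g.val 0 1 * h1

lemma vec_ne_zero {w : ℝ × ℝ} (hw : w ≠ 0) : (!₂[-w.2, w.1] : Plane) ≠ 0 := by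
  intro h
  refine hw (Prod.ext ?_ ?_)
  · simpa using congrArg (fun v : Plane => v 1) h
  · simpa using congrArg (fun v : Plane => v 0) h

open Classical in
/-- The line perpendicular to the vector `w` (an arbitrary line for `w = 0`). -/
def perpLine (w : ℝ × ℝ) : RP1 :=
  if hw : w ≠ 0 then Projectivization.mk ℝ !₂[-w.2, w.1] (vec_ne_zero hw) else lineAt 0

lemma perpLine_eq {w : ℝ × ℝ} (hw : w ≠ 0) :
    perpLine w = Projectivization.mk ℝ !₂[-w.2, w.1] (vec_ne_zero hw) := dif_pos hw

lemma exists_perpLine (θ : RP1) : ∃ w : ℝ × ℝ, w ≠ 0 ∧ perpLine w = θ := by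
  induction θ using Projectivization.ind with
  | h v hv =>
    have hw : (v 1, -v 0) ≠ 0 := by
      intro h
      have h1 : v 1 = 0 := congrArg Prod.fst h
      have h2 : -v 0 = 0 := congrArg Prod.snd h
      exact hv (plane_ext (by simpa using h2) h1)
    refine ⟨(v 1, -v 0), hw, ?_⟩
    rw [perpLine_eq hw]
    congr 1
    exact plane_ext (by simp) (by simp)

lemma perpLine_smul {c : ℝ} (hc : c ≠ 0) (w : ℝ × ℝ) : perpLine (c • w) = perpLine w := by
  by_cases hw : w = 0
  · simp [hw]
  · rw [perpLine_eq hw, perpLine_eq (smul_ne_zero hc hw), Projectivization.mk_eq_mk_iff']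
    exact ⟨c, plane_ext (by simp) (by simp)⟩

/-- With J the rotation by a right angle, A⁻¹ J = (det A)⁻¹ J Aᵀ for 2 × 2 matrices: while A⁻¹ acts
on directions, Aᵀ acts on normals. -/
lemma phi_perpLine (A : Fin k → GL (Fin 2) ℝ) (i : Fin k) {w : ℝ × ℝ} (hw : w ≠ 0) :
    phi A i (perpLine w) = perpLine (tr (A i).val w) := by
  rw [perpLine_eq hw, perpLine_eq (tr_ne_zero _ hw), phi, Projectivization.map_mk,
    Projectivization.mk_eq_mk_iff']
  have hd := det_ne_zero (A i)
  set D := (A i).val 0 0 * (A i).val 1 1 - (A i).val 0 1 * (A i).val 1 0 with hD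
  refine ⟨D⁻¹, lin_injective (A i) ?_⟩
  have hinv : lin (A i).val (lin (A i)⁻¹.val !₂[-w.2, w.1]) = !₂[-w.2, w.1] := by
    have : (A i).val * (A i)⁻¹.val = 1 := by simp
    apply WithLp.ofLp_injective 2
    simp only [lin, Matrix.toLpLin_apply, Matrix.mulVec_mulVec, this, Matrix.one_mulVec]
  rw [hinv]
  refine plane_ext ?_ ?_
  · rw [lin_zero]
    simp only [tr, PiLp.smul_apply, smul_eq_mul, Matrix.cons_val_zero,
      Matrix.cons_val_one]
    field_simp
    rw [hD]
    ring
  · rw [lin_one]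
    simp only [tr, PiLp.smul_apply, smul_eq_mul, Matrix.cons_val_zero,
      Matrix.cons_val_one]
    field_simp
    rw [hD]
    ring

/-- The product of the transposed matrices applied to a vector. -/
def trWalk (A : Fin k → GL (Fin 2) ℝ) (a : ℕ → Fin k) (w : ℝ × ℝ) : ℕ → ℝ × ℝ :=
  walk (fun i => tr (A i).val) w a

lemma trWalk_ne_zero (A : Fin k → GL (Fin 2) ℝ) (a : ℕ → Fin k) {w : ℝ × ℝ} (hw : w ≠ 0) (n : ℕ) :
    trWalk A a w n ≠ 0 := by
  induction n with
  | zero => exact hw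
  | succ n ih => exact tr_ne_zero _ ih

lemma orbit_perpLine (A : Fin k → GL (Fin 2) ℝ) (a : ℕ → Fin k) {w : ℝ × ℝ} (hw : w ≠ 0) (n : ℕ) :
    orbit A a (perpLine w) n = perpLine (trWalk A a w n) := by
  induction n with
  | zero => rfl
  | succ n ih => rw [orbit, ih, phi_perpLine A _ (trWalk_ne_zero A a hw n)]; rfl

/-- Translations cancel in differences. The last letter is the innermost map, so moving the matrices
to the other side of the inner product applies the transposes to w in the order of the letters. -/
lemma wordMap_dot (A : Fin k → GL (Fin 2) ℝ) (d : Fin k → Plane) (a : ℕ → Fin k) (w : ℝ × ℝ)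
    (n : ℕ) : ∀ x y : Plane,
    w.1 * (wordMap A d a n x 0 - wordMap A d a n y 0) +
      w.2 * (wordMap A d a n x 1 - wordMap A d a n y 1) =
    (trWalk A a w n).1 * (x 0 - y 0) + (trWalk A a w n).2 * (x 1 - y 1) := by
  induction n with
  | zero => intro x y; rfl
  | succ n ih =>
    intro x y
    simp only [wordMap, Function.comp]
    rw [ih]
    simp only [PiLp.add_apply, lin_zero, lin_one, trWalk, walk, tr]
    ring

lemma starProjection_perpLine {w : ℝ × ℝ} (hw : w ≠ 0) (y : Plane) :
    (perpLine w).submoduleᗮ.starProjection y =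
      ((w.1 * y 0 + w.2 * y 1) / (w.1 ^ 2 + w.2 ^ 2)) • (!₂[w.1, w.2] : Plane) := by
  have hpos : w.1 ^ 2 + w.2 ^ 2 ≠ 0 := by rw [← nrm_sq]; exact pow_ne_zero 2 (nrm_pos hw).ne'
  have hsub : (perpLine w).submodule = Submodule.span ℝ {(!₂[-w.2, w.1] : Plane)} := by
    rw [perpLine_eq hw, Projectivization.submodule_mk]
  have hproj : ∀ (K : Submodule ℝ Plane) [K.HasOrthogonalProjection],
      K = Submodule.span ℝ {(!₂[-w.2, w.1] : Plane)} →
      Kᗮ.starProjection y = y - (Submodule.span ℝ {(!₂[-w.2, w.1] : Plane)}).starProjection y := by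
    rintro K _ rfl
    rw [Submodule.starProjection_orthogonal_val]
  rw [hproj _ hsub, Submodule.starProjection_singleton, norm_plane]
  have hin : inner ℝ (!₂[-w.2, w.1] : Plane) y = -w.2 * y 0 + w.1 * y 1 := by
    simp [PiLp.inner_apply, Fin.sum_univ_two, mul_comm]
  have hsq : nrm ((!₂[-w.2, w.1] : Plane) 0, (!₂[-w.2, w.1] : Plane) 1) ^ 2 =
      w.1 ^ 2 + w.2 ^ 2 := by
    rw [nrm_sq]
    simp only [Matrix.cons_val_zero, Matrix.cons_val_one]
    ring
  simp only [hin, RCLike.ofReal_real_eq_id, id, hsq]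
  refine plane_ext ?_ ?_
  · simp only [PiLp.sub_apply, PiLp.smul_apply, smul_eq_mul, Matrix.cons_val_zero]
    field_simp
    ring
  · simp only [PiLp.sub_apply, PiLp.smul_apply, smul_eq_mul, Matrix.cons_val_one,
      Matrix.cons_val_fin_one]
    field_simp
    ring

/-- The projection measures inner products with w/|w|, and on the ellipse these vary as inner
products with W/|w| vary on the disk, W being the image of w under the transposes. The extremes are
at ± W/|W|. -/
lemma projLength_perpLine (A : Fin k → GL (Fin 2) ℝ) (d : Fin k → Plane) (a : ℕ → Fin k)
    {w : ℝ × ℝ} (hw : w ≠ 0) (n : ℕ) :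
    projLength A d (perpLine w) a n = 2 * nrm (trWalk A a w n) / nrm w := by
  have hW := trWalk_ne_zero A a hw n
  set W := trWalk A a w n with hWdef
  have hwp := nrm_pos hw
  have hWp := nrm_pos hW
  have hdist : ∀ x y : Plane,
      dist ((perpLine w).submoduleᗮ.starProjection (wordMap A d a n x))
        ((perpLine w).submoduleᗮ.starProjection (wordMap A d a n y)) =
      |W.1 * (x 0 - y 0) + W.2 * (x 1 - y 1)| / nrm w := by
    intro x y
    rw [dist_eq_norm, ← map_sub, starProjection_perpLine hw, norm_smul, norm_plane]
    simp only [PiLp.sub_apply]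
    rw [wordMap_dot, ← hWdef]
    have : nrm ((!₂[w.1, w.2] : Plane) 0, (!₂[w.1, w.2] : Plane) 1) = nrm w := by simp
    rw [this, ← nrm_sq, Real.norm_eq_abs, abs_div, abs_of_pos (pow_pos hwp 2)]
    field_simp
  have hball : ∀ x : Plane, x ∈ Metric.closedBall (0 : Plane) 1 ↔ nrm (x 0, x 1) ≤ 1 := fun x => by
    rw [mem_closedBall_zero_iff, norm_plane]
  unfold projLength
  have hub : ∀ u ∈ (perpLine w).submoduleᗮ.starProjection ''
      (wordMap A d a n '' Metric.closedBall 0 1), ∀ v ∈ (perpLine w).submoduleᗮ.starProjection ''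
      (wordMap A d a n '' Metric.closedBall 0 1), dist u v ≤ 2 * nrm W / nrm w := by
    rintro _ ⟨_, ⟨x, hx, rfl⟩, rfl⟩ _ ⟨_, ⟨y, hy, rfl⟩, rfl⟩
    rw [hdist]
    gcongr
    have h1 := (dot_le W (x 0, x 1)).trans
      (mul_le_mul_of_nonneg_left ((hball x).1 hx) hWp.le)
    have h2 := (dot_le W (y 0, y 1)).trans
      (mul_le_mul_of_nonneg_left ((hball y).1 hy) hWp.le)
    have : W.1 * (x 0 - y 0) + W.2 * (x 1 - y 1) =
        (W.1 * x 0 + W.2 * x 1) - (W.1 * y 0 + W.2 * y 1) := by ring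
    rw [this]
    refine (abs_sub _ _).trans ?_
    simp only at h1 h2
    linarith
  refine le_antisymm (Metric.diam_le_of_forall_dist_le (by positivity) hub) ?_
  set x : Plane := !₂[W.1 / nrm W, W.2 / nrm W] with hx
  have hx1 : nrm (x 0, x 1) = 1 := by
    have : ((x 0, x 1) : ℝ × ℝ) = (nrm W)⁻¹ • W := by
      ext <;> simp [hx, div_eq_inv_mul]
    rw [this, nrm_smul, abs_inv, abs_of_pos hWp, inv_mul_cancel₀ hWp.ne']
  have hx2 : nrm ((-x) 0, (-x) 1) = 1 := by
    rw [← hx1, nrm, nrm]; simp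
  have hval : dist ((perpLine w).submoduleᗮ.starProjection (wordMap A d a n x))
      ((perpLine w).submoduleᗮ.starProjection (wordMap A d a n (-x))) = 2 * nrm W / nrm w := by
    rw [hdist]
    have : W.1 * (x 0 - (-x) 0) + W.2 * (x 1 - (-x) 1) = 2 * nrm W := by
      simp only [hx, PiLp.neg_apply, PiLp.toLp_apply, Matrix.cons_val_zero, Matrix.cons_val_one]
      field_simp
      rw [nrm_sq]
      ring
    rw [this, abs_of_pos (by positivity)]
  rw [← hval]
  refine Metric.dist_le_diam_of_mem (Metric.isBounded_iff.2 ⟨_, fun u hu v hv => hub u hu v hv⟩)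
    ⟨_, ⟨x, (hball x).2 hx1.le, rfl⟩, rfl⟩ ⟨_, ⟨-x, (hball _).2 hx2.le, rfl⟩, rfl⟩

lemma wordLength_perpLine (b : ℝ) (A : Fin k → GL (Fin 2) ℝ) (d : Fin k → Plane) (a : ℕ → Fin k)
    {w : ℝ × ℝ} (hw : w ≠ 0) (n : ℕ) :
    wordLength b A d (perpLine w) a n = Real.logb b (nrm w) - Real.logb b (nrm (trWalk A a w n)) := by
  have h1 := nrm_pos hw
  have h2 := nrm_pos (trWalk_ne_zero A a hw n)
  rw [wordLength, projLength_perpLine A d a hw]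
  have : 2 * nrm (trWalk A a w n) / nrm w / 2 = nrm (trWalk A a w n) / nrm w := by ring
  rw [this, Real.logb_div h2.ne' h1.ne']
  ring

/-- The increment of the length function, in terms of a vector perpendicular to the line. -/
def weight (b : ℝ) (A : Fin k → GL (Fin 2) ℝ) (i : Fin k) (w : ℝ × ℝ) : ℝ :=
  Real.logb b (nrm w) - Real.logb b (nrm (tr (A i).val w))

lemma weight_smul (b : ℝ) (A : Fin k → GL (Fin 2) ℝ) (i : Fin k) {c : ℝ} (hc : c ≠ 0) {w : ℝ × ℝ}
    (hw : w ≠ 0) : weight b A i (c • w) = weight b A i w := by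
  have h1 := (nrm_pos hw).ne'
  have h2 := (nrm_pos (tr_ne_zero (A i) hw)).ne'
  have h3 : |c| ≠ 0 := abs_ne_zero.2 hc
  rw [weight, weight, tr_smul, nrm_smul, nrm_smul, Real.logb_mul h3 h1, Real.logb_mul h3 h2]
  ring

lemma wordLength_succ_sub (b : ℝ) (A : Fin k → GL (Fin 2) ℝ) (d : Fin k → Plane) (a : ℕ → Fin k)
    {w : ℝ × ℝ} (hw : w ≠ 0) (n : ℕ) :
    wordLength b A d (perpLine w) a (n + 1) - wordLength b A d (perpLine w) a n =
      weight b A (a n) (trWalk A a w n) := by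
  rw [wordLength_perpLine b A d a hw, wordLength_perpLine b A d a hw, weight]
  change _ - Real.logb b (nrm (tr _ (trWalk A a w n))) - _ = _
  ring

/-- By Cauchy–Schwarz, |Aᵀw|² = ⟨w, A Aᵀ w⟩ ≤ |w| ‖A‖ |Aᵀ w|. -/
lemma nrm_tr_le (g : GL (Fin 2) ℝ) (w : ℝ × ℝ) :
    nrm (tr g.val w) ≤ ‖Matrix.toEuclideanCLM (𝕜 := ℝ) g.val‖ * nrm w := by
  set q := tr g.val w with hq
  set x : Plane := !₂[q.1, q.2] with hx
  have h1 : nrm (lin g.val x 0, lin g.val x 1) ≤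
      ‖Matrix.toEuclideanCLM (𝕜 := ℝ) g.val‖ * nrm q := by
    have h2 := (Matrix.toEuclideanCLM (𝕜 := ℝ) g.val).le_opNorm x
    rw [norm_plane, norm_plane x] at h2
    have h3 : nrm (x 0, x 1) = nrm q := by simp [hx]
    rw [h3] at h2
    exact h2
  have h4 : nrm q ^ 2 = w.1 * lin g.val x 0 + w.2 * lin g.val x 1 := by
    rw [nrm_sq, lin_zero, lin_one]
    simp only [hx, hq, tr, PiLp.toLp_apply, Matrix.cons_val_zero, Matrix.cons_val_one]
    ring
  have h5 := (le_abs_self _).trans (dot_le w (lin g.val x 0, lin g.val x 1))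
  simp only at h5
  rw [← h4] at h5
  have h6 := mul_le_mul_of_nonneg_left h1 (nrm_nonneg w)
  rcases (nrm_nonneg q).eq_or_lt with h | h
  · rw [← h]
    exact mul_nonneg (norm_nonneg _) (nrm_nonneg _)
  · nlinarith

/-- Cramer's rule bounds the inverse of the transpose. -/
lemma exists_nrm_le (g : GL (Fin 2) ℝ) : ∃ K > 0, ∀ w, nrm w ≤ K * nrm (tr g.val w) := by
  have hd := det_ne_zero g
  set D := g.val 0 0 * g.val 1 1 - g.val 0 1 * g.val 1 0 with hD
  set s := nrm (g.val 1 1, g.val 1 0) + nrm (g.val 0 0, g.val 0 1) with hs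
  refine ⟨s / |D| + 1, ?_, fun w => ?_⟩
  · have := nrm_nonneg (g.val 1 1, g.val 1 0)
    have := nrm_nonneg (g.val 0 0, g.val 0 1)
    positivity
  · set q := tr g.val w with hq
    have h1 : D * w.1 = g.val 1 1 * q.1 + (-g.val 1 0) * q.2 := by
      simp only [hq, tr, hD]; ring
    have h2 : D * w.2 = (-g.val 0 1) * q.1 + g.val 0 0 * q.2 := by
      simp only [hq, tr, hD]; ring
    have e1 : |D| * |w.1| ≤ nrm (g.val 1 1, g.val 1 0) * nrm q := by
      rw [← abs_mul, h1]
      refine (dot_le (g.val 1 1, -g.val 1 0) q).trans (le_of_eq ?_)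
      congr 1
      simp [nrm]
    have e2 : |D| * |w.2| ≤ nrm (g.val 0 0, g.val 0 1) * nrm q := by
      rw [← abs_mul, h2]
      refine (dot_le (-g.val 0 1, g.val 0 0) q).trans (le_of_eq ?_)
      congr 1
      simp [nrm, add_comm]
    have e3 : nrm w ≤ |w.1| + |w.2| := by
      refine Real.sqrt_le_iff.2 ⟨by positivity, ?_⟩
      rw [← sq_abs w.1, ← sq_abs w.2]
      nlinarith [abs_nonneg w.1, abs_nonneg w.2]
    have hDp : 0 < |D| := abs_pos.2 hd
    have e4 : nrm w ≤ s / |D| * nrm q := by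
      rw [div_mul_eq_mul_div, le_div_iff₀ hDp, hs]
      nlinarith
    have := nrm_nonneg q
    nlinarith

lemma exists_weight_bounds {b : ℝ} (hb : 1 < b) (A : Fin k → GL (Fin 2) ℝ)
    (hnorm : ∀ i, ‖Matrix.toEuclideanCLM (𝕜 := ℝ) (A i).val‖ < 1) :
    ∃ c C : ℝ, 0 < c ∧ ∀ i w, w ≠ 0 → c ≤ weight b A i w ∧ weight b A i w ≤ C := by
  have key : ∀ i, ∃ c C : ℝ, 0 < c ∧ ∀ w, w ≠ 0 → c ≤ weight b A i w ∧ weight b A i w ≤ C := by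
    intro i
    obtain ⟨K, hK, hKw⟩ := exists_nrm_le (A i)
    obtain ⟨r, hr0, hr1, hr⟩ : ∃ r : ℝ, 0 < r ∧ r < 1 ∧ ∀ w, nrm (tr (A i).val w) ≤ r * nrm w := by
      -- The midpoint between the norm and 1 is evidently positive, as its logarithm requires, and
      -- still less than 1.
      refine ⟨(‖Matrix.toEuclideanCLM (𝕜 := ℝ) (A i).val‖ + 1) / 2, by positivity,
        by linarith [hnorm i], fun w => (nrm_tr_le (A i) w).trans ?_⟩
      exact mul_le_mul_of_nonneg_right (by linarith [hnorm i]) (nrm_nonneg w)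
    refine ⟨-Real.logb b r, Real.logb b K, ?_, fun w hw => ?_⟩
    · have := Real.logb_neg hb hr0 hr1
      linarith
    · have h1 := nrm_pos hw
      have h2 := nrm_pos (tr_ne_zero (A i) hw)
      constructor
      · have := Real.logb_le_logb_of_le hb h2 (hr w)
        rw [Real.logb_mul hr0.ne' h1.ne'] at this
        rw [weight]; linarith
      · have := Real.logb_le_logb_of_le hb h1 (hKw w)
        rw [Real.logb_mul hK.ne' h2.ne'] at this
        rw [weight]; linarith
  choose c C hc h using key
  rcases isEmpty_or_nonempty (Fin k) with he | he
  · exact ⟨1, 1, one_pos, fun i => (he.false i).elim⟩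
  · obtain ⟨i₀, h0⟩ := Finite.exists_min c
    obtain ⟨i₁, h1⟩ := Finite.exists_max C
    exact ⟨c i₀, C i₁, hc i₀, fun i w hw =>
      ⟨(h0 i).trans (h i w hw).1, (h i w hw).2.trans (h1 i)⟩⟩

end Geometry

/-! ### Charts of the two open quadrants and the action of positive matrices on them. -/

section Coordinates

variable {k : ℕ}

/-- The product of the coordinates of a unit vector on a line. -/
def coordProd (θ : RP1) : ℝ := θ.rep 0 * θ.rep 1 / (θ.rep 0 ^ 2 + θ.rep 1 ^ 2)

/-- The squared second coordinate of a unit vector on a line. -/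
def coordSq (θ : RP1) : ℝ := θ.rep 1 ^ 2 / (θ.rep 0 ^ 2 + θ.rep 1 ^ 2)

lemma coordProd_mk (v : Plane) (hv : v ≠ 0) :
    coordProd (Projectivization.mk ℝ v hv) = v 0 * v 1 / (v 0 ^ 2 + v 1 ^ 2) := by
  obtain ⟨a, ha⟩ := Projectivization.exists_smul_eq_mk_rep ℝ v hv
  have ha0 : (a : ℝ) ≠ 0 := a.ne_zero
  rw [coordProd, ← ha]
  simp only [Units.smul_def, PiLp.smul_apply, smul_eq_mul]
  rw [← mul_div_mul_left (v 0 * v 1) _ (pow_ne_zero 2 ha0)]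
  congr 1 <;> ring

lemma coordSq_mk (v : Plane) (hv : v ≠ 0) :
    coordSq (Projectivization.mk ℝ v hv) = v 1 ^ 2 / (v 0 ^ 2 + v 1 ^ 2) := by
  obtain ⟨a, ha⟩ := Projectivization.exists_smul_eq_mk_rep ℝ v hv
  have ha0 : (a : ℝ) ≠ 0 := a.ne_zero
  rw [coordSq, ← ha]
  simp only [Units.smul_def, PiLp.smul_apply, smul_eq_mul]
  rw [← mul_div_mul_left (v 1 ^ 2) _ (pow_ne_zero 2 ha0)]
  congr 1 <;> ring

lemma sq_add_sq_ne_zero {v : Plane} (hv : v ≠ 0) : v 0 ^ 2 + v 1 ^ 2 ≠ 0 := by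
  have h : 0 < ‖v‖ := norm_pos_iff.2 hv
  rw [norm_plane] at h
  have := nrm_sq (v 0, v 1)
  simp only at this
  rw [← this]
  positivity

lemma continuous_coordProd : Continuous coordProd := by
  refine continuous_coinduced_dom.2 ?_
  have : (coordProd ∘ fun v : {v : Plane // v ≠ 0} => Projectivization.mk' ℝ v) =
      fun v => v.1 0 * v.1 1 / (v.1 0 ^ 2 + v.1 1 ^ 2) := by
    funext v
    exact coordProd_mk v.1 v.2
  rw [this]
  refine Continuous.div (by fun_prop) (by fun_prop) fun v => sq_add_sq_ne_zero v.2

lemma continuous_coordSq : Continuous coordSq := by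
  refine continuous_coinduced_dom.2 ?_
  have : (coordSq ∘ fun v : {v : Plane // v ≠ 0} => Projectivization.mk' ℝ v) =
      fun v => v.1 1 ^ 2 / (v.1 0 ^ 2 + v.1 1 ^ 2) := by
    funext v
    exact coordSq_mk v.1 v.2
  rw [this]
  refine Continuous.div (by fun_prop) (by fun_prop) fun v => sq_add_sq_ne_zero v.2

lemma coordProd_perpLine {w : ℝ × ℝ} (hw : w ≠ 0) :
    coordProd (perpLine w) = -(w.1 * w.2) / (w.1 ^ 2 + w.2 ^ 2) := by
  rw [perpLine_eq hw, coordProd_mk]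
  simp only [Matrix.cons_val_zero, Matrix.cons_val_one, Matrix.cons_val_fin_one]
  congr 1 <;> ring

lemma coordSq_perpLine {w : ℝ × ℝ} (hw : w ≠ 0) :
    coordSq (perpLine w) = w.1 ^ 2 / (w.1 ^ 2 + w.2 ^ 2) := by
  rw [perpLine_eq hw, coordSq_mk]
  simp only [Matrix.cons_val_zero, Matrix.cons_val_one, Matrix.cons_val_fin_one]
  congr 1
  ring

lemma sum_sq_pos {w : ℝ × ℝ} (hw : w ≠ 0) : 0 < w.1 ^ 2 + w.2 ^ 2 := by
  rw [← nrm_sq]; exact pow_pos (nrm_pos hw) 2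

lemma coordProd_neg_iff {w : ℝ × ℝ} (hw : w ≠ 0) : coordProd (perpLine w) < 0 ↔ 0 < w.1 * w.2 := by
  rw [coordProd_perpLine hw, div_neg_iff]
  have := sum_sq_pos hw
  constructor
  · rintro (h | h) <;> linarith [h.1, h.2]
  · intro h
    exact Or.inr ⟨by linarith, this⟩

lemma coordProd_pos_iff {w : ℝ × ℝ} (hw : w ≠ 0) : 0 < coordProd (perpLine w) ↔ w.1 * w.2 < 0 := by
  rw [coordProd_perpLine hw, lt_div_iff₀ (sum_sq_pos hw), zero_mul, neg_pos]

lemma mem_secondQuadrant_iff (θ : RP1) : θ ∈ secondQuadrant ↔ coordProd θ ≤ 0 := by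
  induction θ using Projectivization.ind with
  | h v hv =>
    rw [coordProd_mk]
    have hpos : 0 < v 0 ^ 2 + v 1 ^ 2 :=
      lt_of_le_of_ne (by positivity) (sq_add_sq_ne_zero hv).symm
    rw [div_nonpos_iff]
    simp only [secondQuadrant, Set.mem_ofPred_eq, Projectivization.submodule_mk,
      Submodule.mem_span_singleton]
    constructor
    · intro h
      exact Or.inr ⟨h v ⟨1, one_smul _ _⟩, hpos.le⟩
    · rintro (h | h)
      · linarith [h.1, h.2]
      · rintro _ ⟨c, rfl⟩
        simp only [PiLp.smul_apply, smul_eq_mul]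
        nlinarith [h.1, mul_nonneg (sq_nonneg c) (neg_nonneg.2 h.1)]

/-- The line perpendicular to `(1, exp z)`; these are the lines in the open second quadrant. -/
def line (z : ℝ) : RP1 := perpLine (1, Real.exp z)

/-- The line spanned by `(1, exp y)`. -/
def posLine (y : ℝ) : RP1 := perpLine (Real.exp y, -1)

lemma one_exp_ne_zero (z : ℝ) : ((1, Real.exp z) : ℝ × ℝ) ≠ 0 := fun h =>
  one_ne_zero (congrArg Prod.fst h)

lemma exp_neg_one_ne_zero (y : ℝ) : ((Real.exp y, -1) : ℝ × ℝ) ≠ 0 := fun h =>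
  (Real.exp_pos y).ne' (congrArg Prod.fst h)

/-- The inverse of `line`. -/
def lineCoord (θ : RP1) : ℝ := Real.log (-coordProd θ / coordSq θ)

lemma lineCoord_line (z : ℝ) : lineCoord (line z) = z := by
  rw [lineCoord, line, coordProd_perpLine (one_exp_ne_zero z), coordSq_perpLine (one_exp_ne_zero z)]
  have h := (sum_sq_pos (one_exp_ne_zero z)).ne'
  simp only at h ⊢
  have : -(-(1 * Real.exp z) / (1 ^ 2 + Real.exp z ^ 2)) / (1 ^ 2 / (1 ^ 2 + Real.exp z ^ 2)) =
      Real.exp z := by field_simp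
  rw [this, Real.log_exp]

lemma line_injective : Function.Injective line := Function.LeftInverse.injective lineCoord_line

lemma perpLine_eq_line {w : ℝ × ℝ} (hw : 0 < w.1 * w.2) :
    perpLine w = line (Real.log (w.2 / w.1)) := by
  have h1 : w.1 ≠ 0 := left_ne_zero_of_mul hw.ne'
  have h2 : 0 < w.2 / w.1 := by
    have : w.2 / w.1 = w.1 * w.2 / w.1 ^ 2 := by field_simp
    rw [this]; positivity
  rw [line, Real.exp_log h2, ← perpLine_smul h1 (1, w.2 / w.1)]
  congr 1
  ext
  · simp
  · simp only [Prod.smul_snd, smul_eq_mul]; field_simp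

lemma exists_line {θ : RP1} (h : coordProd θ < 0) : ∃ z, θ = line z := by
  obtain ⟨w, hw, rfl⟩ := exists_perpLine θ
  exact ⟨_, perpLine_eq_line ((coordProd_neg_iff hw).1 h)⟩

lemma coordProd_line (z : ℝ) : coordProd (line z) < 0 :=
  (coordProd_neg_iff (one_exp_ne_zero z)).2 (by simpa using Real.exp_pos z)

lemma range_line : Set.range line = {θ | coordProd θ < 0} := by
  ext θ
  constructor
  · rintro ⟨z, rfl⟩; exact coordProd_line z
  · intro h
    obtain ⟨z, hz⟩ := exists_line h
    exact ⟨z, hz.symm⟩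

lemma continuous_line : Continuous line := by
  have h : Continuous fun z : ℝ => (⟨!₂[-Real.exp z, 1], vec_ne_zero (one_exp_ne_zero z)⟩ :
      {v : Plane // v ≠ 0}) := by
    refine Continuous.subtype_mk ?_ _
    refine (PiLp.continuous_toLp 2 _).comp (continuous_pi fun i => ?_)
    fin_cases i
    · exact Real.continuous_exp.neg
    · exact continuous_const
  have h2 : Continuous fun v : {v : Plane // v ≠ 0} => (Projectivization.mk' ℝ v : RP1) :=
    continuous_coinduced_rng
  convert h2.comp h using 1
  funext z
  rw [line, perpLine_eq (one_exp_ne_zero z)]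
  rfl

lemma measurable_lineCoord : Measurable lineCoord :=
  Real.measurable_log.comp (continuous_coordProd.measurable.neg.div continuous_coordSq.measurable)

lemma measurableEmbedding_line : MeasurableEmbedding line := by
  refine MeasurableEmbedding.of_measurable_inverse continuous_line.measurable ?_
    measurable_lineCoord lineCoord_line
  rw [range_line]
  exact measurableSet_lt continuous_coordProd.measurable measurable_const

/-- The inverse of `posLine`. -/
def posCoord (θ : RP1) : ℝ := Real.log (coordSq θ / coordProd θ)

lemma posCoord_posLine (y : ℝ) : posCoord (posLine y) = y := by
  rw [posCoord, posLine, coordProd_perpLine (exp_neg_one_ne_zero y),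
    coordSq_perpLine (exp_neg_one_ne_zero y)]
  have h := (sum_sq_pos (exp_neg_one_ne_zero y)).ne'
  have h2 := (Real.exp_pos y).ne'
  simp only at h ⊢
  have : Real.exp y ^ 2 / (Real.exp y ^ 2 + (-1) ^ 2) /
      (-(Real.exp y * -1) / (Real.exp y ^ 2 + (-1) ^ 2)) = Real.exp y := by field_simp
  rw [this, Real.log_exp]

lemma posLine_injective : Function.Injective posLine :=
  Function.LeftInverse.injective posCoord_posLine

lemma exists_posLine {θ : RP1} (h : 0 < coordProd θ) : ∃ y, θ = posLine y := by
  obtain ⟨w, hw, rfl⟩ := exists_perpLine θ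
  have hlt := (coordProd_pos_iff hw).1 h
  have h1 : w.2 ≠ 0 := right_ne_zero_of_mul hlt.ne
  have h2 : 0 < -w.1 / w.2 := by
    have : -w.1 / w.2 = -(w.1 * w.2) / w.2 ^ 2 := by field_simp
    rw [this]
    have : 0 < w.2 ^ 2 := by positivity
    exact div_pos (by linarith) this
  refine ⟨Real.log (-w.1 / w.2), ?_⟩
  rw [posLine, Real.exp_log h2, ← perpLine_smul (neg_ne_zero.2 h1) (-w.1 / w.2, -1)]
  congr 1
  ext
  · simp only [Prod.smul_fst, smul_eq_mul]; field_simp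
  · simp

/-- The projective action of a positive matrix in the coordinate `log (y / x)`. -/
def act (M : Matrix (Fin 2) (Fin 2) ℝ) (z : ℝ) : ℝ :=
  Real.log ((M 1 0 + M 1 1 * Real.exp z) / (M 0 0 + M 0 1 * Real.exp z))

section

variable {M : Matrix (Fin 2) (Fin 2) ℝ} (hM : ∀ r c, 0 < M r c)
include hM

lemma row_pos (r : Fin 2) (z : ℝ) : 0 < M r 0 + M r 1 * Real.exp z := by
  have := hM r 0
  have := hM r 1
  positivity

lemma exp_act (z : ℝ) :
    Real.exp (act M z) = (M 1 0 + M 1 1 * Real.exp z) / (M 0 0 + M 0 1 * Real.exp z) :=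
  Real.exp_log (div_pos (row_pos hM 1 z) (row_pos hM 0 z))

/-- Birkhoff's contraction. With P = M₀₀M₁₁ and Q = M₀₁M₁₀ the derivative is (P - Q) e^z divided by
a product that equals (P + Q) e^z plus positive terms, so it is at most |P - Q|/(P + Q) < 1 in
modulus. -/
lemma act_contr : ∃ ρ, 0 ≤ ρ ∧ ρ < 1 ∧ ∀ x y, |act M x - act M y| ≤ ρ * |x - y| := by
  set P := M 0 0 * M 1 1 with hP
  set Q := M 0 1 * M 1 0 with hQ
  have hPpos : 0 < P := mul_pos (hM 0 0) (hM 1 1)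
  have hQpos : 0 < Q := mul_pos (hM 0 1) (hM 1 0)
  refine ⟨|P - Q| / (P + Q), by positivity, ?_, fun x y => ?_⟩
  · rw [div_lt_one (by positivity), abs_lt]
    constructor <;> linarith
  have hder : ∀ z ∈ Set.univ, HasDerivWithinAt (act M)
      (M 1 1 * Real.exp z / (M 1 0 + M 1 1 * Real.exp z) -
        M 0 1 * Real.exp z / (M 0 0 + M 0 1 * Real.exp z)) Set.univ z := by
    intro z _
    have h1 : HasDerivAt (fun z => M 1 0 + M 1 1 * Real.exp z) (M 1 1 * Real.exp z) z :=
      ((Real.hasDerivAt_exp z).const_mul _).const_add _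
    have h0 : HasDerivAt (fun z => M 0 0 + M 0 1 * Real.exp z) (M 0 1 * Real.exp z) z :=
      ((Real.hasDerivAt_exp z).const_mul _).const_add _
    have h := (h1.log (row_pos hM 1 z).ne').sub (h0.log (row_pos hM 0 z).ne')
    refine (h.congr_of_eventuallyEq (Eventually.of_forall fun z => ?_)).hasDerivWithinAt
    exact Real.log_div (row_pos hM 1 z).ne' (row_pos hM 0 z).ne'
  have hbound : ∀ z ∈ Set.univ, ‖M 1 1 * Real.exp z / (M 1 0 + M 1 1 * Real.exp z) -
      M 0 1 * Real.exp z / (M 0 0 + M 0 1 * Real.exp z)‖ ≤ |P - Q| / (P + Q) := by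
    intro z _
    have e := Real.exp_pos z
    have h1 := row_pos hM 1 z
    have h0 := row_pos hM 0 z
    have : M 1 1 * Real.exp z / (M 1 0 + M 1 1 * Real.exp z) -
        M 0 1 * Real.exp z / (M 0 0 + M 0 1 * Real.exp z) =
        (P - Q) * Real.exp z /
          ((M 1 0 + M 1 1 * Real.exp z) * (M 0 0 + M 0 1 * Real.exp z)) := by
      rw [div_sub_div _ _ h1.ne' h0.ne', hP, hQ]
      congr 1
      ring
    rw [this, Real.norm_eq_abs, abs_div, abs_mul, abs_of_pos e, abs_of_pos (mul_pos h1 h0),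
      div_le_div_iff₀ (mul_pos h1 h0) (by positivity), mul_assoc]
    refine mul_le_mul_of_nonneg_left ?_ (abs_nonneg _)
    have h2 : (M 1 0 + M 1 1 * Real.exp z) * (M 0 0 + M 0 1 * Real.exp z) =
        Real.exp z * (P + Q) + (M 1 0 * M 0 0 + M 1 1 * M 0 1 * Real.exp z ^ 2) := by
      rw [hP, hQ]; ring
    rw [h2]
    have := mul_pos (hM 1 0) (hM 0 0)
    have := mul_pos (mul_pos (hM 1 1) (hM 0 1)) (pow_pos e 2)
    linarith
  have := convex_univ.norm_image_sub_le_of_norm_hasDerivWithin_le hder hbound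
    (Set.mem_univ y) (Set.mem_univ x)
  simpa [Real.norm_eq_abs] using this

/-- A quotient (γ + δ e)/(α + β e) of positive terms is at most γ/α + δ/β, and the same holds for
its reciprocal. -/
lemma act_range : ∃ R, ∀ z, |act M z| ≤ R := by
  have a := hM 0 0
  have b := hM 0 1
  have c := hM 1 0
  have d := hM 1 1
  refine ⟨|Real.log (M 1 0 / M 0 0 + M 1 1 / M 0 1)| + |Real.log (M 0 0 / M 1 0 + M 0 1 / M 1 1)|,
    fun z => ?_⟩
  have e := Real.exp_pos z
  have h1 := row_pos hM 1 z
  have h0 := row_pos hM 0 z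
  have up : act M z ≤ Real.log (M 1 0 / M 0 0 + M 1 1 / M 0 1) := by
    refine Real.log_le_log (div_pos h1 h0) ?_
    rw [div_le_iff₀ h0]
    have : (M 1 0 / M 0 0 + M 1 1 / M 0 1) * (M 0 0 + M 0 1 * Real.exp z) =
        M 1 0 + M 1 1 * Real.exp z +
          (M 1 0 / M 0 0 * (M 0 1 * Real.exp z) + M 1 1 / M 0 1 * M 0 0) := by
      field_simp; ring
    rw [this]
    have : 0 < M 1 0 / M 0 0 * (M 0 1 * Real.exp z) + M 1 1 / M 0 1 * M 0 0 := by positivity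
    linarith
  have lo : -act M z ≤ Real.log (M 0 0 / M 1 0 + M 0 1 / M 1 1) := by
    rw [act, ← Real.log_inv, inv_div]
    refine Real.log_le_log (div_pos h0 h1) ?_
    rw [div_le_iff₀ h1]
    have : (M 0 0 / M 1 0 + M 0 1 / M 1 1) * (M 1 0 + M 1 1 * Real.exp z) =
        M 0 0 + M 0 1 * Real.exp z +
          (M 0 0 / M 1 0 * (M 1 1 * Real.exp z) + M 0 1 / M 1 1 * M 1 0) := by
      field_simp; ring
    rw [this]
    have : 0 < M 0 0 / M 1 0 * (M 1 1 * Real.exp z) + M 0 1 / M 1 1 * M 1 0 := by positivity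
    linarith
  have u1 := le_abs_self (Real.log (M 1 0 / M 0 0 + M 1 1 / M 0 1))
  have u2 := le_abs_self (Real.log (M 0 0 / M 1 0 + M 0 1 / M 1 1))
  have u3 := abs_nonneg (Real.log (M 1 0 / M 0 0 + M 1 1 / M 0 1))
  have u4 := abs_nonneg (Real.log (M 0 0 / M 1 0 + M 0 1 / M 1 1))
  rw [abs_le]
  constructor <;> linarith

lemma act_injective (hdet : M 0 0 * M 1 1 - M 0 1 * M 1 0 ≠ 0) : Function.Injective (act M) := by
  intro x y h
  have h1 := congrArg Real.exp h
  rw [exp_act hM, exp_act hM, div_eq_div_iff (row_pos hM 0 x).ne' (row_pos hM 0 y).ne'] at h1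
  have h2 : (M 0 0 * M 1 1 - M 0 1 * M 1 0) * (Real.exp x - Real.exp y) = 0 := by
    linear_combination h1
  have h3 := (mul_eq_zero.1 h2).resolve_left hdet
  exact Real.exp_injective (sub_eq_zero.1 h3)

lemma tr_line (z : ℝ) : tr M (1, Real.exp z) =
    (M 0 0 + M 1 0 * Real.exp z) • (1, Real.exp (act M.transpose z)) := by
  have hT : ∀ r c, 0 < M.transpose r c := fun r c => hM c r
  have h0 := row_pos hT 0 z
  simp only [Matrix.transpose_apply] at h0
  rw [exp_act hT]
  ext
  · simp [tr]
  · simp only [tr, Prod.smul_snd, smul_eq_mul, Matrix.transpose_apply]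
    rw [mul_div_assoc', eq_div_iff h0.ne']
    ring

end

lemma phi_line (A : Fin k → GL (Fin 2) ℝ) (hpos : ∀ i r c, 0 < (A i).val r c) (i : Fin k) (z : ℝ) :
    phi A i (line z) = line (act (A i).val.transpose z) := by
  rw [line, phi_perpLine A i (one_exp_ne_zero z), tr_line (hpos i), perpLine_smul, line]
  have := row_pos (M := (A i).val.transpose) (fun r c => hpos i c r) 0 z
  exact this.ne'

/-- On the open first quadrant φ_i is a partial inverse of the contraction `act (A i).val`. It
therefore expands, which drives orbits out of this quadrant. -/
lemma phi_posLine (A : Fin k → GL (Fin 2) ℝ) (hpos : ∀ i r c, 0 < (A i).val r c) (i : Fin k)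
    (y : ℝ) : phi A i (posLine (act (A i).val y)) = posLine y := by
  rw [posLine, phi_perpLine A i (exp_neg_one_ne_zero _), posLine, exp_act (hpos i)]
  have h0 := row_pos (hpos i) 0 y
  have hd := det_ne_zero (A i)
  rw [← perpLine_smul (div_ne_zero hd h0.ne') (Real.exp y, -1)]
  have hq := div_mul_cancel₀ ((A i).val 1 0 + (A i).val 1 1 * Real.exp y) h0.ne'
  congr 1
  ext
  · simp only [tr, Prod.smul_fst, smul_eq_mul]
    rw [div_mul_eq_mul_div, eq_div_iff h0.ne']
    linear_combination (A i).val 0 0 * hq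
  · simp only [tr, Prod.smul_snd, smul_eq_mul]
    rw [div_mul_eq_mul_div, eq_div_iff h0.ne']
    linear_combination (A i).val 0 1 * hq

lemma phi_injective (A : Fin k → GL (Fin 2) ℝ) (i : Fin k) : Function.Injective (phi A i) :=
  Projectivization.map_injective _ _

/-- The product of the coordinates of Aᵀ w is a quadratic form in w with positive coefficients, so
it is positive when w₁w₂ ≥ 0 and w ≠ 0. -/
lemma phi_secondQuadrant (A : Fin k → GL (Fin 2) ℝ) (hpos : ∀ i r c, 0 < (A i).val r c) (i : Fin k)
    {θ : RP1} (hθ : coordProd θ ≤ 0) : coordProd (phi A i θ) < 0 := by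
  obtain ⟨w, hw, rfl⟩ := exists_perpLine θ
  have h : 0 ≤ w.1 * w.2 := by
    by_contra! h
    exact absurd ((coordProd_pos_iff hw).2 h) (not_lt.2 hθ)
  rw [phi_perpLine A i hw, coordProd_neg_iff (tr_ne_zero _ hw)]
  have a := hpos i 0 0
  have b := hpos i 0 1
  have c := hpos i 1 0
  have d := hpos i 1 1
  have e : (tr (A i).val w).1 * (tr (A i).val w).2 =
      (A i).val 0 0 * (A i).val 0 1 * w.1 ^ 2 + (A i).val 1 0 * (A i).val 1 1 * w.2 ^ 2 +
      ((A i).val 0 0 * (A i).val 1 1 + (A i).val 1 0 * (A i).val 0 1) * (w.1 * w.2) := by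
    simp only [tr]; ring
  rw [e]
  have h3 : 0 ≤ ((A i).val 0 0 * (A i).val 1 1 + (A i).val 1 0 * (A i).val 0 1) * (w.1 * w.2) := by
    positivity
  have h1 := mul_pos a b
  have h2 := mul_pos c d
  by_cases hw1 : w.1 = 0
  · have hw2 : w.2 ≠ 0 := fun h => hw (Prod.ext hw1 h)
    have := mul_pos h2 (pow_pos (abs_pos.2 hw2) 2)
    rw [sq_abs] at this
    have := mul_nonneg h1.le (sq_nonneg w.1)
    linarith
  · have := mul_pos h1 (pow_pos (abs_pos.2 hw1) 2)
    rw [sq_abs] at this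
    have := mul_nonneg h2.le (sq_nonneg w.2)
    linarith

lemma exists_fixed_of_contr {χ : ℝ → ℝ} {ρ : ℝ} (h0 : 0 ≤ ρ) (h1 : ρ < 1)
    (h : ∀ x y, |χ x - χ y| ≤ ρ * |x - y|) : ∃ x, χ x = x := by
  have hc : ContractingWith ρ.toNNReal χ := by
    refine ⟨?_, LipschitzWith.of_dist_le_mul fun x y => ?_⟩
    · rw [← NNReal.coe_lt_coe, Real.coe_toNNReal _ h0]; exact h1
    · rw [Real.coe_toNNReal _ h0]; exact h x y
  exact ⟨_, hc.fixedPoint_isFixedPt⟩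

end Coordinates

/-! ### The contracting system, and entrance into the second quadrant. -/

section System

variable {k : ℕ}

lemma exists_uniform_contr {M : Fin k → Matrix (Fin 2) (Fin 2) ℝ} (hM : ∀ i r c, 0 < M i r c) :
    ∃ ρ R, 0 ≤ ρ ∧ ρ < 1 ∧ (∀ i x y, |act (M i) x - act (M i) y| ≤ ρ * |x - y|) ∧
      ∀ i x, |act (M i) x| ≤ R := by
  choose ρ h0 h1 h using fun i => act_contr (hM i)
  choose R hR using fun i => act_range (hM i)
  rcases isEmpty_or_nonempty (Fin k) with he | he
  · exact ⟨0, 0, le_rfl, one_pos, fun i => (he.false i).elim, fun i => (he.false i).elim⟩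
  · obtain ⟨i₀, hi₀⟩ := Finite.exists_max ρ
    obtain ⟨i₁, hi₁⟩ := Finite.exists_max R
    exact ⟨ρ i₀, R i₁, h0 _, h1 _, fun i x y =>
      (h i x y).trans (mul_le_mul_of_nonneg_right (hi₀ i) (abs_nonneg _)),
      fun i x => (hR i x).trans (hi₁ i)⟩

lemma nrm_mono {v w : ℝ × ℝ} (h1 : 0 ≤ v.1) (h2 : 0 ≤ v.2) (h3 : v.1 ≤ w.1) (h4 : v.2 ≤ w.2) :
    nrm v ≤ nrm w :=
  Real.sqrt_le_sqrt (add_le_add (pow_le_pow_left₀ h1 h3 2) (pow_le_pow_left₀ h2 h4 2))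

/-- When x increases to y, each coordinate grows by a factor between 1 and e^{y-x}, because the
coefficients are nonnegative. -/
lemma log_nrm_lip {a b c d : ℝ} (ha : 0 < a) (hb : 0 ≤ b) (hc : 0 ≤ c) (hd : 0 ≤ d) (x y : ℝ) :
    |Real.log (nrm (a + b * Real.exp x, c + d * Real.exp x)) -
      Real.log (nrm (a + b * Real.exp y, c + d * Real.exp y))| ≤ |x - y| := by
  wlog hxy : x ≤ y generalizing x y
  · rw [abs_sub_comm, abs_sub_comm x y]
    exact this y x (le_of_not_ge hxy)
  have hex := Real.exp_pos x
  have he := Real.exp_le_exp.2 hxy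
  have pos : ∀ z, 0 < nrm (a + b * Real.exp z, c + d * Real.exp z) := fun z => by
    refine nrm_pos fun h => ?_
    have h1 : a + b * Real.exp z = 0 := congrArg Prod.fst h
    have := Real.exp_pos z
    have : 0 ≤ b * Real.exp z := by positivity
    linarith
  have h1 : nrm (a + b * Real.exp x, c + d * Real.exp x) ≤
      nrm (a + b * Real.exp y, c + d * Real.exp y) :=
    nrm_mono (by positivity) (by positivity) (by dsimp only; gcongr) (by dsimp only; gcongr)
  have hone : 1 ≤ Real.exp (y - x) := Real.one_le_exp (by linarith)
  have hmul : Real.exp (y - x) * Real.exp x = Real.exp y := by rw [← Real.exp_add]; congr 1; ring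
  have h2 : nrm (a + b * Real.exp y, c + d * Real.exp y) ≤
      Real.exp (y - x) * nrm (a + b * Real.exp x, c + d * Real.exp x) := by
    have hsm := nrm_smul (Real.exp (y - x)) (a + b * Real.exp x, c + d * Real.exp x)
    rw [abs_of_pos (Real.exp_pos (y - x))] at hsm
    rw [← hsm]
    refine nrm_mono (by positivity) (by positivity) ?_ ?_
    · simp only [Prod.smul_fst, smul_eq_mul, mul_add]
      have : Real.exp (y - x) * (b * Real.exp x) = b * Real.exp y := by rw [← hmul]; ring
      rw [this]
      nlinarith
    · simp only [Prod.smul_snd, smul_eq_mul, mul_add]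
      have : Real.exp (y - x) * (d * Real.exp x) = d * Real.exp y := by rw [← hmul]; ring
      rw [this]
      nlinarith
  have l1 := Real.log_le_log (pos x) h1
  have l2 := Real.log_le_log (pos y) h2
  rw [Real.log_mul (Real.exp_pos _).ne' (pos x).ne', Real.log_exp] at l2
  rw [abs_sub_comm, abs_sub_comm x y, abs_of_nonneg (by linarith), abs_of_nonneg (by linarith)]
  linarith

/-- The maps induced on the coordinate of the open second quadrant. -/
def psi (A : Fin k → GL (Fin 2) ℝ) (i : Fin k) : ℝ → ℝ := act (A i).val.transpose

/-- The increments of the length function on the open second quadrant. -/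
def lineWeight (b : ℝ) (A : Fin k → GL (Fin 2) ℝ) (i : Fin k) (z : ℝ) : ℝ :=
  weight b A i (1, Real.exp z)

lemma exists_isContractingSystem {b : ℝ} (hb : 1 < b) (A : Fin k → GL (Fin 2) ℝ)
    (hpos : ∀ i r c, 0 < (A i).val r c)
    (hnorm : ∀ i, ‖Matrix.toEuclideanCLM (𝕜 := ℝ) (A i).val‖ < 1) :
    ∃ ρ R M c C, IsContractingSystem (psi A) (lineWeight b A) ρ R M c C := by
  obtain ⟨ρ, R, h0, h1, h2, h3⟩ :=
    exists_uniform_contr (M := fun i => (A i).val.transpose) fun i r c => hpos i c r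
  obtain ⟨c, C, hc, hw⟩ := exists_weight_bounds hb A hnorm
  -- A weight is a difference of two logarithms of norms, each 1-Lipschitz, divided by log b.
  refine ⟨ρ, R, 2 / Real.log b, c, C, h0, h1, h2, h3, fun i x y => ?_, hc,
    fun i z => (hw i _ (one_exp_ne_zero z)).1, fun i z => (hw i _ (one_exp_ne_zero z)).2⟩
  have hlog := Real.log_pos hb
  have e1 := log_nrm_lip one_pos le_rfl le_rfl zero_le_one x y
  have e2 := log_nrm_lip (hpos i 0 0) (hpos i 1 0).le (hpos i 0 1).le (hpos i 1 1).le x y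
  simp only [zero_mul, add_zero, one_mul, zero_add] at e1
  have : lineWeight b A i x - lineWeight b A i y =
      ((Real.log (nrm (1, Real.exp x)) - Real.log (nrm (1, Real.exp y))) -
      (Real.log (nrm ((A i).val 0 0 + (A i).val 1 0 * Real.exp x,
        (A i).val 0 1 + (A i).val 1 1 * Real.exp x)) -
      Real.log (nrm ((A i).val 0 0 + (A i).val 1 0 * Real.exp y,
        (A i).val 0 1 + (A i).val 1 1 * Real.exp y)))) / Real.log b := by
    simp only [lineWeight, weight, Real.logb, tr, mul_one]
    ring
  rw [this, abs_div, abs_of_pos hlog, div_mul_eq_mul_div]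
  gcongr
  refine (abs_sub _ _).trans ?_
  linarith

/-- A subinvariant function of a system of contractions with two different fixed points vanishes. -/
lemma subinvariant_eq_zero {χ : Fin k → ℝ → ℝ} {ρ R : ℝ} (hρ0 : 0 ≤ ρ) (hρ1 : ρ < 1)
    (hcontr : ∀ i x y, |χ i x - χ i y| ≤ ρ * |x - y|) (hR : ∀ i x, |χ i x| ≤ R)
    {i j : Fin k} {xi xj : ℝ} (hi : χ i xi = xi) (hj : χ j xj = xj) (hne : xi ≠ xj)
    (p : PMF (Fin k)) (hp : ∀ i, p i ≠ 0) {q : ℝ → ℝ} (hq0 : ∀ z, 0 ≤ q z) (hq1 : ∀ z, q z ≤ 1)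
    (hq : ∀ z, ∃ e : Fin k → ℝ, q z ≤ ∑ i, (p i).toReal * e i ∧
      ∀ i, e i ≤ 0 ∨ ∃ y, χ i y = z ∧ e i ≤ q y) (z : ℝ) : q z = 0 := by
  set Q := sSup (Set.range q) with hQ
  have hbdd : BddAbove (Set.range q) := ⟨1, by rintro _ ⟨z, rfl⟩; exact hq1 z⟩
  have hqQ : ∀ z, q z ≤ Q := fun z => le_csSup hbdd ⟨z, rfl⟩
  have hQ0 : 0 ≤ Q := (hq0 0).trans (hqQ 0)
  have hp0 : ∀ i, 0 < (p i).toReal := fun i => ENNReal.toReal_pos (hp i) (p.apply_ne_top i)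
  have hp1 : ∀ i, (p i).toReal ≤ 1 := fun i =>
    (Finset.single_le_sum (f := fun i => (p i).toReal) (fun i _ => (hp0 i).le)
      (Finset.mem_univ i)).trans (sum_toReal_pmf p).le
  -- If z has no m-fold preimage under χ i, the branch that uses m times the letter i contributes
  -- nothing, and it carries the weight p_i^m.
  have hpow : ∀ i m z, (∀ y, (χ i)^[m] y ≠ z) → q z ≤ (1 - (p i).toReal ^ m) * Q := by
    intro i m
    induction m with
    | zero => intro z h; exact absurd rfl (h z)
    | succ m ih =>
      intro z h
      obtain ⟨e, he, hei⟩ := hq z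
      have heQ : ∀ j, e j ≤ Q := fun j => by
        rcases hei j with h1 | ⟨y, -, h1⟩
        · linarith
        · exact h1.trans (hqQ y)
      have hpm : 0 ≤ 1 - (p i).toReal ^ m := by
        have := pow_le_one₀ (n := m) (hp0 i).le (hp1 i)
        linarith
      have hii : e i ≤ (1 - (p i).toReal ^ m) * Q := by
        rcases hei i with h1 | ⟨y, hy, h1⟩
        · exact h1.trans (mul_nonneg hpm hQ0)
        · refine h1.trans (ih y fun y' hy' => h y' ?_)
          rw [Function.iterate_succ_apply', hy', hy]
      have hsum : ∑ j, (p j).toReal * (Q - e j) = Q - ∑ j, (p j).toReal * e j := by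
        simp only [mul_sub, Finset.sum_sub_distrib, ← Finset.sum_mul, sum_toReal_pmf, one_mul]
      have hsing := Finset.single_le_sum (f := fun j => (p j).toReal * (Q - e j))
        (fun j _ => mul_nonneg (hp0 j).le (sub_nonneg.2 (heQ j))) (Finset.mem_univ i)
      rw [hsum] at hsing
      have h5 : (p i).toReal * (Q - e i) ≥ (p i).toReal * ((p i).toReal ^ m * Q) :=
        mul_le_mul_of_nonneg_left (by linarith) (hp0 i).le
      rw [pow_succ]
      linarith
  have hball : ∀ i x, χ i x = x → ∀ m y, |(χ i)^[m + 1] y - x| ≤ ρ ^ m * (2 * R) := by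
    intro i x hx m
    induction m with
    | zero =>
      intro y
      have h1 := abs_le.1 (hR i y)
      have h2 := abs_le.1 (hR i x)
      rw [hx] at h2
      simp only [zero_add, Function.iterate_one, pow_zero, one_mul]
      rw [abs_le]
      constructor <;> linarith
    | succ m ih =>
      intro y
      rw [Function.iterate_succ_apply']
      have h1 := hcontr i ((χ i)^[m + 1] y) x
      rw [hx] at h1
      refine h1.trans ?_
      rw [pow_succ', mul_assoc]
      exact mul_le_mul_of_nonneg_left (ih y) hρ0
  -- For large m the images of the iterates of χ i and χ j lie in disjoint balls around the two
  -- fixed points. So every z misses one of them, and the supremum Q satisfies Q ≤ (1 - δ) Q.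
  obtain ⟨m, hm⟩ : ∃ m : ℕ, ρ ^ m * (2 * R) < |xi - xj| / 2 := by
    have h1 := (tendsto_pow_atTop_nhds_zero_of_lt_one hρ0 hρ1).mul_const (2 * R)
    rw [zero_mul] at h1
    exact (h1.eventually_lt_const (half_pos (abs_pos.2 (sub_ne_zero.2 hne)))).exists
  set δ := min ((p i).toReal ^ (m + 1)) ((p j).toReal ^ (m + 1)) with hδ
  have hδ0 : 0 < δ := lt_min (pow_pos (hp0 i) _) (pow_pos (hp0 j) _)
  have hall : ∀ z, q z ≤ (1 - δ) * Q := by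
    intro z
    by_cases h : ∀ y, (χ i)^[m + 1] y ≠ z
    · refine (hpow i _ z h).trans (mul_le_mul_of_nonneg_right ?_ hQ0)
      linarith [min_le_left ((p i).toReal ^ (m + 1)) ((p j).toReal ^ (m + 1))]
    · push Not at h
      obtain ⟨y, rfl⟩ := h
      refine (hpow j (m + 1) _ fun y' hy' => ?_).trans (mul_le_mul_of_nonneg_right ?_ hQ0)
      · have h1 := hball i xi hi m y
        have h2 := hball j xj hj m y'
        rw [hy'] at h2
        have h3 := abs_sub_le xi ((χ i)^[m + 1] y) xj
        rw [abs_sub_comm xi ((χ i)^[m + 1] y)] at h3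
        linarith
      · linarith [min_le_right ((p i).toReal ^ (m + 1)) ((p j).toReal ^ (m + 1))]
  have hQle : Q ≤ (1 - δ) * Q := csSup_le (Set.range_nonempty q) (by rintro _ ⟨z, rfl⟩; exact hall z)
  have : Q ≤ 0 := by nlinarith
  exact le_antisymm ((hqQ z).trans this) (hq0 z)

/-- The eigenvalue of a positive matrix at a fixed point of its action, and its domination of the
other eigenvalues. -/
lemma isMaxEigendirection_posLine {M : Matrix (Fin 2) (Fin 2) ℝ} (hM : ∀ r c, 0 < M r c) {y : ℝ}
    (hy : act M y = y) :
    IsMaxEigendirection M (posLine y) (M 0 0 + M 0 1 * Real.exp y) := by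
  have h0 := row_pos hM 0 y
  have e := Real.exp_pos y
  have heig : M 1 0 + M 1 1 * Real.exp y = (M 0 0 + M 0 1 * Real.exp y) * Real.exp y := by
    have := exp_act hM y
    rw [hy, eq_div_iff h0.ne'] at this
    linarith
  constructor
  · intro v hv
    rw [posLine, perpLine_eq (exp_neg_one_ne_zero y), Projectivization.submodule_mk,
      Submodule.mem_span_singleton] at hv
    obtain ⟨c, rfl⟩ := hv
    refine plane_ext ?_ ?_
    · rw [lin_zero]
      simp only [PiLp.smul_apply, smul_eq_mul, Matrix.cons_val_zero, Matrix.cons_val_one,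
        Matrix.cons_val_fin_one]
      ring
    · rw [lin_one]
      simp only [PiLp.smul_apply, smul_eq_mul, Matrix.cons_val_zero, Matrix.cons_val_one,
        Matrix.cons_val_fin_one]
      linear_combination c * heig
  · intro m hm
    obtain ⟨v, hv⟩ := hm.exists_hasEigenvector
    have hv0 := congrArg (fun v : Plane => v 0) hv.apply_eq_smul
    have hv1 := congrArg (fun v : Plane => v 1) hv.apply_eq_smul
    simp only [lin_zero, lin_one, PiLp.smul_apply, smul_eq_mul] at hv0 hv1
    have b0 : |m| * |v 0| ≤ M 0 0 * |v 0| + M 0 1 * |v 1| := by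
      rw [← abs_mul, ← hv0]
      refine (abs_add_le _ _).trans (le_of_eq ?_)
      rw [abs_mul, abs_mul, abs_of_pos (hM 0 0), abs_of_pos (hM 0 1)]
    have b1 : |m| * |v 1| ≤ M 1 0 * |v 0| + M 1 1 * |v 1| := by
      rw [← abs_mul, ← hv1]
      refine (abs_add_le _ _).trans (le_of_eq ?_)
      rw [abs_mul, abs_mul, abs_of_pos (hM 1 0), abs_of_pos (hM 1 1)]
    rw [abs_of_pos h0]
    -- Perron's comparison with the positive eigenvector (1, e^y): one uses the row of the
    -- coordinate in which |v| is largest relative to this vector.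
    by_cases hcase : |v 1| ≤ |v 0| * Real.exp y
    · have hpos : 0 < |v 0| := by
        rcases (abs_nonneg (v 0)).eq_or_lt with h | h
        · rw [← h, zero_mul] at hcase
          refine absurd (plane_ext ?_ ?_ : v = 0) hv.2
          · exact abs_eq_zero.1 h.symm
          · exact abs_eq_zero.1 (le_antisymm hcase (abs_nonneg _))
        · exact h
      refine le_of_mul_le_mul_right ?_ hpos
      have := mul_le_mul_of_nonneg_left hcase (hM 0 1).le
      linarith
    · push Not at hcase
      have hpos : 0 < |v 1| := lt_of_le_of_lt (by positivity) hcase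
      refine le_of_mul_le_mul_right ?_ hpos
      have h2 := mul_le_mul_of_nonneg_left hcase.le (hM 1 0).le
      refine le_of_mul_le_mul_right ?_ e
      have h3 : (M 0 0 + M 0 1 * Real.exp y) * |v 1| * Real.exp y =
          (M 1 0 + M 1 1 * Real.exp y) * |v 1| := by rw [heig]; ring
      rw [h3]
      nlinarith

lemma exists_act_ne_of_mem_goodDirections (A : Fin k → GL (Fin 2) ℝ)
    (hpos : ∀ i r c, 0 < (A i).val r c) {y : ℝ} (h : posLine y ∈ goodDirections A) :
    ∃ i, act (A i).val y ≠ y := by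
  by_contra! hcon
  exact h fun i => ⟨_, isMaxEigendirection_posLine (hpos i) (hcon i)⟩

lemma orbit_eq_walk (A : Fin k → GL (Fin 2) ℝ) (a : ℕ → Fin k) (θ : RP1) (n : ℕ) :
    orbit A a θ n = walk (phi A) θ a n := by
  induction n with
  | zero => rfl
  | succ n ih => rw [orbit, ih]; rfl

/-- Almost every orbit of a good direction enters the open second quadrant. -/
theorem ae_exists_line (A : Fin k → GL (Fin 2) ℝ) (hpos : ∀ i r c, 0 < (A i).val r c)
    (p : PMF (Fin k)) (hp : ∀ i, p i ≠ 0) {θ : RP1} (hθ : θ ∈ goodDirections A) :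
    ∀ᵐ a ∂bernoulli p, ∃ n z, orbit A a θ n = line z := by
  have hreduce : ∀ a : ℕ → Fin k, (∃ n, ¬ 0 < coordProd (orbit A a θ n)) →
      ∃ n z, orbit A a θ n = line z := by
    rintro a ⟨n, hn⟩
    exact ⟨n + 1, exists_line (phi_secondQuadrant A hpos (a n) (not_lt.1 hn))⟩
  suffices h : ∀ᵐ a ∂bernoulli p, ∃ n, ¬ 0 < coordProd (orbit A a θ n) by
    filter_upwards [h] with a ha using hreduce a ha
  by_cases hθ0 : 0 < coordProd θ
  swap
  · exact Eventually.of_forall fun a => ⟨0, hθ0⟩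
  obtain ⟨y, rfl⟩ := exists_posLine hθ0
  obtain ⟨i₀, hi₀⟩ := exists_act_ne_of_mem_goodDirections A hpos hθ
  obtain ⟨ρ, R, hρ0, hρ1, hcontr, hR⟩ := exists_uniform_contr (M := fun i => (A i).val) hpos
  have hback : ∀ i y, 0 < coordProd (phi A i (posLine y)) →
      ∃ y', phi A i (posLine y) = posLine y' ∧ act (A i).val y' = y := by
    intro i y h
    obtain ⟨y', hy'⟩ := exists_posLine h
    refine ⟨y', hy', posLine_injective (phi_injective A i ?_)⟩
    rw [hy', phi_posLine A hpos]
  choose x hx using fun i => exists_fixed_of_contr hρ0 hρ1 (hcontr i)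
  -- If all contractions share their fixed point, a good direction differs from it. An orbit staying
  -- in the first quadrant would then move away from it geometrically, while its coordinates stay
  -- bounded by R, so no sequence is exceptional.
  by_cases hsame : ∀ i j, x i = x j
  · refine Eventually.of_forall fun a => ?_
    by_contra! hcon
    have hyne : y ≠ x i₀ := fun h => hi₀ (by rw [h]; exact hx i₀)
    have hy' : ∀ n, ∃ u, orbit A a (posLine y) n = posLine u ∧ |y - x i₀| ≤ ρ ^ n * |u - x i₀| := by
      intro n
      induction n with
      | zero => exact ⟨y, rfl, by simp⟩
      | succ n ih =>
        obtain ⟨u, hu, hle⟩ := ih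
        have h1 := hcon (n + 1)
        rw [orbit, hu] at h1
        obtain ⟨u', hu', hact⟩ := hback _ _ h1
        refine ⟨u', by rw [orbit, hu, hu'], hle.trans ?_⟩
        rw [pow_succ, mul_assoc]
        refine mul_le_mul_of_nonneg_left ?_ (pow_nonneg hρ0 n)
        have h2 := hcontr (a n) u' (x (a n))
        rwa [hact, hx, hsame (a n) i₀] at h2
    have hbound : ∀ n, |y - x i₀| ≤ ρ ^ n * (2 * R) := by
      intro n
      obtain ⟨u, hu, hle⟩ := hy' n
      refine hle.trans (mul_le_mul_of_nonneg_left ?_ (pow_nonneg hρ0 n))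
      have h1 := hcon (n + 1)
      rw [orbit, hu] at h1
      obtain ⟨u', -, hact⟩ := hback _ _ h1
      have h2 := abs_le.1 (hR (a n) u')
      have h3 := abs_le.1 (hR i₀ (x i₀))
      rw [hact] at h2
      rw [hx] at h3
      rw [abs_le]
      constructor <;> linarith
    have hlim := (tendsto_pow_atTop_nhds_zero_of_lt_one hρ0 hρ1).mul_const (2 * R)
    rw [zero_mul] at hlim
    have := ge_of_tendsto' hlim hbound
    exact hyne (sub_eq_zero.1 (abs_eq_zero.1 (le_antisymm this (abs_nonneg _))))
  · push Not at hsame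
    obtain ⟨i, j, hij⟩ := hsame
    -- With two different fixed points, the probability of staying forever in the first quadrant is
    -- subinvariant, hence zero.
    set E : RP1 → Set (ℕ → Fin k) := fun θ => {a | ∀ n, 0 < coordProd (orbit A a θ n)} with hE
    have hEm : ∀ θ, MeasurableSet (E θ) := by
      intro θ
      have : E θ = ⋂ n, {a | 0 < coordProd (orbit A a θ n)} := by
        ext a; simp [hE]
      rw [this]
      refine MeasurableSet.iInter fun n => ?_
      simp only [orbit_eq_walk]
      exact measurableSet_lt measurable_const (measurable_walk' (phi A) θ n coordProd)
    have hcons : ∀ θ i, 0 < coordProd θ → consSeq i ⁻¹' E θ = E (phi A i θ) := by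
      intro θ i h
      ext a
      simp only [hE, Set.mem_preimage, Set.mem_ofPred_eq, orbit_eq_walk]
      constructor
      · intro h1 n
        have := h1 (n + 1)
        rwa [walk_cons] at this
      · intro h1 n
        cases n with
        | zero => exact h
        | succ n => rw [walk_cons]; exact h1 n
    have hzero := subinvariant_eq_zero hρ0 hρ1 hcontr hR (hx i) (hx j) hij p hp
      (q := fun y => (bernoulli p).real (E (posLine y))) (fun z => measureReal_nonneg)
      (fun z => measureReal_le_one) (fun z => ?_) y
    · have h0 : bernoulli p (E (posLine y)) = 0 := by
        rwa [measureReal_eq_zero_iff] at hzero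
      rw [ae_iff]
      simpa [hE] using h0
    · have hzpos : 0 < coordProd (posLine z) :=
        (coordProd_pos_iff (exp_neg_one_ne_zero z)).2 (by simpa using Real.exp_pos z)
      refine ⟨fun i => (bernoulli p).real (E (phi A i (posLine z))), ?_, fun i => ?_⟩
      · simp only [measureReal_def]
        rw [bernoulli_apply p (hEm _), ENNReal.toReal_sum
          fun i _ => ENNReal.mul_ne_top (p.apply_ne_top i) (measure_ne_top _ _)]
        refine le_of_eq (Finset.sum_congr rfl fun i _ => ?_)
        rw [ENNReal.toReal_mul, hcons _ _ hzpos]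
      · by_cases h : 0 < coordProd (phi A i (posLine z))
        · obtain ⟨y', h1, h2⟩ := hback i z h
          exact Or.inr ⟨y', h2, by dsimp only; rw [h1]⟩
        · refine Or.inl (le_of_eq ?_)
          have : E (phi A i (posLine z)) = ∅ := by
            ext a
            simp only [hE, Set.mem_ofPred_eq, Set.mem_empty_iff_false, iff_false]
            intro h1
            exact h (h1 0)
          simp [this]

end System

/-! ### Absence of fixed functions of the twisted operators. -/

section NonLattice

variable {k : ℕ}

/-- Strict convexity of the disk: the weighted sum of ‖u_j - s‖² is at most 2H² - 2⟨s, s⟩ = 0. -/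
lemma eq_of_norm_sum_eq (p : PMF (Fin k)) (hp : ∀ i, p i ≠ 0) {u : Fin k → ℂ} {s : ℂ} {H : ℝ}
    (hu : ∀ i, ‖u i‖ ≤ H) (hs : ∑ i, ((p i).toReal : ℂ) * u i = s) (hH : ‖s‖ = H) (i : Fin k) :
    u i = s := by
  have hp0 : ∀ i, 0 < (p i).toReal := fun i => ENNReal.toReal_pos (hp i) (p.apply_ne_top i)
  have hin : ∑ j, (p j).toReal * inner ℝ (u j) s = H ^ 2 := by
    have h1 : inner ℝ (∑ j, (p j).toReal • u j) s = H ^ 2 := by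
      have : ∑ j, (p j).toReal • u j = s := by
        rw [← hs]
        exact Finset.sum_congr rfl fun j _ => Complex.real_smul
      rw [this, real_inner_self_eq_norm_sq, hH]
    rw [← h1, sum_inner]
    exact Finset.sum_congr rfl fun j _ => (real_inner_smul_left _ _ _).symm
  have hsum : ∑ j, (p j).toReal * ‖u j - s‖ ^ 2 ≤ 0 := by
    have h2 : ∀ j, (p j).toReal * ‖u j - s‖ ^ 2 ≤
        (p j).toReal * (2 * H ^ 2) - 2 * ((p j).toReal * inner ℝ (u j) s) := by
      intro j
      rw [norm_sub_sq_real, hH]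
      have := mul_le_mul_of_nonneg_left (pow_le_pow_left₀ (norm_nonneg _) (hu j) 2) (hp0 j).le
      linarith
    refine (Finset.sum_le_sum fun j _ => h2 j).trans (le_of_eq ?_)
    rw [Finset.sum_sub_distrib, ← Finset.sum_mul, sum_toReal_pmf, ← Finset.mul_sum, hin]
    ring
  have hnn : ∀ j ∈ Finset.univ, 0 ≤ (p j).toReal * ‖u j - s‖ ^ 2 := fun j _ =>
    mul_nonneg (hp0 j).le (sq_nonneg _)
  have hz := (Finset.sum_eq_zero_iff_of_nonneg hnn).1
    (le_antisymm hsum (Finset.sum_nonneg hnn)) i (Finset.mem_univ i)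
  have h3 := (mul_eq_zero.1 hz).resolve_left (hp0 i).ne'
  exact sub_eq_zero.1 (norm_eq_zero.1 (pow_eq_zero_iff two_ne_zero |>.1 h3))

lemma tendsto_iterate_of_contr {χ : ℝ → ℝ} {ρ : ℝ} (h0 : 0 ≤ ρ) (h1 : ρ < 1)
    (h : ∀ x y, |χ x - χ y| ≤ ρ * |x - y|) {x : ℝ} (hx : χ x = x) (y : ℝ) :
    Tendsto (fun n => χ^[n] y) atTop (𝓝 x) := by
  have hb : ∀ n, |χ^[n] y - x| ≤ ρ ^ n * |y - x| := by
    intro n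
    induction n with
    | zero => simp
    | succ n ih =>
      rw [Function.iterate_succ_apply', pow_succ', mul_assoc]
      have := h (χ^[n] y) x
      rw [hx] at this
      exact this.trans (mul_le_mul_of_nonneg_left ih h0)
  have hlim := (tendsto_pow_atTop_nhds_zero_of_lt_one h0 h1).mul_const |y - x|
  rw [zero_mul] at hlim
  refine tendsto_iff_norm_sub_tendsto_zero.2 (squeeze_zero (fun _ => norm_nonneg _) hb hlim)

lemma fixed_unique_of_contr {χ : ℝ → ℝ} {ρ : ℝ} (h1 : ρ < 1)
    (h : ∀ x y, |χ x - χ y| ≤ ρ * |x - y|) {x y : ℝ} (hx : χ x = x) (hy : χ y = y) : x = y := by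
  have := h x y
  rw [hx, hy] at this
  have h2 := abs_nonneg (x - y)
  exact sub_eq_zero.1 (abs_eq_zero.1 (by nlinarith))

/-- A continuous function fixed by a twisted operator has constant modulus on a closed invariant set
containing all fixed points, and satisfies the cohomological equation there. -/
lemma exists_invariant_set {ψ f : Fin k → ℝ → ℝ} {ρ R M c C : ℝ}
    (hS : IsContractingSystem ψ f ρ R M c C) (p : PMF (Fin k)) (hp : ∀ i, p i ≠ 0) {t : ℝ}
    {h : ℝ → ℂ} (hc : ContinuousOn h (Set.Icc (-R) R))
    (hfix : ∀ z ∈ Set.Icc (-R) R, twist p ψ f t h z = h z)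
    (hne : ∃ z ∈ Set.Icc (-R) R, h z ≠ 0) :
    ∃ E ⊆ Set.Icc (-R) R, (∀ z ∈ E, h z ≠ 0) ∧ (∀ z ∈ E, ∀ i, ψ i z ∈ E) ∧
      (∀ z ∈ E, ∀ i, Complex.exp ((t * f i z : ℝ) * Complex.I) * h (ψ i z) = h z) ∧
      ∀ i x, ψ i x = x → x ∈ E := by
  obtain ⟨z₀, hz₀, hz₀ne⟩ := hne
  obtain ⟨zm, hzm, hmax⟩ := isCompact_Icc.exists_isMaxOn ⟨z₀, hz₀⟩ hc.norm
  have hle : ∀ z ∈ Set.Icc (-R) R, ‖h z‖ ≤ ‖h zm‖ := fun z hz => hmax hz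
  have hpos : 0 < ‖h zm‖ := (norm_pos_iff.2 hz₀ne).trans_le (hle z₀ hz₀)
  have hmem : ∀ i z, ψ i z ∈ Set.Icc (-R) R := fun i z => abs_le.1 (hS.range i z)
  -- On the set where |h| is maximal, the average of the unimodular multiples of h(ψ_i z) has
  -- maximal modulus, so all of them agree. Iterating ψ i from a maximum leads to its fixed point,
  -- which lies in this closed set.
  set E := {z ∈ Set.Icc (-R) R | ‖h z‖ = ‖h zm‖} with hE
  have heq : ∀ z ∈ E, ∀ i, Complex.exp ((t * f i z : ℝ) * Complex.I) * h (ψ i z) = h z := by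
    intro z hz i
    refine eq_of_norm_sum_eq p hp (u := fun i =>
      Complex.exp ((t * f i z : ℝ) * Complex.I) * h (ψ i z)) (fun i => ?_) (hfix z hz.1) hz.2 i
    rw [norm_mul, Complex.norm_exp_ofReal_mul_I, one_mul]
    exact hle _ (hmem i z)
  have hinv : ∀ z ∈ E, ∀ i, ψ i z ∈ E := by
    intro z hz i
    refine ⟨hmem i z, ?_⟩
    have := congrArg norm (heq z hz i)
    rw [norm_mul, Complex.norm_exp_ofReal_mul_I, one_mul] at this
    rw [this, hz.2]
  have hclosed : IsClosed E :=
    hc.norm.preimage_isClosed_of_isClosed isClosed_Icc isClosed_singleton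
  refine ⟨E, fun z hz => hz.1, fun z hz h0 => ?_, hinv, heq, fun i x hx => ?_⟩
  · have := hz.2
    rw [h0, norm_zero] at this
    linarith
  · have hit : ∀ n, (ψ i)^[n] zm ∈ E := by
      intro n
      induction n with
      | zero => exact ⟨hzm, rfl⟩
      | succ n ih => rw [Function.iterate_succ_apply']; exact hinv _ ih i
    exact hclosed.mem_of_tendsto
      (tendsto_iterate_of_contr hS.rho_nonneg hS.rho_lt_one (hS.contr i) hx zm)
      (Eventually.of_forall hit)

/-- The pairing of `(1, exp ξ)` with `(1, exp z)`. -/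
def pairing (ξ z : ℝ) : ℝ := 1 + Real.exp ξ * Real.exp z

lemma pairing_pos (ξ z : ℝ) : 0 < pairing ξ z := by unfold pairing; positivity

/-- This is ⟨v, Mᵀ w⟩ = ⟨M v, w⟩ for v = (1, e^ξ) and w = (1, e^z), with both images scaled to first
coordinate 1. -/
lemma pairing_adjoint {M : Matrix (Fin 2) (Fin 2) ℝ} (hM : ∀ r c, 0 < M r c) (ξ z : ℝ) :
    pairing ξ (act M.transpose z) * (M 0 0 + M 1 0 * Real.exp z) =
      (M 0 0 + M 0 1 * Real.exp ξ) * pairing (act M ξ) z := by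
  have hT : ∀ r c, 0 < M.transpose r c := fun r c => hM c r
  have h1 := (row_pos hT 0 z).ne'
  have h2 := (row_pos hM 0 ξ).ne'
  have e1 := div_mul_cancel₀ (M.transpose 1 0 + M.transpose 1 1 * Real.exp z) h1
  have e2 := div_mul_cancel₀ (M 1 0 + M 1 1 * Real.exp ξ) h2
  rw [← exp_act hT] at e1
  rw [← exp_act hM] at e2
  simp only [Matrix.transpose_apply] at e1
  unfold pairing
  linear_combination Real.exp ξ * e1 - Real.exp z * e2

lemma log_pairing_adjoint {M : Matrix (Fin 2) (Fin 2) ℝ} (hM : ∀ r c, 0 < M r c) (ξ z : ℝ) :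
    Real.log (pairing ξ (act M.transpose z)) + Real.log (M 0 0 + M 1 0 * Real.exp z) =
      Real.log (M 0 0 + M 0 1 * Real.exp ξ) + Real.log (pairing (act M ξ) z) := by
  have hT : ∀ r c, 0 < M.transpose r c := fun r c => hM c r
  have h1 : 0 < M 0 0 + M 1 0 * Real.exp z := row_pos hT 0 z
  rw [← Real.log_mul (pairing_pos _ _).ne' h1.ne', pairing_adjoint hM,
    Real.log_mul (row_pos hM 0 ξ).ne' (pairing_pos _ _).ne']

/-- The norms form a coboundary; only the scaling factor of Aᵀ (1, e^z) matters for the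
cohomological equation. -/
lemma lineWeight_eq (b : ℝ) (A : Fin k → GL (Fin 2) ℝ) (hpos : ∀ i r c, 0 < (A i).val r c)
    (i : Fin k) (z : ℝ) : lineWeight b A i z = (Real.log (nrm (1, Real.exp z)) -
      Real.log (nrm (1, Real.exp (psi A i z))) -
      Real.log ((A i).val 0 0 + (A i).val 1 0 * Real.exp z)) / Real.log b := by
  have hT : ∀ r c, 0 < (A i).val.transpose r c := fun r c => hpos i c r
  have h1 : 0 < (A i).val 0 0 + (A i).val 1 0 * Real.exp z := row_pos hT 0 z
  rw [lineWeight, weight, tr_line (hpos i), nrm_smul, abs_of_pos h1, Real.logb, Real.logb,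
    Real.log_mul h1.ne' (nrm_pos (one_exp_ne_zero _)).ne', psi]
  ring

/-- After exponentiation and cross-multiplication the equation reads (e^ξ - e^ξ')(e^z - e^z') = 0.
-/
lemma log_pairing_injective {z z' : ℝ} (hz : z ≠ z') {ξ ξ' : ℝ}
    (h : Real.log (pairing ξ z) - Real.log (pairing ξ z') =
      Real.log (pairing ξ' z) - Real.log (pairing ξ' z')) : ξ = ξ' := by
  have h1 : Real.log (pairing ξ z * pairing ξ' z') = Real.log (pairing ξ' z * pairing ξ z') := by
    rw [Real.log_mul (pairing_pos _ _).ne' (pairing_pos _ _).ne',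
      Real.log_mul (pairing_pos _ _).ne' (pairing_pos _ _).ne']
    linarith
  have h2 := Real.log_injOn_pos (mul_pos (pairing_pos _ _) (pairing_pos _ _))
    (mul_pos (pairing_pos _ _) (pairing_pos _ _)) h1
  unfold pairing at h2
  have h3 : (Real.exp ξ - Real.exp ξ') * (Real.exp z - Real.exp z') = 0 := by
    linear_combination h2
  have h4 : Real.exp z - Real.exp z' ≠ 0 := sub_ne_zero.2 fun h => hz (Real.exp_injective h)
  exact Real.exp_injective (sub_eq_zero.1 ((mul_eq_zero.1 h3).resolve_right h4))

lemma continuous_log_pairing (z : ℝ) : Continuous fun ξ => Real.log (pairing ξ z) := by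
  refine Continuous.log ?_ fun ξ => (pairing_pos ξ z).ne'
  unfold pairing
  fun_prop

lemma continuous_log_pairing' (ξ : ℝ) : Continuous fun z => Real.log (pairing ξ z) := by
  refine Continuous.log ?_ fun z => (pairing_pos ξ z).ne'
  unfold pairing
  fun_prop

lemma continuous_log_nrm : Continuous fun z => Real.log (nrm (1, Real.exp z)) := by
  refine Continuous.log ?_ fun z => (nrm_pos (one_exp_ne_zero z)).ne'
  unfold nrm
  fun_prop

/-- If a solution of the cohomological equation exists on an invariant set with two points, then all
matrices have the same major eigendirection. -/
lemma fixed_eq_of_cohomological (A : Fin k → GL (Fin 2) ℝ) (hpos : ∀ i r c, 0 < (A i).val r c)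
    {t b : ℝ} (ht : t / Real.log b ≠ 0) {h : ℝ → ℂ} {K E : Set ℝ} (hc : ContinuousOn h K)
    (hEK : E ⊆ K) (hne : ∀ z ∈ E, h z ≠ 0) (hinv : ∀ z ∈ E, ∀ i, psi A i z ∈ E)
    (heq : ∀ z ∈ E, ∀ i,
      Complex.exp ((t * lineWeight b A i z : ℝ) * Complex.I) * h (psi A i z) = h z)
    {j : Fin k} {zj xj : ℝ} (hzj : psi A j zj = zj) (hzjE : zj ∈ E) (hxj : act (A j).val xj = xj)
    {z z' : ℝ} (hz : z ∈ E) (hz' : z' ∈ E) (hzz : z ≠ z')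
    {i : Fin k} {xi : ℝ} (hxi : act (A i).val xi = xi) : xi = xj := by
  set κ := t / Real.log b with hκ
  -- This factor absorbs the coboundary of log norms, leaving only the scaling factors in the
  -- equation for Φ.
  set Φ : ℝ → ℂ := fun z => h z * Complex.exp ((-κ * Real.log (nrm (1, Real.exp z)) : ℝ) *
    Complex.I) with hΦ
  set q : Fin k → ℝ → ℝ := fun i z => Real.log ((A i).val 0 0 + (A i).val 1 0 * Real.exp z) with hq
  have hstep : ∀ z ∈ E, ∀ i, Φ z = Φ (psi A i z) * Complex.exp ((-κ * q i z : ℝ) * Complex.I) := by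
    intro z hz i
    simp only [hΦ]
    rw [← heq z hz i, lineWeight_eq b A hpos, mul_right_comm, ← Complex.exp_add, mul_comm,
      mul_assoc, ← Complex.exp_add, ← add_mul, ← add_mul, ← Complex.ofReal_add,
      ← Complex.ofReal_add]
    congr 4
    rw [mul_div_assoc', mul_comm t, mul_div_assoc, ← hκ]
    simp only [hq]
    ring
  -- `F ξ` says that Φ is on E a constant multiple of the power -iκ of the pairing with ξ.
  -- Adjointness carries this from ξ to `act (A i).val ξ`.
  let F : ℝ → Prop := fun ξ => ∃ c : ℂ, ∀ z ∈ E,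
    Φ z = c * Complex.exp ((-κ * Real.log (pairing ξ z) : ℝ) * Complex.I)
  have hF : ∀ ξ i, F ξ → F (act (A i).val ξ) := by
    rintro ξ i ⟨c, hcξ⟩
    refine ⟨c * Complex.exp ((-κ * Real.log ((A i).val 0 0 + (A i).val 0 1 * Real.exp ξ) : ℝ) *
      Complex.I), fun z hz => ?_⟩
    rw [hstep z hz i, hcξ _ (hinv z hz i), mul_assoc, mul_assoc, ← Complex.exp_add,
      ← Complex.exp_add, ← add_mul, ← add_mul, ← Complex.ofReal_add, ← Complex.ofReal_add,
      ← mul_add, ← mul_add]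
    have := log_pairing_adjoint (hpos i) ξ z
    simp only [hq, psi]
    rw [this]
  have hrho := act_contr (M := (A j).val.transpose) fun r c => hpos j c r
  obtain ⟨ρ, hρ0, hρ1, hcontr⟩ := hrho
  have hFj : F xj := by
    set lam := Real.log ((A j).val 0 0 + (A j).val 0 1 * Real.exp xj) with hlam
    set G : ℝ → ℂ := fun z => Φ z * Complex.exp ((κ * Real.log (pairing xj z) : ℝ) * Complex.I)
      with hG
    -- As xj is fixed, ψ_j multiplies the quotient G by a constant, which is 1 by evaluation at zj.
    -- So G is invariant, and it is constant because the iterates of ψ_j converge to zj.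
    have hGstep : ∀ z ∈ E, G z = G (psi A j z) * Complex.exp ((-κ * lam : ℝ) * Complex.I) := by
      intro z hz
      simp only [hG]
      rw [hstep z hz j, mul_assoc (Φ (psi A j z)), mul_assoc (Φ (psi A j z)), ← Complex.exp_add,
        ← Complex.exp_add, ← add_mul, ← add_mul, ← Complex.ofReal_add, ← Complex.ofReal_add]
      congr 4
      have := log_pairing_adjoint (hpos j) xj z
      rw [hxj] at this
      simp only [hq, psi]
      linear_combination (-κ) * this
    have hGne : ∀ z ∈ E, G z ≠ 0 := fun z hz =>
      mul_ne_zero (mul_ne_zero (hne z hz) (Complex.exp_ne_zero _)) (Complex.exp_ne_zero _)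
    have hone : Complex.exp ((-κ * lam : ℝ) * Complex.I) = 1 := by
      have := hGstep zj hzjE
      rw [hzj] at this
      exact mul_left_cancel₀ (hGne zj hzjE) (by rw [mul_one, ← this])
    have hGinv : ∀ z ∈ E, G (psi A j z) = G z := fun z hz => by
      rw [hGstep z hz, hone, mul_one]
    have hit : ∀ z ∈ E, ∀ n, (psi A j)^[n] z ∈ E ∧ G ((psi A j)^[n] z) = G z := by
      intro z hz n
      induction n with
      | zero => exact ⟨hz, rfl⟩
      | succ n ih =>
        rw [Function.iterate_succ_apply']
        exact ⟨hinv _ ih.1 j, by rw [hGinv _ ih.1, ih.2]⟩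
    have hGc : ContinuousOn G K := by
      refine (hc.mul ?_).mul ?_
      · refine Continuous.continuousOn ?_
        have := continuous_log_nrm
        fun_prop
      · refine Continuous.continuousOn ?_
        have := continuous_log_pairing' xj
        fun_prop
    have hGconst : ∀ z ∈ E, G z = G zj := by
      intro z hz
      have h1 := tendsto_iterate_of_contr hρ0 hρ1 hcontr hzj z
      have h2 : Tendsto (fun n => (psi A j)^[n] z) atTop (𝓝[K] zj) :=
        tendsto_nhdsWithin_iff.2 ⟨h1, Eventually.of_forall fun n => hEK (hit z hz n).1⟩
      have h3 := (hGc zj (hEK hzjE)).tendsto.comp h2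
      refine tendsto_nhds_unique (tendsto_const_nhds.congr fun n => ?_) h3
      exact (hit z hz n).2.symm
    refine ⟨G zj, fun z hz => ?_⟩
    rw [← hGconst z hz]
    simp only [hG]
    rw [mul_assoc, ← Complex.exp_add, ← add_mul, ← Complex.ofReal_add]
    have : κ * Real.log (pairing xj z) + -κ * Real.log (pairing xj z) = 0 := by ring
    rw [this]
    simp
  set D : ℝ → ℝ := fun ξ => Real.log (pairing ξ z) - Real.log (pairing ξ z') with hD
  -- The quotient Φ z' / Φ z equals exp(iκ D ξ) for every ξ with `F ξ`, so the values κ D ξ agree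
  -- modulo 2π.
  have hDF : ∀ ξ ξ', F ξ → F ξ' → Complex.exp ((κ * (D ξ - D ξ') : ℝ) * Complex.I) = 1 := by
    rintro ξ ξ' ⟨c, hcξ⟩ ⟨c', hcξ'⟩
    have hΦne : ∀ z ∈ E, Φ z ≠ 0 := fun z hz => mul_ne_zero (hne z hz) (Complex.exp_ne_zero _)
    have key : ∀ ξ c, (∀ z ∈ E, Φ z = c * Complex.exp ((-κ * Real.log (pairing ξ z) : ℝ) *
        Complex.I)) → Φ z' = Φ z * Complex.exp ((κ * D ξ : ℝ) * Complex.I) := by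
      intro ξ c hcξ
      rw [hcξ z hz, hcξ z' hz', mul_assoc, ← Complex.exp_add, ← add_mul, ← Complex.ofReal_add]
      congr 4
      simp only [hD]
      ring
    have h1 := key ξ c hcξ
    rw [key ξ' c' hcξ'] at h1
    have h2 := mul_left_cancel₀ (hΦne z hz) h1
    rw [mul_sub, Complex.ofReal_sub, sub_mul, Complex.exp_sub, h2, div_self (Complex.exp_ne_zero _)]
  obtain ⟨ρ', hρ0', hρ1', hcontr'⟩ := act_contr (hpos i)
  set ξ : ℕ → ℝ := fun n => (act (A i).val)^[n] xj with hξ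
  have hξF : ∀ n, F (ξ n) := by
    intro n
    induction n with
    | zero => exact hFj
    | succ n ih => simp only [hξ]; rw [Function.iterate_succ_apply']; exact hF _ i ih
  have hξlim : Tendsto ξ atTop (𝓝 xi) := tendsto_iterate_of_contr hρ0' hρ1' hcontr' hxi xj
  -- Along the iterates of xj under A_i, which converge to xi, the increments of κ D tend to 0.
  -- Being multiples of 2π they vanish eventually, so the iterates become stationary, and by
  -- injectivity xj itself is fixed.
  have hDlim : Tendsto (fun n => κ * (D (ξ (n + 1)) - D (ξ n))) atTop (𝓝 0) := by
    have hDc : Continuous D := (continuous_log_pairing z).sub (continuous_log_pairing z')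
    have h1 := (hDc.tendsto xi).comp hξlim
    have h2 := (((tendsto_add_atTop_iff_nat 1).2 h1).sub h1).const_mul κ
    simpa using h2
  obtain ⟨n, hn1, hn2⟩ := ((hDlim.eventually_const_lt (show -(2 * Real.pi) < 0 by
    linarith [Real.pi_pos])).and (hDlim.eventually_lt_const (show 0 < 2 * Real.pi by
    linarith [Real.pi_pos]))).exists
  have hcos := congrArg Complex.re (hDF _ _ (hξF (n + 1)) (hξF n))
  rw [Complex.exp_ofReal_mul_I_re, Complex.one_re,
    Real.cos_eq_one_iff_of_lt_of_lt hn1 hn2] at hcos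
  have hDeq := sub_eq_zero.1 ((mul_eq_zero.1 hcos).resolve_left ht)
  have hξeq : ξ (n + 1) = ξ n := log_pairing_injective hzz hDeq
  have hfix : act (A i).val xj = xj := by
    simp only [hξ] at hξeq
    rw [Function.iterate_succ_apply] at hξeq
    exact (act_injective (hpos i) (det_ne_zero (A i))).iterate n hξeq
  exact fixed_unique_of_contr hρ1' hcontr' hxi hfix

/-- Exponentiation gives 2^|X| = 3^|Y|, which parity excludes for X ≠ 0. -/
lemma int_log_two_ne_log_three {X Y : ℤ} (h : (X : ℝ) * Real.log 2 = Y * Real.log 3) : X = 0 := by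
  have h1 : ((X.natAbs : ℕ) : ℝ) * Real.log 2 = (Y.natAbs : ℕ) * Real.log 3 := by
    have := congrArg abs h
    rw [abs_mul, abs_mul, abs_of_pos (Real.log_pos one_lt_two),
      abs_of_pos (Real.log_pos (by norm_num : (1 : ℝ) < 3))] at this
    rw [Nat.cast_natAbs, Nat.cast_natAbs, Int.cast_abs, Int.cast_abs]
    exact this
  rw [← Real.log_pow, ← Real.log_pow] at h1
  have h2 : ((2 : ℝ) ^ X.natAbs) = 3 ^ Y.natAbs :=
    Real.log_injOn_pos (Set.mem_Ioi.2 (by positivity)) (Set.mem_Ioi.2 (by positivity)) h1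
  have h3 : 2 ^ X.natAbs = 3 ^ Y.natAbs := by exact_mod_cast h2
  by_contra hX
  have h4 : 2 ∣ 3 ^ Y.natAbs := by
    rw [← h3]
    exact dvd_pow_self 2 (Int.natAbs_ne_zero.2 hX)
  have := Nat.prime_two.dvd_of_dvd_pow h4
  omega

lemma eigenvalue_of_isMaxEigendirection {M : Matrix (Fin 2) (Fin 2) ℝ} {θ : RP1} {l : ℝ}
    (h : IsMaxEigendirection M θ l) : Module.End.HasEigenvalue (lin M) l :=
  Module.End.hasEigenvalue_of_hasEigenvector
    ⟨Module.End.mem_eigenspace_iff.2 (h.1 _ (by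
      rw [Projectivization.submodule_eq]; exact Submodule.mem_span_singleton_self _)),
      θ.rep_nonzero⟩

/-- A common minor eigendirection is a common fixed point in the coordinate `z`. -/
lemma hasCommonMinorDirection_iff (A : Fin k → GL (Fin 2) ℝ)
    (hpos : ∀ i r c, 0 < (A i).val r c) (i₀ : Fin k) :
    HasCommonMinorDirection A ↔ ∃ z, ∀ i, psi A i z = z := by
  constructor
  · rintro ⟨x, hx, hfix⟩
    have h1 := phi_secondQuadrant A hpos i₀ ((mem_secondQuadrant_iff x).1 hx)
    rw [hfix] at h1
    obtain ⟨z, rfl⟩ := exists_line h1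
    refine ⟨z, fun i => line_injective ?_⟩
    rw [psi, ← phi_line A hpos, hfix]
  · rintro ⟨z, hz⟩
    refine ⟨line z, (mem_secondQuadrant_iff _).2 (coordProd_line z).le, fun i => ?_⟩
    rw [phi_line A hpos]
    exact congrArg line (hz i)

/-- With the chosen base of the logarithms, and without a common minor eigendirection, the twisted
operators have no nonzero continuous fixed functions. -/
theorem noTwistedFixed (A : Fin k → GL (Fin 2) ℝ) (hpos : ∀ i r c, 0 < (A i).val r c)
    (p : PMF (Fin k)) (hp : ∀ i, p i ≠ 0) (hminor : ¬ HasCommonMinorDirection A) {ρ R M c C : ℝ}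
    (hS : IsContractingSystem (psi A) (lineWeight (logBase A) A) ρ R M c C) {N : ℕ} (hN : 1 ≤ N) :
    NoTwistedFixed p (psi A) (lineWeight (logBase A) A) R N := by
  intro n hn h hc hfix
  by_contra! hne
  have hb1 : 1 < logBase A := by unfold logBase; split_ifs <;> norm_num
  have hlogb := Real.log_pos hb1
  have hNpos : (0 : ℝ) < N := by exact_mod_cast hN
  have hnR : (n : ℝ) ≠ 0 := by exact_mod_cast hn
  set t := 2 * Real.pi * n / N with ht
  have ht0 : t ≠ 0 := by
    have := Real.pi_pos.ne'
    positivity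
  obtain ⟨E, hEK, hE0, hEinv, hEeq, hEfix⟩ := exists_invariant_set hS p hp hc hfix hne
  choose z hz using fun i => exists_fixed_of_contr hS.rho_nonneg hS.rho_lt_one (hS.contr i)
  have hex : ∀ i, ∃ x, act (A i).val x = x := fun i => by
    obtain ⟨ρ', h0, h1, h2⟩ := act_contr (hpos i)
    exact exists_fixed_of_contr h0 h1 h2
  choose x hx using hex
  obtain ⟨i₀⟩ : Nonempty (Fin k) := by
    by_contra hemp
    rw [not_nonempty_iff] at hemp
    exact absurd (sum_toReal_pmf p) (by simp)
  -- The fixed points z i all lie in E, so without a common minor direction E has the two points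
  -- needed to compare the Perron directions.
  obtain ⟨r, s, hrs⟩ : ∃ r s, z r ≠ z s := by
    by_contra! hall
    exact hminor ((hasCommonMinorDirection_iff A hpos i₀).2 ⟨z i₀, fun i => by
      rw [hall i₀ i]; exact hz i⟩)
  have hxx : ∀ i, x i = x i₀ := fun i =>
    fixed_eq_of_cohomological A hpos (div_ne_zero ht0 hlogb.ne') hc hEK hE0 hEinv hEeq (hz i₀)
      (hEfix i₀ _ (hz i₀)) (hx i₀) (hEfix r _ (hz r)) (hEfix s _ (hz s)) hrs (hx i)
  set lam : Fin k → ℝ := fun i => (A i).val 0 0 + (A i).val 0 1 * Real.exp (x i) with hlam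
  have hlam0 : ∀ i, 0 < lam i := fun i => row_pos (hpos i) 0 (x i)
  -- Adjointness at the fixed points of A_i and A_iᵀ identifies their Perron eigenvalues.
  have hw : ∀ i, lineWeight (logBase A) A i (z i) = -Real.logb (logBase A) (lam i) := by
    intro i
    have h1 := log_pairing_adjoint (hpos i) (x i) (z i)
    rw [hx i] at h1
    have h2 : act (A i).val.transpose (z i) = z i := hz i
    rw [h2] at h1
    rw [lineWeight_eq _ A hpos, hz i, sub_self, zero_sub, Real.logb, neg_div]
    simp only [hlam]
    congr 2
    linarith
  -- At z i the cohomological equation reads exp(i t f_i(z i)) = 1 with t = 2πn/N, so each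
  -- eigenvalue is a rational power of b.
  have hrat : ∀ i, ∃ l : ℤ, n * Real.log (lam i) = l * N * Real.log (logBase A) := by
    intro i
    have h1 := hEeq _ (hEfix i _ (hz i)) i
    rw [hz i] at h1
    have h2 : Complex.exp ((t * lineWeight (logBase A) A i (z i) : ℝ) * Complex.I) = 1 :=
      mul_right_cancel₀ (hE0 _ (hEfix i _ (hz i))) (by rw [h1, one_mul])
    have h3 := congrArg Complex.re h2
    rw [Complex.exp_ofReal_mul_I_re, Complex.one_re, Real.cos_eq_one_iff] at h3
    obtain ⟨l, hl⟩ := h3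
    refine ⟨-l, ?_⟩
    rw [hw i, Real.logb, ht] at hl
    have hpi := Real.pi_pos.ne'
    field_simp at hl
    push_cast
    have h4 : Real.pi * (n * Real.log (lam i) + l * N * Real.log (logBase A)) = 0 := by
      linear_combination Real.pi * hl
    have h5 := (mul_eq_zero.1 h4).resolve_left hpi
    linarith
  -- In the resonant case b = 3, and an eigenvalue less than 1 would be a rational power of both 2
  -- and 3. Otherwise b = 2, and the eigenvalues just found make the system resonant.
  by_cases hres : IsResonant A
  · have hb3 : logBase A = 3 := by unfold logBase; rw [if_pos hres]
    obtain ⟨⟨θ, hθ⟩, -⟩ := hres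
    obtain ⟨q, hq⟩ := hθ i₀
    have hmax := isMaxEigendirection_posLine (hpos i₀) (hx i₀)
    have h2q : (0 : ℝ) < 2 ^ (q : ℝ) := Real.rpow_pos_of_pos two_pos _
    have heq : lam i₀ = 2 ^ (q : ℝ) := by
      have a1 := hmax.2 _ (eigenvalue_of_isMaxEigendirection hq)
      have a2 := hq.2 _ (eigenvalue_of_isMaxEigendirection hmax)
      rw [abs_of_pos h2q, abs_of_pos (hlam0 i₀)] at a1 a2
      exact le_antisymm a2 a1
    have hlt : Real.log (lam i₀) ≠ 0 := by
      intro h0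
      have h1 := hS.lower i₀ (z i₀)
      rw [hw, Real.logb, h0, zero_div, neg_zero] at h1
      linarith [hS.pos]
    obtain ⟨l, hl⟩ := hrat i₀
    rw [heq, Real.log_rpow two_pos] at hlt
    rw [heq, Real.log_rpow two_pos, hb3] at hl
    have hqd : (q : ℝ) * q.den = q.num := by exact_mod_cast Rat.mul_den_eq_num q
    have hX := int_log_two_ne_log_three (X := n * q.num) (Y := l * N * q.den) (by
      push_cast
      rw [← hqd]
      linear_combination (q.den : ℝ) * hl)
    rcases mul_eq_zero.1 hX with h0 | h0
    · exact hn h0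
    · refine hlt ?_
      rw [Rat.num_eq_zero.1 h0]
      simp
  · have hb2 : logBase A = 2 := by unfold logBase; rw [if_neg hres]
    refine hres ⟨⟨posLine (x i₀), fun i => ?_⟩, hminor⟩
    obtain ⟨l, hl⟩ := hrat i
    refine ⟨(l * N / n : ℚ), ?_⟩
    have hval : (2 : ℝ) ^ (((l * N / n : ℚ)) : ℝ) = lam i := by
      rw [hb2] at hl
      refine Real.log_injOn_pos (Set.mem_Ioi.2 (Real.rpow_pos_of_pos two_pos _))
        (Set.mem_Ioi.2 (hlam0 i)) ?_
      rw [Real.log_rpow two_pos]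
      push_cast
      field_simp
      linarith
    rw [hval, ← hxx i]
    exact isMaxEigendirection_posLine (hpos i) (hx i)

end NonLattice

/-! ### Convergence along almost every orbit, for all test functions at once. -/

section Trajectories

variable {k : ℕ}

/-- The bounded Lipschitz functions. -/
def boundedLip : Set (ℝ → ℝ) :=
  {g | ∃ B D, (∀ z, |g z| ≤ B) ∧ ∀ x y, |g x - g y| ≤ D * |x - y|}

lemma continuous_of_mem_boundedLip {g : ℝ → ℝ} (hg : g ∈ boundedLip) : Continuous g := by
  obtain ⟨-, D, -, hD⟩ := hg
  refine (LipschitzWith.of_dist_le' (K := D) fun x y => ?_).continuous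
  rw [Real.dist_eq, Real.dist_eq]
  exact hD x y

/-- Countably many bounded Lipschitz functions approximate all others on an interval. -/
lemma exists_countable_boundedLip (R : ℝ) : ∃ G ⊆ boundedLip, G.Countable ∧
    ∀ g ∈ boundedLip, ∀ ε > 0, ∃ h ∈ G, ∀ z ∈ Set.Icc (-R) R, |g z - h z| ≤ ε := by
  let r : boundedLip → C(Set.Icc (-R) R, ℝ) := fun g =>
    ⟨fun z => g.1 z, (continuous_of_mem_boundedLip g.2).comp continuous_subtype_val⟩
  -- C([-R, R]) is separable, and so is the set of restrictions. A countable family is needed for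
  -- one exceptional null set to serve all test functions.
  obtain ⟨t, htr, htc, hcl⟩ :=
    (TopologicalSpace.IsSeparable.of_separableSpace (Set.range r)).exists_countable_dense_subset
  have : Nonempty boundedLip := ⟨⟨fun _ => 0, 0, 0, by simp, by simp⟩⟩
  choose! s hs using fun F (hF : F ∈ t) => htr hF
  refine ⟨(fun F => (s F).1) '' t, ?_, htc.image _, fun g hg ε hε => ?_⟩
  · rintro _ ⟨F, -, rfl⟩
    exact (s F).2
  · obtain ⟨F, hF, hd⟩ := Metric.mem_closure_iff.1 (hcl ⟨⟨g, hg⟩, rfl⟩) ε hε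
    refine ⟨_, ⟨F, hF, rfl⟩, fun z hz => ?_⟩
    have h1 := ContinuousMap.dist_apply_le_dist (f := r ⟨g, hg⟩) (g := F) ⟨z, hz⟩
    rw [← hs F hF] at h1 hd
    exact h1.trans hd.le

lemma abs_mean_le {u : ℕ → ℝ} {B : ℝ} (hB0 : 0 ≤ B) (hu : ∀ j, |u j| ≤ B) (I : ℕ) :
    |mean u I| ≤ B := by
  have h := norm_mean_le (u := fun j => (u j : ℂ)) hB0
    (fun j => by rw [Complex.norm_real]; exact hu j) I
  rwa [mean_ofReal, Complex.norm_real] at h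

/-- Convergence of averages passes from countably many to all bounded Lipschitz functions. -/
lemma tendsto_mean_of_dense {R : ℝ} {G : Set (ℝ → ℝ)} (hGL : G ⊆ boundedLip)
    (hG : ∀ g ∈ boundedLip, ∀ ε > 0, ∃ h ∈ G, ∀ z ∈ Set.Icc (-R) R, |g z - h z| ≤ ε)
    {ν : Measure ℝ} [IsProbabilityMeasure ν] (hν : ∀ᵐ z ∂ν, z ∈ Set.Icc (-R) R) {ζ : ℕ → ℝ}
    (hζ : ∀ᶠ j in atTop, ζ j ∈ Set.Icc (-R) R)
    (h : ∀ g ∈ G, Tendsto (mean fun j => g (ζ j)) atTop (𝓝 (∫ z, g z ∂ν))) {g : ℝ → ℝ}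
    (hg : g ∈ boundedLip) : Tendsto (mean fun j => g (ζ j)) atTop (𝓝 (∫ z, g z ∂ν)) := by
  obtain ⟨n, hn⟩ := eventually_atTop.1 hζ
  rw [← mean_shift n]
  rw [Metric.tendsto_atTop]
  intro ε hε
  obtain ⟨g', hg', hgg'⟩ := hG g hg (ε / 4) (by positivity)
  have h1 := (mean_shift n).2 (h g' hg')
  rw [Metric.tendsto_atTop] at h1
  obtain ⟨J, hJ⟩ := h1 (ε / 4) (by positivity)
  have hint : ∀ g ∈ boundedLip, Integrable g ν := fun g hg => by
    obtain ⟨B, -, hB, -⟩ := id hg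
    exact Integrable.of_bound (continuous_of_mem_boundedLip hg).aestronglyMeasurable B
      (Eventually.of_forall hB)
  have h2 : |∫ z, g z ∂ν - ∫ z, g' z ∂ν| ≤ ε / 4 := by
    rw [← integral_sub (hint g hg) (hint g' (hGL hg'))]
    have := norm_integral_le_of_norm_le_const (μ := ν) (f := fun z => g z - g' z) (C := ε / 4)
      (hν.mono fun z hz => hgg' z hz)
    simpa using this
  refine ⟨J, fun I hI => ?_⟩
  have h3 := hJ I hI
  rw [Real.dist_eq] at h3 ⊢
  have h4 : |mean (fun j => g (ζ (n + j))) I - mean (fun j => g' (ζ (n + j))) I| ≤ ε / 4 := by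
    rw [← mean_sub]
    exact abs_mean_le (by positivity) (fun j => hgg' _ (hn _ (by omega))) I
  rw [abs_lt] at h3 ⊢
  rw [abs_le] at h2 h4
  constructor <;> linarith [h2.1, h2.2, h3.1, h3.2, h4.1, h4.2]

lemma countable_walk {X : Type*} (T : Fin k → X → X) (x : X) (n : ℕ) :
    (Set.range fun a : ℕ → Fin k => walk T x a n).Countable := by
  induction n with
  | zero =>
    refine (Set.countable_singleton x).mono ?_
    rintro _ ⟨a, rfl⟩
    rfl
  | succ n ih =>
    refine (Set.countable_iUnion fun i => ih.image (T i)).mono ?_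
    rintro _ ⟨a, rfl⟩
    exact Set.mem_iUnion.2 ⟨a n, _, ⟨a, rfl⟩, rfl⟩

/-- Almost sure properties of trajectories from all starting points hold for all tails of a
trajectory. -/
lemma ae_walk_tail {X : Type*} (p : PMF (Fin k)) (T : Fin k → X → X) {P : X → (ℕ → Fin k) → Prop}
    (h : ∀ x, ∀ᵐ a ∂bernoulli p, P x a) (x : X) :
    ∀ᵐ a ∂bernoulli p, ∀ n, P (walk T x a n) fun j => a (n + j) := by
  refine ae_all_iff.2 fun n => ?_
  -- At time n the trajectory has countably many possible positions, and the shifted sequence of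
  -- letters again has the Bernoulli distribution.
  have h1 := (ae_ball_iff (countable_walk T x n)).2 fun y _ => ae_shift p n (h y)
  filter_upwards [h1] with a ha using ha _ ⟨a, rfl⟩

lemma weight_of_perpLine_eq_line (b : ℝ) (A : Fin k → GL (Fin 2) ℝ) (i : Fin k) {w : ℝ × ℝ}
    (hw : w ≠ 0) {z : ℝ} (h : perpLine w = line z) : weight b A i w = lineWeight b A i z := by
  have h1 : 0 < w.1 * w.2 := (coordProd_neg_iff hw).1 (h ▸ coordProd_line z)
  have h2 : w.1 ≠ 0 := left_ne_zero_of_mul h1.ne'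
  have h3 : 0 < w.2 / w.1 := by
    have : w.2 / w.1 = w.1 * w.2 / w.1 ^ 2 := by field_simp
    rw [this]; positivity
  have h4 : Real.log (w.2 / w.1) = z := line_injective (by rw [← perpLine_eq_line h1, h])
  have h5 : w = w.1 • ((1, Real.exp z) : ℝ × ℝ) := by
    rw [← h4, Real.exp_log h3]
    ext
    · simp
    · simp [mul_div_cancel₀ _ h2]
  rw [h5, weight_smul b A i h2 (one_exp_ne_zero z), lineWeight]

/-- Once an orbit has entered the open second quadrant, it is given by the skew product. -/
lemma orbit_wordLength_eq_walk (b : ℝ) (A : Fin k → GL (Fin 2) ℝ)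
    (hpos : ∀ i r c, 0 < (A i).val r c) (d : Fin k → Plane) (a : ℕ → Fin k) {w : ℝ × ℝ}
    (hw : w ≠ 0) {n : ℕ} {z : ℝ} (h : orbit A a (perpLine w) n = line z) (j : ℕ) :
    let x := walk (skew (psi A) (lineWeight b A)) (z, wordLength b A d (perpLine w) a n)
      (fun j => a (n + j)) j
    orbit A a (perpLine w) (n + j) = line x.1 ∧ wordLength b A d (perpLine w) a (n + j) = x.2 := by
  induction j with
  | zero => exact ⟨h, rfl⟩
  | succ j ih =>
    simp only at ih ⊢
    rw [walk, skew]
    constructor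
    · rw [← add_assoc, orbit, ih.1, phi_line A hpos]
      rfl
    · have h1 := wordLength_succ_sub b A d a hw (n + j)
      rw [weight_of_perpLine_eq_line b A _ (trWalk_ne_zero A a hw _)
        (by rw [← orbit_perpLine A a hw, ih.1])] at h1
      rw [← add_assoc]
      linarith [ih.2]

lemma wordLength_zero (b : ℝ) (A : Fin k → GL (Fin 2) ℝ) (d : Fin k → Plane) (a : ℕ → Fin k)
    {w : ℝ × ℝ} (hw : w ≠ 0) : wordLength b A d (perpLine w) a 0 = 0 := by
  rw [wordLength_perpLine b A d a hw]
  exact sub_self _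

/-- The mean weight is positive. -/
lemma renewalMean_one_pos {ψ f : Fin k → ℝ → ℝ} {ρ R M c C : ℝ}
    (hS : IsContractingSystem ψ f ρ R M c C) (p : PMF (Fin k)) (m : Measure ℝ)
    [IsProbabilityMeasure m] : 0 < renewalMean p ψ f m fun _ => 1 := by
  have hle : ∀ z, c ≤ ∑ i, (p i).toReal * (f i z * 1) := fun z => by
    calc c = ∑ i, (p i).toReal * c := by rw [← Finset.sum_mul, sum_toReal_pmf, one_mul]
      _ ≤ _ := Finset.sum_le_sum fun i _ =>
        mul_le_mul_of_nonneg_left (by rw [mul_one]; exact hS.lower i z) ENNReal.toReal_nonneg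
  have hint : Integrable (fun z => ∑ i, (p i).toReal * (f i z * 1)) m := by
    refine Integrable.of_bound (C := C) ?_ (Eventually.of_forall fun z => ?_)
    · refine Continuous.aestronglyMeasurable (continuous_finsetSum _ fun i _ => ?_)
      exact continuous_const.mul ((weight_continuous hS i).mul continuous_const)
    · refine abs_sum_pmf_le p fun i => ?_
      rw [mul_one, abs_of_nonneg (hS.pos.le.trans (hS.lower i z))]
      exact hS.upper i z
  have h := integral_mono (integrable_const c) hint hle
  simp only [integral_const, probReal_univ, one_smul] at h
  exact hS.pos.trans_le h

/-- Averages of bounded Lipschitz functions at the stopping times, along almost every orbit. -/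
theorem ae_mean_stopIndex {b : ℝ} (hb : 1 < b) (A : Fin k → GL (Fin 2) ℝ)
    (hpos : ∀ i r c, 0 < (A i).val r c)
    (hnorm : ∀ i, ‖Matrix.toEuclideanCLM (𝕜 := ℝ) (A i).val‖ < 1) (d : Fin k → Plane)
    (p : PMF (Fin k)) (hp : ∀ i, p i ≠ 0) {ρ R M c C : ℝ}
    (hS : IsContractingSystem (psi A) (lineWeight b A) ρ R M c C) {m : Measure ℝ}
    [IsProbabilityMeasure m] (hm : m = ∑ i, p i • m.map (psi A i)) {N : ℕ} (hN1 : 1 ≤ N)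
    (hN : NoTwistedFixed p (psi A) (lineWeight b A) R N) {ν : Measure ℝ} [IsProbabilityMeasure ν]
    (hν : ∀ᵐ z ∂ν, z ∈ Set.Icc (-R) R)
    (hint : ∀ g ∈ boundedLip, ∫ z, g z ∂ν = renewalMean p (psi A) (lineWeight b A) m g /
      renewalMean p (psi A) (lineWeight b A) m fun _ => 1)
    {θ : RP1} (hθ : θ ∈ goodDirections A) :
    ∀ᵐ a ∂bernoulli p, ∃ ζ : ℕ → ℝ,
      (∀ᶠ j in atTop, orbit A a θ (stopIndex b A d θ N a j) = line (ζ j)) ∧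
      ∀ g ∈ boundedLip, Tendsto (mean fun j => g (ζ (j + 1))) atTop (𝓝 (∫ z, g z ∂ν)) := by
  obtain ⟨G, hGL, hGc, hG⟩ := exists_countable_boundedLip R
  obtain ⟨w, hw, rfl⟩ := exists_perpLine θ
  obtain ⟨c', C', hc', hweight⟩ := exists_weight_bounds hb A hnorm
  set L := renewalMean p (psi A) (lineWeight b A) m with hL
  have hNpos : (0 : ℝ) < N := by exact_mod_cast hN1
  have hone : (fun _ => 1 : ℝ → ℝ) ∈ boundedLip := ⟨1, 0, by simp, by simp⟩
  have hfloor : ∀ g ∈ boundedLip, ∀ x : ℝ × ℝ, ∀ᵐ a ∂bernoulli p,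
      Tendsto (mean fun j => g (walk (skew (psi A) (lineWeight b A)) x a (j + 1)).1 *
        ((⌊(walk (skew (psi A) (lineWeight b A)) x a (j + 1)).2 / N⌋ : ℝ) -
          ⌊(walk (skew (psi A) (lineWeight b A)) x a j).2 / N⌋)) atTop (𝓝 (L g / N)) := by
    rintro g ⟨B, D, hB, hD⟩ x
    exact ae_mean_floor hS p hm hN hB hD x
  -- The entrance time depends on the sequence, so convergence is prepared for the skew product
  -- started at every time, from the current coordinate and length. Before entrance `lineCoord` is
  -- meaningless, but harmless. The constant 1 is added to G for the denominator.
  have htail := ae_walk_tail p (fun i => tr (A i).val) (P := fun v a =>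
    (∀ g ∈ insert (fun _ => 1) G,
      let x := walk (skew (psi A) (lineWeight b A))
        (lineCoord (perpLine v), Real.logb b (nrm w) - Real.logb b (nrm v)) a
      Tendsto (mean fun j => g (x (j + 1)).1 * ((⌊(x (j + 1)).2 / N⌋ : ℝ) - ⌊(x j).2 / N⌋)) atTop
        (𝓝 (L g / N)))) (fun v =>
      (ae_ball_iff (hGc.insert _)).2 fun g hg => by
        rcases hg with rfl | hg
        · exact hfloor _ hone _
        · exact hfloor g (hGL hg) _) w
  filter_upwards [htail, ae_exists_line A hpos p hp hθ] with a ha hline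
  obtain ⟨n, z, hz⟩ := hline
  have hwalk := orbit_wordLength_eq_walk b A hpos d a hw hz
  have ha' := ha n
  have hperp : perpLine (walk (fun i => tr (A i).val) w a n) = line z := by
    rw [← hz, orbit_perpLine A a hw]; rfl
  have hlen : Real.logb b (nrm w) - Real.logb b (nrm (walk (fun i => tr (A i).val) w a n)) =
      wordLength b A d (perpLine w) a n := (wordLength_perpLine b A d a hw n).symm
  rw [hperp, lineCoord_line, hlen] at ha'
  set S := fun n => wordLength b A d (perpLine w) a n with hSdef
  have hS0 : S 0 = 0 := wordLength_zero b A d a hw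
  have hSc : ∀ n, c' ≤ S (n + 1) - S n := fun n => by
    simp only [hSdef]
    rw [wordLength_succ_sub b A d a hw]
    exact (hweight _ _ (trWalk_ne_zero A a hw n)).1
  have hSC : ∀ n, S (n + 1) - S n ≤ C' := fun n => by
    simp only [hSdef]
    rw [wordLength_succ_sub b A d a hw]
    exact (hweight _ _ (trWalk_ne_zero A a hw n)).2
  have hτ := tendsto_firstIndex hS0 hc' hSc hSC hN1
  set x := walk (skew (psi A) (lineWeight b A)) (z, S n) (fun j => a (n + j)) with hx
  set y : ℕ → ℝ := fun l => lineCoord (orbit A a (perpLine w) l) with hy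
  have hyx : ∀ j, y (n + j) = (x j).1 := fun j => by
    simp only [hy]; rw [(hwalk j).1, lineCoord_line]
  have hSx : ∀ j, S (n + j) = (x j).2 := fun j => (hwalk j).2
  have horb : ∀ l, n ≤ l → orbit A a (perpLine w) l = line (y l) := by
    intro l hl
    obtain ⟨j, rfl⟩ := Nat.exists_eq_add_of_le hl
    rw [hyx, (hwalk j).1]
  -- At the entrance time n itself the coordinate can be arbitrary; one step later it lies in the
  -- bounded range of the maps.
  have hyR : ∀ l, n + 1 ≤ l → y l ∈ Set.Icc (-R) R := by
    intro l hl
    obtain ⟨j, rfl⟩ := Nat.exists_eq_add_of_le hl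
    rw [add_assoc, hyx, add_comm 1 j]
    exact abs_le.1 (hS.range _ _)
  have hstopIdx : ∀ j, stopIndex b A d (perpLine w) N a j = firstIndex S (N * j) := fun j => rfl
  have hpass : ∀ g ∈ insert (fun _ => 1) G, Tendsto (mean fun l => g (y (l + 1)) *
      ((⌊S (l + 1) / N⌋ : ℝ) - ⌊S l / N⌋)) atTop (𝓝 (L g / N)) := by
    intro g hg
    rw [← mean_shift n]
    refine (ha' g hg).congr fun I => ?_
    congr 1
    funext j
    rw [add_assoc n j 1, hyx, hSx, hSx]
  have hL1 : L (fun _ => 1) ≠ 0 := (renewalMean_one_pos hS p m).ne'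
  refine ⟨fun j => y (firstIndex S (N * j)), ?_, fun g hg => ?_⟩
  · filter_upwards [hτ.eventually_ge_atTop n] with j hj
    rw [hstopIdx, horb _ hj]
  · refine tendsto_mean_of_dense (R := R) hGL hG hν
      (ζ := fun j => y (firstIndex S (N * (j + 1 : ℕ)))) ?_ (fun g hg => ?_) hg
    · have h1 := ((tendsto_add_atTop_iff_nat 1).2 hτ).eventually_ge_atTop (n + 1)
      filter_upwards [h1] with j hj using hyR _ hj
    · obtain ⟨B, -, hB, -⟩ := id (hGL hg)
      have h1 := hpass _ (Set.mem_insert (fun _ => (1 : ℝ)) G)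
      simp only [one_mul] at h1
      have h2 := mean_firstIndex hS0 hc' hSc hSC hN1 (γ := fun l => g (y l)) (fun l => hB _)
        (div_ne_zero hL1 hNpos.ne') (hpass g (Set.mem_insert_of_mem _ hg)) h1
      -- The factor 1/N cancels, so the limit does not depend on N.
      rw [div_div_div_cancel_right₀ hNpos.ne'] at h2
      rw [hint g (hGL hg)]
      exact h2

end Trajectories

/-! ### The Furstenberg measure in coordinates, and the renewal measure. -/

section Measures

variable {k : ℕ}

lemma measurable_psi (A : Fin k → GL (Fin 2) ℝ) (i : Fin k) : Measurable (psi A i) := by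
  unfold psi act
  fun_prop

lemma psi_injective (A : Fin k → GL (Fin 2) ℝ) (hpos : ∀ i r c, 0 < (A i).val r c) (i : Fin k) :
    Function.Injective (psi A i) := by
  refine act_injective (fun r c => hpos i c r) ?_
  have := det_ne_zero (A i)
  simp only [Matrix.transpose_apply]
  rwa [mul_comm ((A i).val 1 0)]

/-- The Furstenberg measure is carried by the open second quadrant. -/
lemma ae_line_lineCoord (A : Fin k → GL (Fin 2) ℝ) (hpos : ∀ i r c, 0 < (A i).val r c)
    (p : PMF (Fin k)) {μF : Measure RP1} (hμF : IsFurstenberg A p μF) :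
    ∀ᵐ θ ∂μF, line (lineCoord θ) = θ := by
  have h0 : μF {θ | coordProd θ < 0}ᶜ = 0 := by
    have hm : MeasurableSet {θ : RP1 | coordProd θ < 0}ᶜ :=
      (measurableSet_lt continuous_coordProd.measurable measurable_const).compl
    rw [hμF.stationary _ hm]
    -- Every φ_i maps the closed second quadrant into the open one, so stationarity improves the
    -- support.
    refine Finset.sum_eq_zero fun i _ => ?_
    have hsub : phi A i ⁻¹' {θ | coordProd θ < 0}ᶜ ⊆ secondQuadrantᶜ := fun θ hθ h =>
      hθ (phi_secondQuadrant A hpos i ((mem_secondQuadrant_iff θ).1 h))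
    exact mul_eq_zero_of_right _ (measure_mono_null hsub hμF.supp)
  have h1 : ∀ᵐ θ ∂μF, coordProd θ < 0 := h0
  filter_upwards [h1] with θ hθ
  obtain ⟨z, rfl⟩ := exists_line hθ
  rw [lineCoord_line]

lemma map_line_map_lineCoord (A : Fin k → GL (Fin 2) ℝ) (hpos : ∀ i r c, 0 < (A i).val r c)
    (p : PMF (Fin k)) {μF : Measure RP1} (hμF : IsFurstenberg A p μF) :
    (μF.map lineCoord).map line = μF := by
  rw [Measure.map_map continuous_line.measurable measurable_lineCoord]
  conv_rhs => rw [← Measure.map_id (μ := μF)]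
  exact Measure.map_congr (ae_line_lineCoord A hpos p hμF)

lemma map_lineCoord_stationary (A : Fin k → GL (Fin 2) ℝ) (hpos : ∀ i r c, 0 < (A i).val r c)
    (p : PMF (Fin k)) {μF : Measure RP1} (hμF : IsFurstenberg A p μF) :
    μF.map lineCoord = ∑ i, p i • (μF.map lineCoord).map (psi A i) := by
  refine Measure.ext fun E hE => ?_
  rw [Measure.finsetSum_apply, Measure.map_apply measurable_lineCoord hE,
    hμF.stationary _ (measurable_lineCoord hE)]
  refine Finset.sum_congr rfl fun i _ => ?_
  rw [Measure.smul_apply, Measure.map_apply (measurable_psi A i) hE,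
    Measure.map_apply measurable_lineCoord (measurable_psi A i hE), smul_eq_mul]
  congr 1
  refine measure_congr ?_
  filter_upwards [ae_line_lineCoord A hpos p hμF] with θ hθ
  refine propext ?_
  change lineCoord (phi A i θ) ∈ E ↔ psi A i (lineCoord θ) ∈ E
  conv_lhs => rw [← hθ, phi_line A hpos, lineCoord_line]
  rfl

variable {ψ f : Fin k → ℝ → ℝ} {ρ R M c C : ℝ} {m : Measure ℝ} {p : PMF (Fin k)}

lemma stationary_apply (hψ : ∀ i, Measurable (ψ i)) (hm : m = ∑ i, p i • m.map (ψ i)) {E : Set ℝ}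
    (hE : MeasurableSet E) : m E = ∑ i, p i * m (ψ i ⁻¹' E) := by
  conv_lhs => rw [hm]
  rw [Measure.finsetSum_apply]
  refine Finset.sum_congr rfl fun i _ => ?_
  rw [Measure.smul_apply, Measure.map_apply (hψ i) hE, smul_eq_mul]

/-- The stationary measure of contractions with a common fixed point is carried by this point. -/
lemma ae_eq_of_common_fixed (hS : IsContractingSystem ψ f ρ R M c C)
    (hm : m = ∑ i, p i • m.map (ψ i)) {z₀ : ℝ} (hz₀ : ∀ i, ψ i z₀ = z₀) : ∀ᵐ z ∂m, z = z₀ := by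
  have hψ : ∀ i, Measurable (ψ i) := fun i => (psi_continuous hS i).measurable
  have hmeas : ∀ n : ℕ, MeasurableSet {z : ℝ | ρ ^ n * (R + |z₀|) < |z - z₀|} := fun n =>
    measurableSet_lt measurable_const (by fun_prop)
  -- Stationarity pulls the complement of a ball around z₀ back into the complement of a ball larger
  -- by 1/ρ; the induction starts from the bounded range.
  have h : ∀ n : ℕ, m {z | ρ ^ n * (R + |z₀|) < |z - z₀|} = 0 := by
    intro n
    induction n with
    | zero =>
      rw [stationary_apply hψ hm (hmeas 0)]
      refine Finset.sum_eq_zero fun i _ => mul_eq_zero_of_right _ ?_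
      refine measure_mono_null (fun z hz => ?_) (measure_empty (μ := m))
      have h1 : ρ ^ 0 * (R + |z₀|) < |ψ i z - z₀| := hz
      have h2 := hS.range i z
      have h3 := abs_sub (ψ i z) z₀
      rw [pow_zero, one_mul] at h1
      exact absurd h1 (by linarith)
    | succ n ih =>
      rw [stationary_apply hψ hm (hmeas (n + 1))]
      refine Finset.sum_eq_zero fun i _ => mul_eq_zero_of_right _ ?_
      refine measure_mono_null (fun z hz => ?_) ih
      have h1 : ρ ^ (n + 1) * (R + |z₀|) < |ψ i z - z₀| := hz
      have h2 := hS.contr i z z₀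
      rw [hz₀] at h2
      rw [pow_succ', mul_assoc] at h1
      exact lt_of_mul_lt_mul_left (h1.trans_le h2) hS.rho_nonneg
  have h1 : ∀ᵐ z ∂m, ∀ n : ℕ, |z - z₀| ≤ ρ ^ n * (R + |z₀|) :=
    ae_all_iff.2 fun n => by
      rw [ae_iff]
      simpa only [not_le] using h n
  filter_upwards [h1] with z hz
  have h2 := (tendsto_pow_atTop_nhds_zero_of_lt_one hS.rho_nonneg hS.rho_lt_one).mul_const
    (R + |z₀|)
  rw [zero_mul] at h2
  exact sub_eq_zero.1 (abs_eq_zero.1 (le_antisymm (ge_of_tendsto' h2 hz) (abs_nonneg _)))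

/-- The stationary measure of injective contractions with two different fixed points has no
atoms. -/
lemma nullSingletonClass_of_stationary (hS : IsContractingSystem ψ f ρ R M c C) [IsProbabilityMeasure m]
    (hp : ∀ i, p i ≠ 0) (hinj : ∀ i, Function.Injective (ψ i))
    (hm : m = ∑ i, p i • m.map (ψ i)) {i j : Fin k} {zi zj : ℝ} (hi : ψ i zi = zi)
    (hj : ψ j zj = zj) (hne : zi ≠ zj) : NullSingletonClass m := by
  refine ⟨fun z => ?_⟩
  -- Injectivity makes the mass of a point the average of the masses of its preimages, a
  -- subinvariant function.
  have h := subinvariant_eq_zero hS.rho_nonneg hS.rho_lt_one hS.contr hS.range hi hj hne p hp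
    (q := fun z => m.real {z}) (fun z => measureReal_nonneg) (fun z => measureReal_le_one)
    (fun z => ⟨fun i => m.real (ψ i ⁻¹' {z}), le_of_eq ?_, fun i => ?_⟩) z
  · rwa [measureReal_eq_zero_iff] at h
  · simp only [measureReal_def]
    rw [stationary_apply (fun i => (psi_continuous hS i).measurable) hm (measurableSet_singleton z),
      ENNReal.toReal_sum fun i _ => ENNReal.mul_ne_top (p.apply_ne_top i) (measure_ne_top _ _)]
    exact Finset.sum_congr rfl fun i _ => ENNReal.toReal_mul
  · by_cases h : ∃ y, ψ i y = z
    · obtain ⟨y, rfl⟩ := h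
      refine Or.inr ⟨y, rfl, le_of_eq ?_⟩
      dsimp only
      rw [← Set.image_singleton, (hinj i).preimage_image]
    · refine Or.inl (le_of_eq ?_)
      have : ψ i ⁻¹' {z} = ∅ := by
        ext y
        simp only [Set.mem_preimage, Set.mem_singleton_iff, Set.mem_empty_iff_false, iff_false]
        exact fun hy => h ⟨y, hy⟩
      simp [this]

/-- The distribution of the next point, weighted by the increments. -/
def renewalMeasure (p : PMF (Fin k)) (ψ f : Fin k → ℝ → ℝ) (m : Measure ℝ) : Measure ℝ :=
  ∑ i, p i • (m.withDensity fun z => ENNReal.ofReal (f i z)).map (ψ i)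

/-- Densities bounded below by c > 0 and positive probabilities do not change null sets, term by
term in the stationarity equation. This gives the equivalence with the Furstenberg measure. -/
lemma renewalMeasure_eq_zero_iff (hS : IsContractingSystem ψ f ρ R M c C) (hp : ∀ i, p i ≠ 0)
    (hm : m = ∑ i, p i • m.map (ψ i)) {E : Set ℝ} (hE : MeasurableSet E) :
    renewalMeasure p ψ f m E = 0 ↔ m E = 0 := by
  have hψ : ∀ i, Measurable (ψ i) := fun i => (psi_continuous hS i).measurable
  have hf : ∀ i, Measurable fun z => ENNReal.ofReal (f i z) := fun i =>
    (weight_continuous hS i).measurable.ennreal_ofReal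
  rw [stationary_apply hψ hm hE, renewalMeasure, Measure.finsetSum_apply,
    Finset.sum_eq_zero_iff, Finset.sum_eq_zero_iff]
  refine forall_congr' fun i => imp_congr_right fun _ => ?_
  rw [Measure.smul_apply, Measure.map_apply (hψ i) hE, smul_eq_mul, mul_eq_zero, mul_eq_zero,
    or_iff_right (hp i), or_iff_right (hp i), withDensity_apply_eq_zero (hf i)]
  have : {z | ENNReal.ofReal (f i z) ≠ 0} = Set.univ := by
    ext z
    simpa using hS.pos.trans_le (hS.lower i z)
  rw [this, Set.univ_inter]

lemma integral_renewalMeasure (hS : IsContractingSystem ψ f ρ R M c C) [IsProbabilityMeasure m]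
    {g : ℝ → ℝ} (hg : g ∈ boundedLip) :
    ∫ z, g z ∂renewalMeasure p ψ f m = renewalMean p ψ f m g := by
  have hψ : ∀ i, Measurable (ψ i) := fun i => (psi_continuous hS i).measurable
  have hgc := continuous_of_mem_boundedLip hg
  obtain ⟨B, -, hB, -⟩ := hg
  have hfC : ∀ i z, |f i z| ≤ C := fun i z => by
    rw [abs_of_nonneg (hS.pos.le.trans (hS.lower i z))]; exact hS.upper i z
  have hfin : ∀ i, IsFiniteMeasure (m.withDensity fun z => ENNReal.ofReal (f i z)) := fun i =>
    isFiniteMeasure_withDensity_ofReal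
      (Integrable.of_bound (weight_continuous hS i).aestronglyMeasurable C
        (Eventually.of_forall (hfC i))).2
  rw [renewalMeasure, renewalMean, integral_finsetSum_measure, integral_finsetSum]
  · refine Finset.sum_congr rfl fun i _ => ?_
    rw [integral_smul_measure, integral_map (hψ i).aemeasurable hgc.aestronglyMeasurable,
      integral_const_mul, integral_withDensity_eq_integral_toReal_smul
        (weight_continuous hS i).measurable.ennreal_ofReal (by simp)]
    rw [smul_eq_mul]
    congr 1
    refine integral_congr_ae (Eventually.of_forall fun z => ?_)
    dsimp only
    rw [ENNReal.toReal_ofReal (hS.pos.le.trans (hS.lower i z)), smul_eq_mul]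
  · intro i _
    refine Integrable.const_mul (Integrable.of_bound (C := C * B) ?_
      (Eventually.of_forall fun z => ?_)) _
    · exact ((weight_continuous hS i).mul (hgc.comp (psi_continuous hS i))).aestronglyMeasurable
    · rw [norm_mul]
      exact mul_le_mul (hfC i z) (hB _) (abs_nonneg _) ((abs_nonneg _).trans (hfC i z))
  · intro i _
    refine Integrable.smul_measure ?_ (p.apply_ne_top i)
    have := Measure.isFiniteMeasure_map (m.withDensity fun z => ENNReal.ofReal (f i z)) (ψ i)
    exact Integrable.of_bound hgc.aestronglyMeasurable B (Eventually.of_forall hB)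

/-- The limit distribution at the stopping times. -/
theorem exists_renewal_distribution (hS : IsContractingSystem ψ f ρ R M c C) (hp : ∀ i, p i ≠ 0)
    [IsProbabilityMeasure m] (hm : m = ∑ i, p i • m.map (ψ i)) :
    ∃ ν : Measure ℝ, IsProbabilityMeasure ν ∧ ν ≪ m ∧ m ≪ ν ∧ (∀ᵐ z ∂ν, z ∈ Set.Icc (-R) R) ∧
      ∀ g ∈ boundedLip, ∫ z, g z ∂ν = renewalMean p ψ f m g / renewalMean p ψ f m fun _ => 1 := by
  have hone : (fun _ => 1 : ℝ → ℝ) ∈ boundedLip := ⟨1, 0, by simp, by simp⟩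
  have hΛ := renewalMean_one_pos hS p m
  set ν₀ := renewalMeasure p ψ f m with hν₀
  have hreal : ν₀.real Set.univ = renewalMean p ψ f m fun _ => 1 := by
    rw [← integral_renewalMeasure hS hone]
    simp [hν₀]
  -- The real value of a measure is 0 both for mass 0 and for mass ∞, so its positivity excludes
  -- both.
  have h0 : ν₀ Set.univ ≠ 0 := fun h => by
    rw [measureReal_def, h, ENNReal.toReal_zero] at hreal
    linarith
  have htop : ν₀ Set.univ ≠ ⊤ := fun h => by
    rw [measureReal_def, h, ENNReal.toReal_top] at hreal
    linarith
  have hψ : ∀ i, Measurable (ψ i) := fun i => (psi_continuous hS i).measurable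
  have hzero := fun {E : Set ℝ} (hE : MeasurableSet E) => renewalMeasure_eq_zero_iff hS hp hm hE
  have hc0 : (ν₀ Set.univ)⁻¹ ≠ 0 := ENNReal.inv_ne_zero.2 htop
  have hνm : (ν₀ Set.univ)⁻¹ • ν₀ ≪ m := Measure.AbsolutelyContinuous.mk fun E hE h => by
    rw [Measure.smul_apply, (hzero hE).2 h, smul_zero]
  refine ⟨(ν₀ Set.univ)⁻¹ • ν₀, ⟨?_⟩, hνm, ?_, hνm.ae_le ?_, fun g hg => ?_⟩
  · rw [Measure.smul_apply, smul_eq_mul, ENNReal.inv_mul_cancel h0 htop]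
  · refine Measure.AbsolutelyContinuous.mk fun E hE h => (hzero hE).1 ?_
    rw [Measure.smul_apply, smul_eq_mul] at h
    exact (mul_eq_zero.1 h).resolve_left hc0
  · have hI : MeasurableSet (Set.Icc (-R) R)ᶜ := measurableSet_Icc.compl
    change m (Set.Icc (-R) R)ᶜ = 0
    rw [stationary_apply hψ hm hI]
    refine Finset.sum_eq_zero fun i _ => mul_eq_zero_of_right _ ?_
    refine measure_mono_null (fun z hz => ?_) (measure_empty (μ := m))
    exact hz (abs_le.1 (hS.range i z))
  · rw [integral_smul_measure, integral_renewalMeasure hS hg, ENNReal.toReal_inv,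
      ← measureReal_def, hreal, smul_eq_mul, inv_mul_eq_div]

end Measures

/-! ### Arcs of the projective line and their boundaries. -/

section Intervals

lemma lineAt_eq_iff (s t : ℝ) : lineAt s = lineAt t ↔ ∃ n : ℤ, s = t + n * Real.pi := by
  rw [lineAt, lineAt, Projectivization.mk_eq_mk_iff']
  constructor
  · rintro ⟨c, hc⟩
    have h0 := congrArg (fun v : Plane => v 0) hc
    have h1 := congrArg (fun v : Plane => v 1) hc
    simp only [PiLp.smul_apply, smul_eq_mul, Matrix.cons_val_zero, Matrix.cons_val_one,
      Matrix.cons_val_fin_one] at h0 h1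
    have h2 : Real.sin (s - t) = 0 := by
      rw [Real.sin_sub, ← h0, ← h1]
      ring
    obtain ⟨n, hn⟩ := Real.sin_eq_zero_iff.1 h2
    exact ⟨n, by linarith⟩
  · rintro ⟨n, rfl⟩
    refine ⟨(-1) ^ n, plane_ext ?_ ?_⟩
    · simp [Real.cos_add_int_mul_pi]
    · simp [Real.sin_add_int_mul_pi]

/-- The angle of `line z`. -/
def angle (z : ℝ) : ℝ := Real.pi / 2 + Real.arctan (Real.exp z)

lemma angle_strictMono : StrictMono angle := fun _ _ h =>
  add_lt_add_right (Real.arctan_strictMono (Real.exp_strictMono h)) _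

lemma abs_angle_sub_lt (x y : ℝ) : |angle x - angle y| < Real.pi := by
  have h1 := Real.arctan_lt_pi_div_two (Real.exp x)
  have h2 := Real.arctan_lt_pi_div_two (Real.exp y)
  have h3 := Real.neg_pi_div_two_lt_arctan (Real.exp x)
  have h4 := Real.neg_pi_div_two_lt_arctan (Real.exp y)
  rw [abs_lt, angle, angle]
  constructor <;> linarith

lemma line_eq_lineAt (z : ℝ) : line z = lineAt (angle z) := by
  rw [line, perpLine_eq (one_exp_ne_zero z), lineAt, Projectivization.mk_eq_mk_iff']
  have h : Real.sqrt (1 + Real.exp z ^ 2) ≠ 0 := by positivity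
  refine ⟨Real.sqrt (1 + Real.exp z ^ 2), plane_ext ?_ ?_⟩
  · simp only [PiLp.smul_apply, smul_eq_mul, Matrix.cons_val_zero]
    rw [angle, add_comm (Real.pi / 2), Real.cos_add_pi_div_two, Real.sin_arctan]
    field_simp
  · simp only [PiLp.smul_apply, smul_eq_mul, Matrix.cons_val_one, Matrix.cons_val_fin_one]
    rw [angle, add_comm (Real.pi / 2), Real.sin_add_pi_div_two, Real.cos_arctan]
    field_simp

lemma preimage_line_image_lineAt (J : Set ℝ) :
    line ⁻¹' (lineAt '' J) = ⋃ n : ℤ, (fun z => angle z + n * Real.pi) ⁻¹' J := by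
  ext z
  simp only [Set.mem_preimage, Set.mem_image, Set.mem_iUnion]
  rw [line_eq_lineAt]
  constructor
  · rintro ⟨t, ht, h⟩
    obtain ⟨n, rfl⟩ := (lineAt_eq_iff _ _).1 h
    exact ⟨n, ht⟩
  · rintro ⟨n, hn⟩
    exact ⟨_, hn, (lineAt_eq_iff _ _).2 ⟨n, rfl⟩⟩

/-- The frontier of an order connected set of reals is countable. -/
lemma countable_frontier_of_ordConnected {J : Set ℝ} (hJ : J.OrdConnected) :
    (frontier J).Countable := by
  -- A boundary point strictly between two elements of J would be interior, so it is the supremum or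
  -- the infimum.
  have hsub : frontier J ⊆ {b | IsLUB J b} ∪ {b | IsGLB J b} := by
    intro b hb
    by_cases h1 : b ∈ upperBounds J
    · exact Or.inl (isLUB_of_mem_closure h1 (frontier_subset_closure hb))
    by_cases h2 : b ∈ lowerBounds J
    · exact Or.inr (isGLB_of_mem_closure h2 (frontier_subset_closure hb))
    simp only [upperBounds, lowerBounds, Set.mem_ofPred_eq, not_forall, not_le] at h1 h2
    obtain ⟨y, hy, hby⟩ := h1
    obtain ⟨x, hx, hxb⟩ := h2
    refine absurd (mem_interior_iff_mem_nhds.2 ?_) hb.2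
    exact mem_of_superset (Icc_mem_nhds hxb hby) (hJ.out hx hy)
  refine Set.Countable.mono hsub (Set.Countable.union ?_ ?_)
  · exact Set.Subsingleton.countable fun x hx y hy => IsLUB.unique hx hy
  · exact Set.Subsingleton.countable fun x hx y hy => IsGLB.unique hx hy

lemma countable_frontier_union {s t : Set ℝ} (hs : (frontier s).Countable)
    (ht : (frontier t).Countable) : (frontier (s ∪ t)).Countable :=
  (hs.union ht).mono ((frontier_union_subset s t).trans
    (Set.union_subset_union Set.inter_subset_left Set.inter_subset_right))

/-- The part of an interval in the open second quadrant has countable boundary. -/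
lemma countable_frontier_preimage_line {S : Set RP1} (hS : IsInterval S) :
    (frontier (line ⁻¹' S)).Countable := by
  obtain ⟨J, hJ, rfl⟩ := hS
  rw [preimage_line_image_lineAt]
  set E : ℤ → Set ℝ := fun n => (fun z => angle z + n * Real.pi) ⁻¹' J with hE
  have hEo : ∀ n, (frontier (E n)).Countable := fun n =>
    countable_frontier_of_ordConnected (hJ.preimage_mono fun x y h =>
      add_le_add_left (angle_strictMono.monotone h) _)
  by_cases huniv : ⋃ n, E n = Set.univ
  · rw [huniv, frontier_univ]
    exact Set.countable_empty
  by_cases hemp : ⋃ n, E n = ∅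
  · rw [hemp, frontier_empty]
    exact Set.countable_empty
  obtain ⟨z₀, hz₀⟩ := (Set.ne_univ_iff_exists_notMem _).1 huniv
  obtain ⟨z₁, hz₁⟩ := Set.nonempty_iff_ne_empty.2 hemp
  obtain ⟨m, hm⟩ := Set.mem_iUnion.1 hz₁
  -- If z₀ belongs to no translate, the translates that meet J are neighbours: otherwise J would
  -- contain angle z₀ + (n + 1)π, since all angles differ by less than π. Hence at most three pieces
  -- occur in the union below.
  have key : ∀ {n l : ℤ} {x y : ℝ}, x ∈ E n → y ∈ E l → l ≤ n + 1 := by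
    intro n l x y hx hy
    by_contra! hlt
    refine hz₀ (Set.mem_iUnion.2 ⟨n + 1, hJ.out hx hy ⟨?_, ?_⟩⟩)
    · have h1 := (abs_lt.1 (abs_angle_sub_lt x z₀)).2
      push_cast
      linarith
    · have h1 := (abs_lt.1 (abs_angle_sub_lt z₀ y)).2
      have h2 : ((n + 1 + 1 : ℤ) : ℝ) ≤ l := by exact_mod_cast hlt
      have h3 := mul_le_mul_of_nonneg_right h2 Real.pi_pos.le
      push_cast at h3 ⊢
      linarith
  have hU : ⋃ n, E n = E (m - 1) ∪ (E m ∪ E (m + 1)) := by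
    refine Set.Subset.antisymm (fun z hz => ?_) ?_
    · obtain ⟨n, hn⟩ := Set.mem_iUnion.1 hz
      have h1 := key hm hn
      have h2 := key hn hm
      have h3 : n = m - 1 ∨ n = m ∨ n = m + 1 := by omega
      rcases h3 with rfl | rfl | rfl
      · exact Or.inl hn
      · exact Or.inr (Or.inl hn)
      · exact Or.inr (Or.inr hn)
    · exact Set.union_subset (Set.subset_iUnion E _)
        (Set.union_subset (Set.subset_iUnion E _) (Set.subset_iUnion E _))
  rw [hU]
  exact countable_frontier_union (hEo _) (countable_frontier_union (hEo _) (hEo _))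

/-- Frequencies of intervals with null boundary, for lines in the open second quadrant. -/
lemma equidistributes_of_lip {x : ℕ → RP1} {ζ : ℕ → ℝ} (hx : ∀ᶠ j in atTop, x j = line (ζ j))
    {ν : Measure ℝ} [IsProbabilityMeasure ν]
    (h : ∀ g ∈ boundedLip, Tendsto (mean fun j => g (ζ (j + 1))) atTop (𝓝 (∫ y, g y ∂ν))) :
    Equidistributes x (ν.map line) := by
  intro S _ hS0
  refine hasFrequency_of_lip measurableEmbedding_line hx
    (fun g B D hB hD => h g ⟨B, D, hB, hD⟩) ?_
  rw [measurableEmbedding_line.map_apply] at hS0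
  exact measure_mono_null (continuous_line.frontier_preimage_subset S) hS0

end Intervals

/-! ### Assembly: with and without a common minor direction. -/

section Main

variable {k : ℕ}

/-- Averages at the stopping times when all matrices have the same minor eigendirection. -/
lemma ae_mean_stopIndex_of_common_fixed {b : ℝ} (hb : 1 < b) (A : Fin k → GL (Fin 2) ℝ)
    (hpos : ∀ i r c, 0 < (A i).val r c)
    (hnorm : ∀ i, ‖Matrix.toEuclideanCLM (𝕜 := ℝ) (A i).val‖ < 1) (d : Fin k → Plane)
    (p : PMF (Fin k)) (hp : ∀ i, p i ≠ 0) {z₀ : ℝ} (hz₀ : ∀ i, psi A i z₀ = z₀)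
    {ν : Measure ℝ} [IsProbabilityMeasure ν] (hν : ∀ᵐ z ∂ν, z = z₀) {N : ℕ} (hN1 : 1 ≤ N)
    {θ : RP1} (hθ : θ ∈ goodDirections A) :
    ∀ᵐ a ∂bernoulli p, ∃ ζ : ℕ → ℝ,
      (∀ᶠ j in atTop, orbit A a θ (stopIndex b A d θ N a j) = line (ζ j)) ∧
      ∀ g ∈ boundedLip, Tendsto (mean fun j => g (ζ (j + 1))) atTop (𝓝 (∫ z, g z ∂ν)) := by
  obtain ⟨ρ, R, M, c, C, hS⟩ := exists_isContractingSystem hb A hpos hnorm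
  obtain ⟨w, hw, rfl⟩ := exists_perpLine θ
  obtain ⟨c', C', hc', hweight⟩ := exists_weight_bounds hb A hnorm
  filter_upwards [ae_exists_line A hpos p hp hθ] with a hline
  obtain ⟨n, z, hz⟩ := hline
  have hwalk := orbit_wordLength_eq_walk b A hpos d a hw hz
  set x := walk (skew (psi A) (lineWeight b A))
    (z, wordLength b A d (perpLine w) a n) (fun j => a (n + j)) with hx
  have hτ : Tendsto (fun j => stopIndex b A d (perpLine w) N a j) atTop atTop :=
    tendsto_firstIndex (S := fun n => wordLength b A d (perpLine w) a n)
      (wordLength_zero b A d a hw) hc' (fun n => by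
        rw [wordLength_succ_sub b A d a hw]
        exact (hweight _ _ (trWalk_ne_zero A a hw n)).1) (fun n => by
        rw [wordLength_succ_sub b A d a hw]
        exact (hweight _ _ (trWalk_ne_zero A a hw n)).2) hN1
  -- A common fixed point attracts every trajectory, whatever the letters and the stopping times.
  have hdist : ∀ j, |(x j).1 - z₀| ≤ ρ ^ j * |z - z₀| := by
    intro j
    induction j with
    | zero => simp [hx, walk]
    | succ j ih =>
      have h1 := hS.contr (a (n + j)) (x j).1 z₀
      rw [hz₀] at h1
      refine h1.trans ?_
      rw [pow_succ', mul_assoc]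
      exact mul_le_mul_of_nonneg_left ih hS.rho_nonneg
  have hlim : Tendsto (fun j => (x j).1) atTop (𝓝 z₀) := by
    have h1 := (tendsto_pow_atTop_nhds_zero_of_lt_one hS.rho_nonneg hS.rho_lt_one).mul_const
      |z - z₀|
    rw [zero_mul] at h1
    exact tendsto_iff_norm_sub_tendsto_zero.2 (squeeze_zero (fun j => norm_nonneg _) hdist h1)
  have hcoord : Tendsto (fun l => lineCoord (orbit A a (perpLine w) l)) atTop (𝓝 z₀) := by
    refine (tendsto_add_atTop_iff_nat n).1 (hlim.congr fun j => ?_)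
    rw [add_comm j n, (hwalk j).1, lineCoord_line]
  refine ⟨fun j => lineCoord (orbit A a (perpLine w) (stopIndex b A d (perpLine w) N a j)), ?_,
    fun g hg => ?_⟩
  · filter_upwards [hτ.eventually_ge_atTop n] with j hj
    obtain ⟨l, hl⟩ := Nat.exists_eq_add_of_le hj
    rw [hl, (hwalk l).1, lineCoord_line]
  · have h1 : ∫ y, g y ∂ν = g z₀ := by
      rw [integral_congr_ae (g := fun _ => g z₀) (hν.mono fun y hy => by rw [hy])]
      simp
    rw [h1]
    have h2 := ((continuous_of_mem_boundedLip hg).tendsto z₀).comp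
      (hcoord.comp ((tendsto_add_atTop_iff_nat 1).2 hτ))
    refine h2.cesaro.congr fun I => ?_
    rw [mean, inv_mul_eq_div]
    rfl

lemma one_lt_logBase (A : Fin k → GL (Fin 2) ℝ) : 1 < logBase A := by
  unfold logBase
  split_ifs <;> norm_num

/-- The limit distribution at the stopping times, in the coordinate of the open second quadrant. -/
theorem exists_limit_distribution (A : Fin k → GL (Fin 2) ℝ) (d : Fin k → Plane) (p : PMF (Fin k))
    (hpos : ∀ i r c, 0 < (A i).val r c)
    (hnorm : ∀ i, ‖Matrix.toEuclideanCLM (𝕜 := ℝ) (A i).val‖ < 1) (hp : ∀ i, p i ≠ 0)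
    {m : Measure ℝ} [IsProbabilityMeasure m] (hm : m = ∑ i, p i • m.map (psi A i)) :
    ∃ ν : Measure ℝ, IsProbabilityMeasure ν ∧ ν ≪ m ∧ m ≪ ν ∧
      (¬ HasCommonMinorDirection A → NullSingletonClass ν) ∧
      ∀ θ ∈ goodDirections A, ∀ N : ℕ, 1 ≤ N → ∀ᵐ a ∂bernoulli p, ∃ ζ : ℕ → ℝ,
        (∀ᶠ j in atTop, orbit A a θ (stopIndex (logBase A) A d θ N a j) = line (ζ j)) ∧
        ∀ g ∈ boundedLip, Tendsto (mean fun j => g (ζ (j + 1))) atTop (𝓝 (∫ z, g z ∂ν)) := by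
  obtain ⟨i₀⟩ : Nonempty (Fin k) := by
    by_contra hemp
    rw [not_nonempty_iff] at hemp
    exact absurd (sum_toReal_pmf p) (by simp)
  have hb := one_lt_logBase A
  obtain ⟨ρ, R, M, c, C, hS⟩ := exists_isContractingSystem hb A hpos hnorm
  -- With a common minor direction m is a point mass and is itself the limit; otherwise the limit is
  -- the normalised renewal measure, which inherits the absence of atoms from m.
  by_cases hminor : HasCommonMinorDirection A
  · obtain ⟨z₀, hz₀⟩ := (hasCommonMinorDirection_iff A hpos i₀).1 hminor
    exact ⟨m, inferInstance, Measure.AbsolutelyContinuous.rfl, Measure.AbsolutelyContinuous.rfl,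
      fun h => absurd hminor h, fun θ hθ N hN =>
      ae_mean_stopIndex_of_common_fixed hb A hpos hnorm d p hp hz₀
        (ae_eq_of_common_fixed hS hm hz₀) hN hθ⟩
  · obtain ⟨ν, hν, hνm, hmν, hR, hint⟩ := exists_renewal_distribution hS hp hm
    refine ⟨ν, hν, hνm, hmν, fun _ => ⟨fun z => hνm ?_⟩, fun θ hθ N hN =>
      ae_mean_stopIndex hb A hpos hnorm d p hp hS hm hN
        (noTwistedFixed A hpos p hp hminor hS hN) hR hint hθ⟩
    choose x hx using fun i => exists_fixed_of_contr hS.rho_nonneg hS.rho_lt_one (hS.contr i)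
    obtain ⟨i, hi⟩ : ∃ i, x i ≠ x i₀ := by
      by_contra! hall
      exact hminor ((hasCommonMinorDirection_iff A hpos i₀).2 ⟨x i₀, fun i => by
        rw [← hall i]; exact hx i⟩)
    have := nullSingletonClass_of_stationary hS hp (psi_injective A hpos) hm (hx i) (hx i₀) hi
    exact measure_singleton z

end Main

end SelfAffine

end

theorem mainTheorem6 {k : ℕ} (A : Fin k → GL (Fin 2) ℝ) (d : Fin k → Plane) (p : PMF (Fin k))
    (hpos : ∀ i r c, 0 < (A i).val r c)
    (hnorm : ∀ i, ‖Matrix.toEuclideanCLM (𝕜 := ℝ) (A i).val‖ < 1)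
    (hp : ∀ i, p i ≠ 0)
    (μF : Measure RP1) (hμF : SelfAffine.IsFurstenberg A p μF) :
    ∃ νF : Measure RP1, IsProbabilityMeasure νF ∧ νF ≪ μF ∧ μF ≪ νF ∧
      ∀ θ ∈ SelfAffine.goodDirections A, ∀ N : ℕ, 1 ≤ N →
        ∀ᵐ a ∂SelfAffine.bernoulli p,
          SelfAffine.Equidistributes
            (fun j => SelfAffine.orbit A a θ
              (SelfAffine.stopIndex (SelfAffine.logBase A) A d θ N a j)) νF ∧
          (¬ SelfAffine.HasCommonMinorDirection A →
            ∀ S, SelfAffine.IsInterval S →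
              SelfAffine.HasFrequency
                (fun j => SelfAffine.orbit A a θ
                  (SelfAffine.stopIndex (SelfAffine.logBase A) A d θ N a j)) νF S) := by
  have := hμF.prob
  have hmp : IsProbabilityMeasure (μF.map SelfAffine.lineCoord) :=
    Measure.isProbabilityMeasure_map SelfAffine.measurable_lineCoord.aemeasurable
  -- The Furstenberg measure is carried by the chart `line`, so everything is done in its coordinate
  -- and transported back.
  obtain ⟨ν, hν, hνm, hmν, hatom, hlim⟩ := SelfAffine.exists_limit_distribution A d p hpos hnorm hp
    (SelfAffine.map_lineCoord_stationary A hpos p hμF)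
  have hμ := SelfAffine.map_line_map_lineCoord A hpos p hμF
  have hmeas := SelfAffine.continuous_line.measurable
  refine ⟨ν.map SelfAffine.line, Measure.isProbabilityMeasure_map hmeas.aemeasurable, ?_, ?_,
    fun θ hθ N hN => ?_⟩
  · have h := hνm.map hmeas
    rwa [hμ] at h
  · have h := hmν.map hmeas
    rwa [hμ] at h
  · filter_upwards [hlim θ hθ N hN] with a ha
    obtain ⟨ζ, hζ, h⟩ := ha
    refine ⟨SelfAffine.equidistributes_of_lip hζ h, fun hminor S hS => ?_⟩
    have := hatom hminor
    -- Only the boundary inside the chart matters; it is countable, hence null for an atomless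
    -- measure.
    exact SelfAffine.hasFrequency_of_lip SelfAffine.measurableEmbedding_line hζ
      (fun g B D hB hD => h g ⟨B, D, hB, hD⟩)
      ((SelfAffine.countable_frontier_preimage_line hS).measure_zero ν)
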